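/- An L-frame is the union of a non-degenerate horizontal and a non-degenerate vertical line segment in the plane that share an endpoint, the corner; there are four types of L-frames, according to whether the horizontal segment leaves the corner to the left or to the right and whether the vertical segment leaves it upwards or downwards. The intersection graph of a finite family of L-frames has one vertex for each L-frame, and two vertices are adjacent if and only if the two L-frames have a point in common. The Minimum Dominating Set problem is linear-time solvable on the intersection graphs of families of L-frames of the same type such that all the L-frames intersect a common vertical line and a common horizontal line. Precisely: there is a program for the unit-cost random access machine (with addition, truncated subtraction, multiplication, integer division, comparison, and indirect addressing) such that for every $k$ there is a constant $C$ with the following property. Let $L_0,\dots,L_{n-1}$ be L-frames of the same type, all of which meet a vertical line $x=a$ and a horizontal line $y=b$. Let $f$ and $g$ be strictly increasing maps from the set of $x$-coordinates, respectively $y$-coordinates, of the corners and segment endpoints of these L-frames to $\{0,1,\dots,(n+1)^k\}$ (for instance, the identity, if the coordinates are themselves such integers). On the input that consists of $n$ and of the corner and the two other endpoints of each $L_i$, each coordinate $x$ or $y$ being written as the number $f(x)$ or $g(y)$, the program halts after at most $C(n+1)$ steps, never holds a number larger than $C(n+1)^C$ (that is, it works with words of $O(\log n)$ bits), and outputs a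 list without repetitions of the indices of the vertices of a minimum-cardinality dominating set of the intersection graph. The lines are not part of the input, and the L-frames may be listed in any order. -/

import Mathlib

/-! ### L-frames in the plane and their intersection graphs -/

/-- An L-frame: the union of a nondegenerate horizontal segment, from the corner `(cx, cy)` to
`(hx, cy)`, and a nondegenerate vertical segment, from the corner to `(cx, vy)`. -/
structure LFrame where
  /-- x-coordinate of the corner -/
  cx : ℝ
  /-- y-coordinate of the corner -/
  cy : ℝ
  /-- x-coordinate of the other endpoint of the horizontal segment -/
  hx : ℝ
  /-- y-coordinate of the other endpoint of the vertical segment -/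
  vy : ℝ
  hx_ne : hx ≠ cx
  vy_ne : vy ≠ cy

namespace LFrame

/-- The set of points of an L-frame. -/
def carrier (L : LFrame) : Set (ℝ × ℝ) :=
  segment ℝ (L.cx, L.cy) (L.hx, L.cy) ∪ segment ℝ (L.cx, L.cy) (L.cx, L.vy)

/-- Two L-frames are of the same one of the four types: their horizontal segments leave the corner
in the same direction, and so do their vertical segments. -/
def SameType (L M : LFrame) : Prop :=
  (L.cx < L.hx ↔ M.cx < M.hx) ∧ (L.cy < L.vy ↔ M.cy < M.vy)

/-- The intersection graph of a finite family of L-frames. -/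
def interGraph {n : ℕ} (F : Fin n → LFrame) : SimpleGraph (Fin n) where
  Adj i j := i ≠ j ∧ ((F i).carrier ∩ (F j).carrier).Nonempty
  symm := ⟨fun _ _ h => ⟨h.1.symm, by rw [Set.inter_comm]; exact h.2⟩⟩
  loopless := ⟨fun _ h => h.1 rfl⟩

/-- The x-coordinates that occur in a family of L-frames. -/
def xCoords {n : ℕ} (F : Fin n → LFrame) : Set ℝ :=
  Set.range (fun i => (F i).cx) ∪ Set.range (fun i => (F i).hx)

/-- The y-coordinates that occur in a family of L-frames. -/
def yCoords {n : ℕ} (F : Fin n → LFrame) : Set ℝ :=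
  Set.range (fun i => (F i).cy) ∪ Set.range (fun i => (F i).vy)

/-- The input words for a family of `n` L-frames, where a coordinate `x` (respectively `y`) is
written as the natural number `f x` (respectively `g y`): the number `n`, and then the four
coordinates of each L-frame in turn. -/
def inputWords {n : ℕ} (F : Fin n → LFrame) (f g : ℝ → ℕ) : List ℕ :=
  n :: (List.ofFn fun i =>
    [f (F i).cx, g (F i).cy, f (F i).hx, g (F i).vy]).flatten

end LFrame

/-! ### Minimum dominating sets -/

/-- `D` is a dominating set of `G`: every vertex outside `D` has a neighbour in `D`. -/
def IsDominatingSet {V : Type*} (G : SimpleGraph V) (D : Finset V) : Prop :=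
  ∀ v, v ∉ D → ∃ u ∈ D, G.Adj v u

/-- `D` is a dominating set of `G` of minimum cardinality. -/
def IsMinDominatingSet {V : Type*} (G : SimpleGraph V) (D : Finset V) : Prop :=
  IsDominatingSet G D ∧ ∀ E : Finset V, IsDominatingSet G E → D.card ≤ E.card

/-! ### Random access machines

A program is a finite list of instructions, acting on registers `0, 1, 2, …` and on a memory with
cells `0, 1, 2, …`. Registers and cells hold natural numbers. Every instruction takes one step. -/

namespace RAM

/-- The instructions of a random access machine. -/
inductive Instr where
  /-- `reg r := c` -/
  | const (r c : ℕ)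
  /-- `reg r := reg s + reg t` -/
  | add (r s t : ℕ)
  /-- `reg r := reg s - reg t`, or `0` if this is negative -/
  | sub (r s t : ℕ)
  /-- `reg r := reg s * reg t` -/
  | mul (r s t : ℕ)
  /-- `reg r := ⌊reg s / reg t⌋`, or `0` if `reg t = 0` -/
  | div (r s t : ℕ)
  /-- `reg r := mem (reg s)` -/
  | load (r s : ℕ)
  /-- `mem (reg r) := reg s` -/
  | store (r s : ℕ)
  /-- if `reg r < reg s`, jump to instruction `l`, otherwise go on -/
  | jlt (r s l : ℕ)

/-- A program is a finite list of instructions, numbered from `0`. -/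
abbrev Program := List Instr

/-- A configuration: the number of the next instruction, the registers, the memory. -/
structure Config where
  pc : ℕ
  reg : ℕ → ℕ
  mem : ℕ → ℕ

/-- The effect of one instruction. -/
def Instr.exec (c : Config) : Instr → Config
  | .const r a => ⟨c.pc + 1, Function.update c.reg r a, c.mem⟩
  | .add r s t => ⟨c.pc + 1, Function.update c.reg r (c.reg s + c.reg t), c.mem⟩
  | .sub r s t => ⟨c.pc + 1, Function.update c.reg r (c.reg s - c.reg t), c.mem⟩
  | .mul r s t => ⟨c.pc + 1, Function.update c.reg r (c.reg s * c.reg t), c.mem⟩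
  | .div r s t => ⟨c.pc + 1, Function.update c.reg r (c.reg s / c.reg t), c.mem⟩
  | .load r s => ⟨c.pc + 1, Function.update c.reg r (c.mem (c.reg s)), c.mem⟩
  | .store r s => ⟨c.pc + 1, c.reg, Function.update c.mem (c.reg r) (c.reg s)⟩
  | .jlt r s l => ⟨if c.reg r < c.reg s then l else c.pc + 1, c.reg, c.mem⟩

/-- The machine has halted when the next instruction lies outside the program. -/
def Halted (P : Program) (c : Config) : Prop := P.length ≤ c.pc

/-- One step; a halted configuration stays as it is. -/
def step (P : Program) (c : Config) : Config :=
  match P[c.pc]? with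
  | some i => i.exec c
  | none => c

/-- The initial configuration: the input words stand in memory from cell `0` on, and everything
else is zero. -/
def init (input : List ℕ) : Config := ⟨0, fun _ => 0, fun a => input.getD a 0⟩

/-- The configuration after `t` steps on a given input. -/
def run (P : Program) (input : List ℕ) (t : ℕ) : Config := (step P)^[t] (init input)

/-- The output words of a configuration: cell `0` holds their number, and they stand in memory
from cell `1` on. -/
def Config.output (c : Config) : List ℕ := (List.range (c.mem 0)).map fun a => c.mem (a + 1)

/-- All numbers in the registers and in the memory are at most `B`. -/
def Config.WordsLE (c : Config) (B : ℕ) : Prop := (∀ r, c.reg r ≤ B) ∧ ∀ a, c.mem a ≤ B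

/-- On the given input the program halts within `T` steps, never holds a number larger than `B`
on the way, and ends with an output that satisfies `Q`. -/
def Computes (P : Program) (input : List ℕ) (T B : ℕ) (Q : List ℕ → Prop) : Prop :=
  ∃ t ≤ T, (∀ s ≤ t, (run P input s).WordsLE B) ∧ Halted P (run P input t) ∧
    Q (run P input t).output

end RAM

set_option linter.constructorNameAsVariable false
set_option linter.unusedSimpArgs false
set_option linter.unusedVariables false

namespace RAM

/-! ### A structured language on top of the random access machine -/

/-! Geometry. If all frames have the same type and meet `x = a` and `y = b`, then each horizontal
arm runs from its corner at least to `x = a`, and each vertical arm at least to `y = b`. Hence two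
frames intersect exactly when neither corner is strictly beyond the other in both coordinates, where
`y` is reversed for two of the four types (`LFrame.inter_nonempty_iff`). Ordering the corners by `x`
and by `y`, with ties broken so that tied corners become inversions, turns the intersection graph
into the inversion graph of a permutation `P`. The coordinates are polynomial in `n`, so a bounded
number of radix passes computes both orders in linear time.

Combinatorics. Sentinel points are added at both ends of the permutation, and progress is measured
by a frontier `(X, Y)`: every point that is not both to the right of `X` and above `Y` is dominated.
Frontiers grow by four moves (`Reach`): out to the rightmost point of value at most `Y`; up to the
highest point among the first `X`; to a single point; or to an inverted pair at cost two. Each move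
is justified by one or two actual points (`sound_right`, `sound_up`, `sound_single`,
`sound_double`). Conversely, every dominating set is matched by moves of no larger total cost
(`PermData.exists_reach`). For the latter one looks at the rightmost and the topmost chosen point:
if they coincide, or if one of them is not needed, a single move restores it; otherwise each has a
private point, and these two force all other chosen points either to be superfluous or to lie to the
lower left, so that the two form a pair move. The optimum is therefore the least cost of a frontier
in the last column, less one for the isolated last sentinel (`solves_of_sound`).

Linear time. Frontiers are generated by increasing cost, and dominated ones are discarded. Moves to
the right or up are needed only from the largest row `q` and the largest column `p` of a level.
Single points and pairs come from one sweep over the columns beyond `p`. It carries the rightmost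
old frontier that no point of value at most `q` has blocked, and the least value `nu` above `q` seen
since that frontier (`Window`): a single point must lie below `nu`, and the best pair is determined
by `nu` and the current column. The sweep stops when no remaining value is below `nu`, which happens
no later than just after the largest column of the next level. So consecutive levels touch almost
disjoint ranges of columns and the costs telescope (`wp_sweep`, `LevelStart.next_level`,
`wp_levels`). Witness sets share a tree of predecessor pointers, so a move takes constant time.

Machine. The algorithm is written in a small structured language with a total-correctness calculus
`Cmd.wp`, which also checks word sizes. `Cmd.comp_spec` translates this into machine code whose
running time is at most a constant times the number of executed commands. -/

/-- The variables of structured programs. -/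
inductive Var where
  | n | b | m | fl | i | j | d | e | pw | km | key | x | z | mu | nu | p | q | pp
  | par | np | nq | nqn | qn | cnt | w | t | y
deriving DecidableEq

/-- The arrays of structured programs. -/
inductive Arr where
  | KX | KY | OX | OY | RY | CNT | BUCK | P | Q | T | R | S | Y | ND | PAR | PT
deriving DecidableEq

/-- States of structured programs: variables, arrays, the input/output area, and a counter of
executed commands. -/
structure St where
  v : Var → ℕ
  a : Arr → ℕ → ℕ
  io : ℕ → ℕ
  clk : ℕ

namespace St

/-- Only the counter advances. -/
def tick (s : St) : St := ⟨s.v, s.a, s.io, s.clk + 1⟩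

/-- Assignment to a variable. -/
def set (s : St) (x : Var) (m : ℕ) : St := ⟨Function.update s.v x m, s.a, s.io, s.clk + 1⟩

/-- Assignment to an array element. -/
def put (s : St) (k : Arr) (i m : ℕ) : St :=
  ⟨s.v, Function.update s.a k (Function.update (s.a k) i m), s.io, s.clk + 1⟩

/-- Assignment to a cell of the input/output area. -/
def out (s : St) (i m : ℕ) : St := ⟨s.v, s.a, Function.update s.io i m, s.clk + 1⟩

@[simp] theorem tick_v (s : St) : s.tick.v = s.v := rfl
@[simp] theorem tick_a (s : St) : s.tick.a = s.a := rfl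
@[simp] theorem tick_io (s : St) : s.tick.io = s.io := rfl
@[simp] theorem tick_clk (s : St) : s.tick.clk = s.clk + 1 := rfl
@[simp] theorem set_v (s : St) (x y : Var) (m : ℕ) :
    (s.set x m).v y = if y = x then m else s.v y := by simp [set, Function.update_apply]
@[simp] theorem set_a (s : St) (x : Var) (m : ℕ) : (s.set x m).a = s.a := rfl
@[simp] theorem set_io (s : St) (x : Var) (m : ℕ) : (s.set x m).io = s.io := rfl
@[simp] theorem set_clk (s : St) (x : Var) (m : ℕ) : (s.set x m).clk = s.clk + 1 := rfl
@[simp] theorem put_v (s : St) (k : Arr) (i m : ℕ) : (s.put k i m).v = s.v := rfl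
@[simp] theorem put_a (s : St) (k l : Arr) (i m : ℕ) :
    (s.put k i m).a l = if l = k then Function.update (s.a k) i m else s.a l := by
  simp [put, Function.update_apply]
@[simp] theorem put_io (s : St) (k : Arr) (i m : ℕ) : (s.put k i m).io = s.io := rfl
@[simp] theorem put_clk (s : St) (k : Arr) (i m : ℕ) : (s.put k i m).clk = s.clk + 1 := rfl
@[simp] theorem out_v (s : St) (i m : ℕ) : (s.out i m).v = s.v := rfl
@[simp] theorem out_a (s : St) (i m : ℕ) : (s.out i m).a = s.a := rfl
@[simp] theorem out_io (s : St) (i m : ℕ) : (s.out i m).io = Function.update s.io i m := rfl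
@[simp] theorem out_clk (s : St) (i m : ℕ) : (s.out i m).clk = s.clk + 1 := rfl

end St

/-- Expressions. -/
inductive Expr where
  | var (x : Var)
  | lit (c : ℕ)
  | add (a b : Expr)
  | sub (a b : Expr)
  | mul (a b : Expr)
  | div (a b : Expr)
  | arr (k : Arr) (i : Expr)
  | io (i : Expr)

namespace Expr

/-- The value of an expression. -/
@[simp] def eval (s : St) : Expr → ℕ
  | var x => s.v x
  | lit c => c
  | add a b => a.eval s + b.eval s
  | sub a b => a.eval s - b.eval s
  | mul a b => a.eval s * b.eval s
  | div a b => a.eval s / b.eval s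
  | arr k i => s.a k (i.eval s)
  | io i => s.io (i.eval s)

/-- The evaluation of an expression stays within words of size `B`, and reads the input/output
area only below its end `off`. -/
@[simp] def ok (B off : ℕ) (s : St) : Expr → Prop
  | var _ => True
  | lit c => c ≤ B
  | add a b => a.ok B off s ∧ b.ok B off s ∧ a.eval s + b.eval s ≤ B
  | sub a b => a.ok B off s ∧ b.ok B off s
  | mul a b => a.ok B off s ∧ b.ok B off s ∧ a.eval s * b.eval s ≤ B
  | div a b => a.ok B off s ∧ b.ok B off s
  | arr _ i => i.ok B off s ∧ off + 16 * (i.eval s + 1) ≤ B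
  | io i => i.ok B off s ∧ i.eval s < off

end Expr

/-- Structured commands. The conditions of `ite` and `loop` are `a < b`. -/
inductive Cmd where
  | assign (x : Var) (e : Expr)
  | store (k : Arr) (i e : Expr)
  | write (i e : Expr)
  | seq (c d : Cmd)
  | ite (a b : Expr) (c d : Cmd)
  | loop (a b : Expr) (c : Cmd)

infixr:60 " ;; " => Cmd.seq

namespace Cmd

/-- The command terminates from the state `s` in a state satisfying `Q`, with words of size at
most `B` and accesses to the input/output area below `off`. -/
def wp (B off : ℕ) : Cmd → (St → Prop) → St → Prop
  | assign x e, Q, s => e.ok B off s ∧ Q (s.set x (e.eval s))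
  | store k i e, Q, s => i.ok B off s ∧ e.ok B off s ∧ off + 16 * (i.eval s + 1) ≤ B ∧
      Q (s.put k (i.eval s) (e.eval s))
  | write i e, Q, s => i.ok B off s ∧ e.ok B off s ∧ i.eval s < off ∧
      Q (s.out (i.eval s) (e.eval s))
  | seq c d, Q, s => c.wp B off (d.wp B off Q) s
  | ite a b c d, Q, s => a.ok B off s ∧ b.ok B off s ∧
      (a.eval s < b.eval s → c.wp B off Q s.tick) ∧ (¬ a.eval s < b.eval s → d.wp B off Q s.tick)
  | .loop a b c, Q, s => ∃ I : ℕ → St → Prop, (∃ k, I k s) ∧ ∀ k s, I k s →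
      a.ok B off s ∧ b.ok B off s ∧
      (a.eval s < b.eval s → c.wp B off (fun s' => ∃ k' < k, I k' s') s.tick) ∧
      (¬ a.eval s < b.eval s → Q s.tick)

variable {B off : ℕ}

theorem wp_mono {c : Cmd} {Q Q' : St → Prop} (h : ∀ s, Q s → Q' s) {s : St}
    (hc : c.wp B off Q s) : c.wp B off Q' s := by
  induction c generalizing Q Q' s with
  | assign x e => exact ⟨hc.1, h _ hc.2⟩
  | store k i e => exact ⟨hc.1, hc.2.1, hc.2.2.1, h _ hc.2.2.2⟩
  | write i e => exact ⟨hc.1, hc.2.1, hc.2.2.1, h _ hc.2.2.2⟩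
  | seq c d ihc ihd => exact ihc (fun s hs => ihd h hs) hc
  | ite a b c d ihc ihd =>
    exact ⟨hc.1, hc.2.1, fun hl => ihc h (hc.2.2.1 hl), fun hl => ihd h (hc.2.2.2 hl)⟩
  | loop a b c ih =>
    obtain ⟨I, h0, hI⟩ := hc
    exact ⟨I, h0, fun k s hs => ⟨(hI k s hs).1, (hI k s hs).2.1, (hI k s hs).2.2.1,
      fun hl => h _ ((hI k s hs).2.2.2 hl)⟩⟩

theorem wp_seq {c d : Cmd} {Q R : St → Prop} {s : St} (hc : c.wp B off R s)
    (hd : ∀ s, R s → d.wp B off Q s) : (c ;; d).wp B off Q s :=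
  wp_mono hd hc

/-- The rule for loops, with an invariant and a variant. -/
theorem wp_while {a b : Expr} {c : Cmd} {Q : St → Prop} {s : St} (I : St → Prop) (m : St → ℕ)
    (h0 : I s) (hI : ∀ s, I s → a.ok B off s ∧ b.ok B off s ∧
      (a.eval s < b.eval s → c.wp B off (fun s' => I s' ∧ m s' < m s) s.tick) ∧
      (¬ a.eval s < b.eval s → Q s.tick)) : (Cmd.loop a b c).wp B off Q s := by
  refine ⟨fun k s => I s ∧ m s = k, ⟨_, h0, rfl⟩, ?_⟩
  rintro k s ⟨hs, rfl⟩
  refine ⟨(hI s hs).1, (hI s hs).2.1, fun hl => ?_, (hI s hs).2.2.2⟩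
  exact wp_mono (fun s' hs' => ⟨_, hs'.2, hs'.1, rfl⟩) ((hI s hs).2.2.1 hl)

/-- The variables that a command may change. -/
@[simp] def setsVar : Cmd → Var → Bool
  | assign x _, y => x = y
  | store _ _ _, _ => false
  | write _ _, _ => false
  | seq c d, y => c.setsVar y || d.setsVar y
  | ite _ _ c d, y => c.setsVar y || d.setsVar y
  | .loop _ _ c, y => c.setsVar y

/-- The arrays that a command may change. -/
@[simp] def setsArr : Cmd → Arr → Bool
  | assign _ _, _ => false
  | store k _ _, l => k = l
  | write _ _, _ => false
  | seq c d, y => c.setsArr y || d.setsArr y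
  | ite _ _ c d, y => c.setsArr y || d.setsArr y
  | .loop _ _ c, y => c.setsArr y

/-- Whether a command may change the input/output area. -/
@[simp] def setsIo : Cmd → Bool
  | assign _ _ => false
  | store _ _ _ => false
  | write _ _ => true
  | seq c d => c.setsIo || d.setsIo
  | ite _ _ c d => c.setsIo || d.setsIo
  | .loop _ _ c => c.setsIo

/-- `s'` agrees with `s` on everything that the command does not change. -/
def Frame (c : Cmd) (s s' : St) : Prop :=
  (∀ x, c.setsVar x = false → s'.v x = s.v x) ∧ (∀ k, c.setsArr k = false → s'.a k = s.a k) ∧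
    (c.setsIo = false → s'.io = s.io)

/-- Specifications need only mention what a command changes: which variables and arrays it may
assign is read off the syntax, and everything else is preserved along the run. -/
theorem wp_frame {c : Cmd} {Q : St → Prop} {s : St} (hc : c.wp B off Q s) :
    c.wp B off (fun s' => Q s' ∧ c.Frame s s') s := by
  induction c generalizing Q s with
  | assign x e =>
    refine ⟨hc.1, hc.2, ?_, fun _ _ => rfl, fun _ => rfl⟩
    intro y hy
    have : y ≠ x := by rintro rfl; simp at hy
    simp [this]
  | store k i e =>
    refine ⟨hc.1, hc.2.1, hc.2.2.1, hc.2.2.2, fun _ _ => rfl, ?_, fun _ => rfl⟩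
    intro y hy
    have : y ≠ k := by rintro rfl; simp at hy
    simp [this]
  | write i e =>
    exact ⟨hc.1, hc.2.1, hc.2.2.1, hc.2.2.2, fun _ _ => rfl, fun _ _ => rfl, by simp⟩
  | seq c d ihc ihd =>
    refine wp_mono (c := c) ?_ (ihc hc)
    rintro s1 ⟨h1, f1, g1, i1⟩
    refine wp_mono ?_ (ihd h1)
    rintro s2 ⟨h2, f2, g2, i2⟩
    refine ⟨h2, fun x hx => ?_, fun x hx => ?_, fun hx => ?_⟩ <;>
      simp only [setsVar, setsArr, setsIo, Bool.or_eq_false_iff] at hx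
    · rw [f2 x hx.2, f1 x hx.1]
    · rw [g2 x hx.2, g1 x hx.1]
    · rw [i2 hx.2, i1 hx.1]
  | ite a b c d ihc ihd =>
    refine ⟨hc.1, hc.2.1, fun hl => ?_, fun hl => ?_⟩
    · refine wp_mono ?_ (ihc (hc.2.2.1 hl))
      rintro s2 ⟨h2, f2, g2, i2⟩
      refine ⟨h2, fun x hx => ?_, fun x hx => ?_, fun hx => ?_⟩ <;>
        simp only [setsVar, setsArr, setsIo, Bool.or_eq_false_iff] at hx
      · rw [f2 x hx.1]; rfl
      · rw [g2 x hx.1]; rfl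
      · rw [i2 hx.1]; rfl
    · refine wp_mono ?_ (ihd (hc.2.2.2 hl))
      rintro s2 ⟨h2, f2, g2, i2⟩
      refine ⟨h2, fun x hx => ?_, fun x hx => ?_, fun hx => ?_⟩ <;>
        simp only [setsVar, setsArr, setsIo, Bool.or_eq_false_iff] at hx
      · rw [f2 x hx.2]; rfl
      · rw [g2 x hx.2]; rfl
      · rw [i2 hx.2]; rfl
  | loop a b c ih =>
    obtain ⟨I, ⟨k0, h0⟩, hI⟩ := hc
    -- The given invariant is strengthened by agreement with the initial state of the loop.
    refine ⟨fun k s' => I k s' ∧ (Cmd.loop a b c).Frame s s',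
      ⟨k0, h0, fun _ _ => rfl, fun _ _ => rfl, fun _ => rfl⟩, ?_⟩
    rintro k s1 ⟨h1, f1, g1, i1⟩
    obtain ⟨ha, hb, hc, hd⟩ := hI k s1 h1
    refine ⟨ha, hb, fun hl => ?_, fun hl => ⟨hd hl, f1, g1, i1⟩⟩
    refine wp_mono ?_ (ih (hc hl))
    rintro s2 ⟨⟨k', hk', h2⟩, f2, g2, i2⟩
    exact ⟨k', hk', h2, fun x hx => (f2 x hx).trans (f1 x hx),
      fun x hx => (g2 x hx).trans (g1 x hx), fun hx => (i2 hx).trans (i1 hx)⟩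

end Cmd

/-! ### Compilation -/

/-- The register of a variable. Registers `0`, `1`, `2` hold `0`, `1`, and the end of the
input/output area. -/
def Var.reg (x : Var) : ℕ := 3 + x.ctorIdx

theorem Var.reg_inj {x y : Var} (h : x.reg = y.reg) : x = y := by
  have : x.ctorIdx = y.ctorIdx := by simpa [Var.reg] using h
  rw [← Var.ofNat_ctorIdx x, this, Var.ofNat_ctorIdx]

/-- The first of the registers for intermediate results. -/
abbrev tempReg : ℕ := 30

theorem Var.reg_lt (x : Var) : x.reg < tempReg := by cases x <;> decide

theorem Var.three_le_reg (x : Var) : 3 ≤ x.reg := Nat.le_add_right _ _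

theorem Arr.ctorIdx_inj {x y : Arr} (h : x.ctorIdx = y.ctorIdx) : x = y := by
  rw [← Arr.ofNat_ctorIdx x, h, Arr.ofNat_ctorIdx]

theorem Arr.ctorIdx_lt (x : Arr) : x.ctorIdx < 16 := by cases x <;> decide

/-- Code that replaces an index in register `t` by the address of that element of an array. -/
def addrCode (k : Arr) (t u : ℕ) : List Instr :=
  [.const u 16, .mul t t u, .add t t 2, .const u k.ctorIdx, .add t t u]

/-- Code that evaluates an expression into register `t`. -/
def Expr.comp : Expr → ℕ → List Instr
  | var x, t => [.add t x.reg 0]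
  | lit c, t => [.const t c]
  | add a b, t => a.comp t ++ (b.comp (t + 1) ++ [.add t t (t + 1)])
  | sub a b, t => a.comp t ++ (b.comp (t + 1) ++ [.sub t t (t + 1)])
  | mul a b, t => a.comp t ++ (b.comp (t + 1) ++ [.mul t t (t + 1)])
  | div a b, t => a.comp t ++ (b.comp (t + 1) ++ [.div t t (t + 1)])
  | arr k i, t => i.comp t ++ (addrCode k t (t + 1) ++ [.load t t])
  | io i, t => i.comp t ++ [.load t t]

/-- Code that evaluates two expressions into the first two registers for intermediate results. -/
def comp2 (a b : Expr) : List Instr := a.comp tempReg ++ b.comp (tempReg + 1)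

/-- The code of a command, to be placed at instruction number `o`. -/
def Cmd.comp : Cmd → ℕ → List Instr
  | assign x e, _ => e.comp tempReg ++ [.add x.reg tempReg 0]
  | store k i e, _ => comp2 i e ++ (addrCode k tempReg (tempReg + 2) ++
      [.store tempReg (tempReg + 1)])
  | write i e, _ => comp2 i e ++ [.store tempReg (tempReg + 1)]
  | seq c d, o => c.comp o ++ d.comp (o + (c.comp o).length)
  | ite a b c d, o =>
    let o1 := o + (comp2 a b).length + 1
    let dd := d.comp o1
    let o2 := o1 + dd.length + 1
    let cc := c.comp o2
    comp2 a b ++ (.jlt tempReg (tempReg + 1) o2 :: (dd ++ (.jlt 0 1 (o2 + cc.length) :: cc)))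
  | .loop a b c, o =>
    let o1 := o + (comp2 a b).length + 2
    let cc := c.comp o1
    comp2 a b ++ (.jlt tempReg (tempReg + 1) o1 :: .jlt 0 1 (o1 + cc.length + 1) ::
      (cc ++ [.jlt 0 1 o]))

/-- A bound for the length of the code of the single steps of a command. -/
def Cmd.weight : Cmd → ℕ
  | assign _ e => (e.comp tempReg).length + 1
  | store _ i e => (comp2 i e).length + 6
  | write i e => (comp2 i e).length + 1
  | seq c d => max c.weight d.weight
  | ite a b c d => max ((comp2 a b).length + 2) (max c.weight d.weight)
  | .loop a b c => max ((comp2 a b).length + 3) c.weight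

/-- The code stands in the program from instruction number `o` on. -/
def CodeAt (P : Program) (o : ℕ) (l : List Instr) : Prop :=
  ∀ j, j < l.length → P[o + j]? = l[j]?

theorem CodeAt.append {P : Program} {o : ℕ} {l m : List Instr} :
    CodeAt P o (l ++ m) ↔ CodeAt P o l ∧ CodeAt P (o + l.length) m := by
  constructor
  · refine fun h => ⟨fun j hj => ?_, fun j hj => ?_⟩
    · rw [h j (by simp; omega), List.getElem?_append_left hj]
    · have := h (l.length + j) (by simp; omega)
      rw [List.getElem?_append_right (by omega)] at this
      simpa [add_assoc] using this
  · rintro ⟨h1, h2⟩ j hj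
    rcases lt_or_ge j l.length with h | h
    · rw [h1 j h, List.getElem?_append_left h]
    · have := h2 (j - l.length) (by simp at hj; omega)
      rw [List.getElem?_append_right h, ← this]
      congr 1; omega

theorem CodeAt.cons {P : Program} {o : ℕ} {i : Instr} {l : List Instr} :
    CodeAt P o (i :: l) ↔ P[o]? = some i ∧ CodeAt P (o + 1) l := by
  have := CodeAt.append (P := P) (o := o) (l := [i]) (m := l)
  simp only [List.singleton_append, List.length_singleton] at this
  rw [this]
  simp [CodeAt]

/-- In `m` steps the machine passes from `c` to `c'`, without numbers larger than `B`. -/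
def Steps (P : Program) (B : ℕ) (c c' : Config) (m : ℕ) : Prop :=
  (step P)^[m] c = c' ∧ ∀ s ≤ m, ((step P)^[s] c).WordsLE B

theorem Steps.trans {P : Program} {B : ℕ} {c c' c'' : Config} {m m' : ℕ}
    (h : Steps P B c c' m) (h' : Steps P B c' c'' m') : Steps P B c c'' (m + m') := by
  refine ⟨?_, fun s hs => ?_⟩
  · rw [add_comm, Function.iterate_add_apply, h.1, h'.1]
  · rcases le_total s m with h1 | h1
    · exact h.2 s h1
    · obtain ⟨r, rfl⟩ := Nat.exists_eq_add_of_le h1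
      rw [add_comm, Function.iterate_add_apply, h.1]
      exact h'.2 r (by omega)

theorem Steps.one {P : Program} {B : ℕ} {c : Config} {i : Instr} (h : c.WordsLE B)
    (hi : P[c.pc]? = some i) (h' : (i.exec c).WordsLE B) : Steps P B c (i.exec c) 1 := by
  have e : step P c = i.exec c := by simp [step, hi]
  refine ⟨by simp [e], fun s hs => ?_⟩
  interval_cases s
  · exact h
  · simpa [e] using h'

/-- The configuration `c` represents the state `s`. -/
structure Sim (B off : ℕ) (s : St) (c : Config) : Prop where
  zero : c.reg 0 = 0
  one : c.reg 1 = 1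
  two : c.reg 2 = off
  var : ∀ x : Var, c.reg x.reg = s.v x
  io : ∀ i < off, c.mem i = s.io i
  arr : ∀ (k : Arr) i, c.mem (off + 16 * i + k.ctorIdx) = s.a k i
  words : c.WordsLE B

variable {B off : ℕ} {P : Program} {s : St} {c : Config}

theorem Sim.temp (h : Sim B off s c) {t m pc : ℕ} (ht : tempReg ≤ t) (hm : m ≤ B) :
    Sim B off s ⟨pc, Function.update c.reg t m, c.mem⟩ := by
  have e : ∀ r < tempReg, Function.update c.reg t m r = c.reg r := fun r hr =>
    Function.update_of_ne (by omega) _ _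
  refine ⟨?_, ?_, ?_, fun x => ?_, h.io, h.arr, fun r => ?_, h.words.2⟩
  · exact (e _ (by norm_num)).trans h.zero
  · exact (e _ (by norm_num)).trans h.one
  · exact (e _ (by norm_num)).trans h.two
  · exact (e _ x.reg_lt).trans (h.var x)
  · rcases eq_or_ne r t with rfl | hr
    · simpa using hm
    · simpa [Function.update_of_ne hr] using h.words.1 r

theorem Sim.jump (h : Sim B off s c) (pc : ℕ) : Sim B off s ⟨pc, c.reg, c.mem⟩ :=
  ⟨h.zero, h.one, h.two, h.var, h.io, h.arr, h.words⟩

theorem Sim.tick (h : Sim B off s c) : Sim B off s.tick c :=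
  ⟨h.zero, h.one, h.two, h.var, h.io, h.arr, h.words⟩

theorem Sim.step_temp (h : Sim B off s c) {i : Instr} {t m : ℕ} (hi : P[c.pc]? = some i)
    (ht : tempReg ≤ t) (he : i.exec c = ⟨c.pc + 1, Function.update c.reg t m, c.mem⟩)
    (hm : m ≤ B) :
    ∃ c', Steps P B c c' 1 ∧ Sim B off s c' ∧ c'.pc = c.pc + 1 ∧ c'.reg t = m ∧
      (∀ r, r ≠ t → c'.reg r = c.reg r) ∧ c'.mem = c.mem := by
  have h' := h.temp (pc := c.pc + 1) ht hm
  refine ⟨_, Steps.one h.words hi ?_, ?_, ?_, ?_, ?_, ?_⟩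
  · rw [he]; exact h'.words
  · rw [he]; exact h'
  · rw [he]
  · rw [he]; simp
  · intro r hr; rw [he]; simp [hr]
  · rw [he]

/-- The sixteen arrays are interleaved with stride 16 above the input/output area, so none of them
needs a declared length. -/
theorem addrCode_spec (h : Sim B off s c) {k : Arr} {t u i : ℕ} (hti : c.reg t = i)
    (ht : tempReg ≤ t) (hu : t < u) (hB : off + 16 * (i + 1) ≤ B)
    (hP : CodeAt P c.pc (addrCode k t u)) :
    ∃ c', Steps P B c c' 5 ∧ Sim B off s c' ∧ c'.pc = c.pc + 5 ∧
      c'.reg t = off + 16 * i + k.ctorIdx ∧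
      (∀ r, r ≠ t → r ≠ u → c'.reg r = c.reg r) ∧ c'.mem = c.mem := by
  have hk := k.ctorIdx_lt
  simp only [addrCode, CodeAt.cons] at hP
  obtain ⟨p1, p2, p3, p4, p5, -⟩ := hP
  obtain ⟨c1, s1, h1, q1, r1, o1, m1⟩ := h.step_temp p1 (by omega) rfl (by omega)
  rw [← q1] at p2 p3 p4 p5
  obtain ⟨c2, s2, h2, q2, r2, o2, m2⟩ := h1.step_temp (m := i * 16) p2 ht
    (by simp only [Instr.exec, o1 t (by omega), hti, r1]) (by omega)
  rw [← q2] at p3 p4 p5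
  obtain ⟨c3, s3, h3, q3, r3, o3, m3⟩ := h2.step_temp (m := i * 16 + off) p3 ht
    (by simp only [Instr.exec, r2, h2.two]) (by omega)
  rw [← q3] at p4 p5
  obtain ⟨c4, s4, h4, q4, r4, o4, m4⟩ := h3.step_temp (m := k.ctorIdx) p4 (by omega) rfl
    (by omega)
  rw [← q4] at p5
  obtain ⟨c5, s5, h5, q5, r5, o5, m5⟩ := h4.step_temp (m := i * 16 + off + k.ctorIdx) p5 ht
    (by simp only [Instr.exec, r4, o4 t (by omega), r3]) (by omega)
  refine ⟨c5, (((s1.trans s2).trans s3).trans s4).trans s5, h5, by omega, by rw [r5]; ring,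
    fun r hr hr' => ?_, by rw [m5, m4, m3, m2, m1]⟩
  rw [o5 r hr, o4 r hr', o3 r hr, o2 r hr, o1 r hr']

/-- The code of the expression `e` is correct. -/
def Evals (B off : ℕ) (P : Program) (s : St) (e : Expr) : Prop :=
  ∀ (t : ℕ) (c : Config), tempReg ≤ t → Sim B off s c → e.ok B off s → CodeAt P c.pc (e.comp t) →
    ∃ c', Steps P B c c' (e.comp t).length ∧ Sim B off s c' ∧
      c'.pc = c.pc + (e.comp t).length ∧ c'.reg t = e.eval s ∧ ∀ r < t, c'.reg r = c.reg r

/-- The value of the left operand survives in register `t`, because the right operand is compiled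
for `t + 1` and leaves all smaller registers alone. -/
theorem Evals.binary {a b : Expr} (ha : Evals B off P s a) (hb : Evals B off P s b) {i : Instr}
    {m t : ℕ} (hi : ∀ {c : Config}, c.reg t = a.eval s → c.reg (t + 1) = b.eval s →
      i.exec c = ⟨c.pc + 1, Function.update c.reg t m, c.mem⟩)
    (ht : tempReg ≤ t) (h : Sim B off s c) (hao : a.ok B off s) (hbo : b.ok B off s) (hm : m ≤ B)
    (hP : CodeAt P c.pc (a.comp t ++ (b.comp (t + 1) ++ [i]))) :
    ∃ c', Steps P B c c' (a.comp t ++ (b.comp (t + 1) ++ [i])).length ∧ Sim B off s c' ∧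
      c'.pc = c.pc + (a.comp t ++ (b.comp (t + 1) ++ [i])).length ∧ c'.reg t = m ∧
      ∀ r < t, c'.reg r = c.reg r := by
  rw [CodeAt.append, CodeAt.append, CodeAt.cons] at hP
  obtain ⟨p1, p2, p3, -⟩ := hP
  obtain ⟨c1, s1, h1, q1, r1, o1⟩ := ha _ _ ht h hao p1
  rw [← q1] at p2 p3
  obtain ⟨c2, s2, h2, q2, r2, o2⟩ := hb _ _ (by omega) h1 hbo p2
  rw [← q2] at p3
  obtain ⟨c3, s3, h3, q3, r3, o3, -⟩ := h2.step_temp (m := m) p3 ht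
    (hi ((o2 t (by omega)).trans r1) r2) hm
  refine ⟨c3, ?_, h3, ?_, r3, fun r hr => ?_⟩
  · simpa [add_assoc] using (s1.trans s2).trans s3
  · simp; omega
  · rw [o3 r (by omega), o2 r (by omega), o1 r hr]

/-- Sums and products carry explicit bounds in `ok`; differences and quotients do not exceed their
left operand, and everything read from the machine is already bounded. -/
theorem Expr.eval_le (e : Expr) (h : Sim B off s c) (he : e.ok B off s) : e.eval s ≤ B := by
  induction e with
  | var x => rw [Expr.eval, ← h.var]; exact h.words.1 _
  | lit a => exact he
  | add a b => exact he.2.2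
  | sub a b iha => exact (Nat.sub_le _ _).trans (iha he.1)
  | mul a b => exact he.2.2
  | div a b iha => exact (Nat.div_le_self _ _).trans (iha he.1)
  | arr k i => rw [Expr.eval, ← h.arr]; exact h.words.2 _
  | io i => rw [Expr.eval, ← h.io _ he.2]; exact h.words.2 _

theorem Expr.comp_spec (e : Expr) : Evals B off P s e := by
  induction e with
  | var x =>
    intro t c ht h he hP
    rw [Expr.comp, CodeAt.cons] at hP
    obtain ⟨c1, s1, h1, q1, r1, o1, -⟩ := h.step_temp (m := s.v x) hP.1 ht
      (by simp [Instr.exec, h.zero, h.var]) (by rw [← h.var]; exact h.words.1 _)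
    exact ⟨c1, s1, h1, q1, r1, fun r hr => o1 r (by omega)⟩
  | lit a =>
    intro t c ht h he hP
    rw [Expr.comp, CodeAt.cons] at hP
    obtain ⟨c1, s1, h1, q1, r1, o1, -⟩ := h.step_temp (m := a) hP.1 ht rfl he
    exact ⟨c1, s1, h1, q1, r1, fun r hr => o1 r (by omega)⟩
  | add a b iha ihb =>
    intro t c ht h he hP
    exact iha.binary ihb (fun h1 h2 => by simp [Instr.exec, h1, h2]) ht h he.1 he.2.1 he.2.2 hP
  | sub a b iha ihb =>
    intro t c ht h he hP
    exact iha.binary ihb (fun h1 h2 => by simp [Instr.exec, h1, h2]) ht h he.1 he.2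
      (Expr.eval_le (.sub a b) h he) hP
  | mul a b iha ihb =>
    intro t c ht h he hP
    exact iha.binary ihb (fun h1 h2 => by simp [Instr.exec, h1, h2]) ht h he.1 he.2.1 he.2.2 hP
  | div a b iha ihb =>
    intro t c ht h he hP
    exact iha.binary ihb (fun h1 h2 => by simp [Instr.exec, h1, h2]) ht h he.1 he.2
      (Expr.eval_le (.div a b) h he) hP
  | arr k i ih =>
    intro t c ht h he hP
    rw [Expr.comp, CodeAt.append, CodeAt.append, CodeAt.cons] at hP
    obtain ⟨p1, p2, p3, -⟩ := hP
    obtain ⟨c1, s1, h1, q1, r1, o1⟩ := ih _ _ ht h he.1 p1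
    rw [← q1] at p2 p3
    obtain ⟨c2, s2, h2, q2, r2, o2, -⟩ := addrCode_spec h1 r1 ht (Nat.lt_succ_self t) he.2 p2
    rw [show c1.pc + (addrCode k t (t + 1)).length = c2.pc from q2.symm] at p3
    obtain ⟨c3, s3, h3, q3, r3, o3, -⟩ := h2.step_temp (m := (Expr.arr k i).eval s) p3 ht
      (by simp [Instr.exec, r2, h2.arr]) (Expr.eval_le (.arr k i) h he)
    refine ⟨c3, ?_, h3, ?_, r3, fun r hr => ?_⟩
    · simpa [Expr.comp, addrCode, add_assoc] using (s1.trans s2).trans s3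
    · simp [Expr.comp, addrCode]; omega
    · rw [o3 r (by omega), o2 r (by omega) (by omega), o1 r hr]
  | io i ih =>
    intro t c ht h he hP
    rw [Expr.comp, CodeAt.append, CodeAt.cons] at hP
    obtain ⟨p1, p3, -⟩ := hP
    obtain ⟨c1, s1, h1, q1, r1, o1⟩ := ih _ _ ht h he.1 p1
    rw [← q1] at p3
    obtain ⟨c3, s3, h3, q3, r3, o3, -⟩ := h1.step_temp (m := (Expr.io i).eval s) p3 ht
      (by simp [Instr.exec, r1, h1.io _ he.2]) (Expr.eval_le (.io i) h he)
    refine ⟨c3, ?_, h3, ?_, r3, fun r hr => ?_⟩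
    · simpa [Expr.comp, add_assoc] using s1.trans s3
    · simp [Expr.comp]; omega
    · rw [o3 r (by omega), o1 r hr]

theorem comp2_spec {a b : Expr} (h : Sim B off s c) (ha : a.ok B off s) (hb : b.ok B off s)
    (hP : CodeAt P c.pc (comp2 a b)) :
    ∃ c', Steps P B c c' (comp2 a b).length ∧ Sim B off s c' ∧
      c'.pc = c.pc + (comp2 a b).length ∧ c'.reg tempReg = a.eval s ∧
      c'.reg (tempReg + 1) = b.eval s := by
  rw [comp2, CodeAt.append] at hP
  obtain ⟨p1, p2⟩ := hP
  obtain ⟨c1, s1, h1, q1, r1, o1⟩ := a.comp_spec _ _ le_rfl h ha p1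
  rw [← q1] at p2
  obtain ⟨c2, s2, h2, q2, r2, o2⟩ := b.comp_spec (tempReg + 1) _ (Nat.le_succ _) h1 hb p2
  refine ⟨c2, ?_, h2, ?_, (o2 _ (by omega)).trans r1, r2⟩
  · simpa [comp2] using s1.trans s2
  · simp [comp2]; omega

theorem Sim.step_jlt (h : Sim B off s c) {r u l : ℕ} (hi : P[c.pc]? = some (.jlt r u l)) :
    Steps P B c ⟨if c.reg r < c.reg u then l else c.pc + 1, c.reg, c.mem⟩ 1 :=
  Steps.one h.words hi (h.jump (if c.reg r < c.reg u then l else c.pc + 1)).words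

theorem Sim.step_store (h : Sim B off s c) (hi : P[c.pc]? = some (.store tempReg (tempReg + 1))) :
    Steps P B c ⟨c.pc + 1, c.reg,
      Function.update c.mem (c.reg tempReg) (c.reg (tempReg + 1))⟩ 1 := by
  refine Steps.one h.words hi ⟨h.words.1, fun a => ?_⟩
  rcases eq_or_ne a (c.reg tempReg) with rfl | ha
  · simpa [Instr.exec] using h.words.1 _
  · simpa [Instr.exec, ha] using h.words.2 a

theorem Sim.set (h : Sim B off s c) (x : Var) {m : ℕ} (hm : m ≤ B) (pc : ℕ) :
    Sim B off (s.set x m) ⟨pc, Function.update c.reg x.reg m, c.mem⟩ := by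
  have h3 := x.three_le_reg
  refine ⟨?_, ?_, ?_, fun y => ?_, h.io, h.arr, fun r => ?_, h.words.2⟩
  · simpa [Function.update_of_ne (show 0 ≠ x.reg by omega)] using h.zero
  · simpa [Function.update_of_ne (show 1 ≠ x.reg by omega)] using h.one
  · simpa [Function.update_of_ne (show 2 ≠ x.reg by omega)] using h.two
  · rcases eq_or_ne y x with rfl | hy
    · simp
    · have : y.reg ≠ x.reg := fun e => hy (Var.reg_inj e)
      simpa [hy, this] using h.var y
  · rcases eq_or_ne r x.reg with rfl | hr
    · simpa using hm
    · simpa [hr] using h.words.1 r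

theorem Sim.put (h : Sim B off s c) (k : Arr) (i : ℕ) {m : ℕ} (hm : m ≤ B) (pc : ℕ) :
    Sim B off (s.put k i m) ⟨pc, c.reg, Function.update c.mem (off + 16 * i + k.ctorIdx) m⟩ := by
  have hk := k.ctorIdx_lt
  refine ⟨h.zero, h.one, h.two, h.var, fun j hj => ?_, fun l j => ?_, h.words.1, fun a => ?_⟩
  · simpa [Function.update_of_ne (show j ≠ off + 16 * i + k.ctorIdx by omega)] using h.io j hj
  · have hl := l.ctorIdx_lt
    by_cases e : l = k ∧ j = i
    · obtain ⟨rfl, rfl⟩ := e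
      simp
    -- An array index below 16 is a remainder modulo the stride, so distinct pairs of array and
    -- index have distinct addresses.
    · have : off + 16 * j + l.ctorIdx ≠ off + 16 * i + k.ctorIdx := by
        intro e'
        exact e ⟨Arr.ctorIdx_inj (by omega), by omega⟩
      simp only [Function.update_of_ne this, St.put_a, h.arr]
      split_ifs with h1
      · subst h1
        rw [Function.update_of_ne (fun e' => e ⟨rfl, e'⟩)]
      · rfl
  · rcases eq_or_ne a (off + 16 * i + k.ctorIdx) with rfl | ha
    · simpa using hm
    · simpa [ha] using h.words.2 a

theorem Sim.out (h : Sim B off s c) {i : ℕ} (hi : i < off) {m : ℕ} (hm : m ≤ B) (pc : ℕ) :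
    Sim B off (s.out i m) ⟨pc, c.reg, Function.update c.mem i m⟩ := by
  refine ⟨h.zero, h.one, h.two, h.var, fun j hj => ?_, fun l j => ?_, h.words.1, fun a => ?_⟩
  · rcases eq_or_ne j i with rfl | hij
    · simp
    · simpa [hij] using h.io j hj
  · simpa [Function.update_of_ne (show off + 16 * j + l.ctorIdx ≠ i by omega)] using h.arr l j
  · rcases eq_or_ne a i with rfl | ha
    · simpa using hm
    · simpa [ha] using h.words.2 a

/-- Compiled code is correct, and takes time proportional to the number of executed commands. -/
theorem Cmd.comp_spec (d : Cmd) {W : ℕ} (hW : d.weight ≤ W) {Q : St → Prop} {s : St} {c : Config}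
    (h : Sim B off s c) (hd : d.wp B off Q s) (hP : CodeAt P c.pc (d.comp c.pc)) :
    ∃ m c' s', Steps P B c c' m ∧ Sim B off s' c' ∧ c'.pc = c.pc + (d.comp c.pc).length ∧ Q s' ∧
      m + W * s.clk ≤ W * s'.clk := by
  induction d generalizing Q s c with
  | assign x e =>
    obtain ⟨he, hq⟩ := hd
    rw [Cmd.comp, CodeAt.append, CodeAt.cons] at hP
    simp only [Cmd.weight] at hW
    obtain ⟨p1, p2, -⟩ := hP
    obtain ⟨c1, s1, h1, q1, r1, -⟩ := e.comp_spec _ _ le_rfl h he p1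
    rw [← q1] at p2
    have h2 := h1.set x (e.eval_le h he) (c1.pc + 1)
    have e2 : (Instr.add x.reg tempReg 0).exec c1 =
        ⟨c1.pc + 1, Function.update c1.reg x.reg (e.eval s), c1.mem⟩ := by
      simp [Instr.exec, r1, h1.zero]
    have s2 := Steps.one h1.words p2 (e2 ▸ h2.words)
    rw [e2] at s2
    refine ⟨_, _, _, s1.trans s2, h2, ?_, hq, ?_⟩
    · simp [Cmd.comp]; omega
    · simp only [St.set_clk, mul_add]; omega
  | store k i e =>
    obtain ⟨hi, he, hB, hq⟩ := hd
    rw [Cmd.comp, CodeAt.append, CodeAt.append, CodeAt.cons] at hP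
    simp only [Cmd.weight] at hW
    obtain ⟨p1, p2, p3, -⟩ := hP
    obtain ⟨c1, s1, h1, q1, r1, o1⟩ := comp2_spec h hi he p1
    rw [← q1] at p2 p3
    obtain ⟨c2, s2, h2, q2, r2, o2, -⟩ := addrCode_spec h1 r1 le_rfl
      (show tempReg < tempReg + 2 by omega) hB p2
    rw [show c1.pc + (addrCode k tempReg (tempReg + 2)).length = c2.pc from q2.symm] at p3
    have s3 := h2.step_store p3
    rw [r2, o2 _ (by omega) (by omega), o1] at s3
    refine ⟨_, _, _, (s1.trans s2).trans s3, h2.put k _ (e.eval_le h he) _, ?_, hq, ?_⟩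
    · simp [Cmd.comp, addrCode]; omega
    · simp only [St.put_clk, mul_add]; omega
  | write i e =>
    obtain ⟨hi, he, hB, hq⟩ := hd
    rw [Cmd.comp, CodeAt.append, CodeAt.cons] at hP
    simp only [Cmd.weight] at hW
    obtain ⟨p1, p3, -⟩ := hP
    obtain ⟨c1, s1, h1, q1, r1, o1⟩ := comp2_spec h hi he p1
    rw [← q1] at p3
    have s3 := h1.step_store p3
    rw [r1, o1] at s3
    refine ⟨_, _, _, s1.trans s3, h1.out hB (e.eval_le h he) _, ?_, hq, ?_⟩
    · simp [Cmd.comp]; omega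
    · simp only [St.out_clk, mul_add]; omega
  | seq d1 d2 ih1 ih2 =>
    rw [Cmd.comp, CodeAt.append] at hP
    simp only [Cmd.weight, max_le_iff] at hW
    obtain ⟨p1, p2⟩ := hP
    obtain ⟨m1, c1, s1, t1, h1, q1, w1, k1⟩ := ih1 hW.1 h hd p1
    rw [← q1] at p2
    obtain ⟨m2, c2, s2, t2, h2, q2, w2, k2⟩ := ih2 hW.2 h1 w1 p2
    refine ⟨_, _, _, t1.trans t2, h2, ?_, w2, by omega⟩
    simp only [Cmd.comp, List.length_append, ← q1]; omega
  | ite a b d1 d2 ih1 ih2 =>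
    obtain ⟨ha, hb, hl1, hl2⟩ := hd
    simp only [Cmd.comp] at hP ⊢
    rw [CodeAt.append, CodeAt.cons, CodeAt.append, CodeAt.cons] at hP
    simp only [Cmd.weight, max_le_iff] at hW
    obtain ⟨p1, p2, p3, p4, p5⟩ := hP
    obtain ⟨c1, s1, h1, q1, r1, o1⟩ := comp2_spec h ha hb p1
    rw [← q1] at p2 p3 p4 p5 ⊢
    have s2 := h1.step_jlt p2
    rw [r1, o1] at s2
    have hclk : W * s.tick.clk = W * s.clk + W := by simp [mul_add]
    split_ifs at s2 with hlt
    · obtain ⟨m3, c3, s3, t3, h3, q3, w3, k3⟩ := ih1 hW.2.1 (h1.tick.jump _) (hl1 hlt) p5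
      refine ⟨_, _, _, (s1.trans s2).trans t3, h3, ?_, w3, by omega⟩
      rw [q3]; simp; omega
    · obtain ⟨m3, c3, s3, t3, h3, q3, w3, k3⟩ := ih2 hW.2.2 (h1.tick.jump _) (hl2 hlt) p3
      simp only [] at q3
      rw [← q3] at p4
      have s4 := h3.step_jlt p4
      -- Registers 0 and 1 always hold 0 and 1, so `jlt 0 1` is an unconditional jump; here it skips
      -- the other branch.
      rw [h3.zero, h3.one, if_pos Nat.zero_lt_one] at s4
      refine ⟨_, _, _, ((s1.trans s2).trans t3).trans s4, h3.jump _, ?_, w3, by omega⟩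
      rw [q3]; simp; omega
  | loop a b d ih =>
    obtain ⟨I, ⟨k, hk⟩, hI⟩ := hd
    simp only [Cmd.weight, max_le_iff] at hW
    -- The outer induction handles the body of the loop; the number of rounds is handled by strong
    -- induction on the variant.
    induction k using Nat.strong_induction_on generalizing s c with
    | _ k ihk =>
    obtain ⟨ha, hb, hl1, hl2⟩ := hI k s hk
    have hP0 := hP
    simp only [Cmd.comp] at hP ⊢
    rw [CodeAt.append, CodeAt.cons, CodeAt.cons, CodeAt.append, CodeAt.cons] at hP
    obtain ⟨p1, p2, p3, p4, p5, -⟩ := hP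
    obtain ⟨c1, s1, h1, q1, r1, o1⟩ := comp2_spec h ha hb p1
    rw [← q1] at p2 p3 p4 p5
    have s2 := h1.step_jlt p2
    rw [r1, o1] at s2
    have hclk : W * s.tick.clk = W * s.clk + W := by simp [mul_add]
    split_ifs at s2 with hlt
    · obtain ⟨m3, c3, s3, t3, h3, q3, ⟨k', hk', w3⟩, k3⟩ :=
        ih hW.2 (h1.tick.jump (c1.pc + 2)) (hl1 hlt) p4
      simp only [] at q3
      rw [show c1.pc + 1 + 1 = c1.pc + 2 from rfl, ← q3] at p5
      have s4 := h3.step_jlt p5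
      rw [h3.zero, h3.one, if_pos Nat.zero_lt_one] at s4
      obtain ⟨m5, c5, s5, t5, h5, q5, w5, k5⟩ := ihk k' hk' (h3.jump c.pc) hP0 w3
      refine ⟨_, _, _, (((s1.trans s2).trans t3).trans s4).trans t5, h5, ?_, w5, by omega⟩
      rw [q5]; simp [Cmd.comp]
    · have s3 := (h1.jump (c1.pc + 1)).step_jlt p3
      simp only [h1.zero, h1.one, if_pos Nat.zero_lt_one] at s3
      refine ⟨_, _, _, (s1.trans s2).trans s3, h1.tick.jump _, ?_, hl2 hlt, by omega⟩
      rw [q1]; simp; omega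

/-- Code that sets up the registers `1` and `2`. -/
def prologue : List Instr :=
  [.const 1 1, .load 2 0, .const tempReg 4, .mul 2 2 tempReg, .const tempReg 8, .add 2 2 tempReg]

/-- The machine program for a command. -/
def Cmd.program (d : Cmd) : Program := prologue ++ d.comp 6

/-- The initial state of a structured program. -/
def St.start (input : List ℕ) : St := ⟨fun _ => 0, fun _ _ => 0, fun i => input.getD i 0, 0⟩

/-- The input occupies `4 * n + 1` cells. The area of `4 * n + 8` cells also makes the words of a
first frame readable when `n = 0`. -/
theorem prologue_spec {P : Program} {B : ℕ} {input : List ℕ} (hin : ∀ x ∈ input, x ≤ B)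
    (hB : 4 * input.getD 0 0 + 8 ≤ B) (hlen : input.length ≤ 4 * input.getD 0 0 + 8)
    (hP : CodeAt P 0 prologue) :
    ∃ c, Steps P B (init input) c 6 ∧ Sim B (4 * input.getD 0 0 + 8) (St.start input) c ∧
      c.pc = 6 := by
  simp only [prologue, CodeAt.cons] at hP
  obtain ⟨p1, p2, p3, p4, p5, p6, -⟩ := hP
  have hget : ∀ a, input.getD a 0 ≤ B := by
    intro a
    rcases lt_or_ge a input.length with h | h
    · rw [List.getD_eq_getElem _ _ h]
      exact hin _ (List.getElem_mem h)
    · rw [List.getD_eq_default _ _ h]; exact Nat.zero_le _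
  have key : ∀ (pc : ℕ) (reg : ℕ → ℕ) (i : Instr) (r m : ℕ), (∀ r, reg r ≤ B) → m ≤ B →
      P[pc]? = some i →
      i.exec ⟨pc, reg, fun a => input.getD a 0⟩ =
        ⟨pc + 1, Function.update reg r m, fun a => input.getD a 0⟩ →
      Steps P B ⟨pc, reg, fun a => input.getD a 0⟩
        ⟨pc + 1, Function.update reg r m, fun a => input.getD a 0⟩ 1 ∧
      ∀ r', Function.update reg r m r' ≤ B := by
    intro pc reg i r m hr hm hi he
    have h' : ∀ r', Function.update reg r m r' ≤ B := by
      intro r'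
      rcases eq_or_ne r' r with rfl | h
      · simpa using hm
      · simpa [h] using hr r'
    refine ⟨?_, h'⟩
    rw [← he]
    refine Steps.one ⟨hr, hget⟩ hi ?_
    rw [he]
    exact ⟨h', hget⟩
  obtain ⟨s1, w1⟩ := key 0 (fun _ => 0) _ 1 1 (fun _ => Nat.zero_le _) (by omega) p1 rfl
  obtain ⟨s2, w2⟩ := key _ _ _ 2 (input.getD 0 0) w1 (hget 0) p2 (by simp [Instr.exec])
  obtain ⟨s3, w3⟩ := key _ _ _ tempReg 4 w2 (by omega) p3 rfl
  obtain ⟨s4, w4⟩ := key _ _ _ 2 (input.getD 0 0 * 4) w3 (by omega) p4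
    (by simp [Instr.exec, Function.update_apply])
  obtain ⟨s5, w5⟩ := key _ _ _ tempReg 8 w4 (by omega) p5 rfl
  obtain ⟨s6, w6⟩ := key _ _ _ 2 (4 * input.getD 0 0 + 8) w5 (by omega) p6
    (by simp [Instr.exec, Function.update_apply, mul_comm])
  refine ⟨_, ((((s1.trans s2).trans s3).trans s4).trans s5).trans s6,
    ⟨?_, ?_, ?_, fun x => ?_, fun i hi => rfl, fun k i => ?_, w6, hget⟩, rfl⟩
  · simp [Function.update_apply]
  · simp [Function.update_apply]
  · simp
  · have h1 := x.three_le_reg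
    have h2 : x.reg < 30 := x.reg_lt
    simp [Function.update_apply, St.start, show x.reg ≠ 1 by omega, show x.reg ≠ 2 by omega,
      show x.reg ≠ 30 by omega]
  -- All cells from `off` on lie behind the input, hence all arrays start as zero.
  · exact List.getD_eq_default _ _ (by omega)

/-- A terminating structured program gives a random access machine program. -/
theorem Cmd.computes {d : Cmd} {B K : ℕ} {input : List ℕ} {Q : List ℕ → Prop}
    (hin : ∀ x ∈ input, x ≤ B) (hB : 4 * input.getD 0 0 + 8 ≤ B)
    (hlen : input.length ≤ 4 * input.getD 0 0 + 8)
    (hd : d.wp B (4 * input.getD 0 0 + 8) (fun s => s.clk ≤ K ∧ s.io 0 + 1 ≤ 4 * input.getD 0 0 + 8 ∧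
      Q ((List.range (s.io 0)).map fun a => s.io (a + 1))) (St.start input)) :
    Computes d.program input (6 + d.weight * K) B Q := by
  have hP : CodeAt d.program 0 prologue ∧ CodeAt d.program 6 (d.comp 6) := by
    have : CodeAt d.program 0 (prologue ++ d.comp 6) := fun j _ => by simp [program]
    rw [CodeAt.append] at this
    simpa [prologue] using this
  obtain ⟨c0, s0, h0, q0⟩ := prologue_spec hin hB hlen hP.1
  obtain ⟨m, c, s, t1, h1, q1, ⟨w1, w2, w3⟩, k1⟩ :=
    d.comp_spec (P := d.program) le_rfl h0 hd (q0 ▸ hP.2)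
  obtain ⟨e, hw⟩ := s0.trans t1
  have hm : m ≤ d.weight * K := by
    have := Nat.mul_le_mul_left d.weight w1
    simp only [St.start, mul_zero, add_zero] at k1
    omega
  refine ⟨6 + m, by omega, hw, ?_, ?_⟩
  · rw [run, e, Halted, q1, q0]
    simp [program, prologue]
    omega
  · rw [run, e]
    convert w3 using 1
    rw [Config.output, h1.io 0 (by omega)]
    refine List.map_congr_left fun a ha => h1.io _ ?_
    rw [List.mem_range] at ha
    omega

end RAM

/-! ### Dominating sets of permutation graphs, from the lower left to the upper right -/

/-- A permutation `P` of `1, …, N` that fixes `1` and `N`, its inverse `Q`, the prefix maxima `T`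
of `P`, the prefix maxima `R` of `Q`, and the suffix minima `S` of `P`. -/
structure PermData (N : ℕ) (P Q T R S : ℕ → ℕ) : Prop where
  two_le : 2 ≤ N
  P_mem : ∀ v, 1 ≤ v → v ≤ N → 1 ≤ P v ∧ P v ≤ N
  Q_mem : ∀ v, 1 ≤ v → v ≤ N → 1 ≤ Q v ∧ Q v ≤ N
  PQ : ∀ v, 1 ≤ v → v ≤ N → P (Q v) = v
  QP : ∀ v, 1 ≤ v → v ≤ N → Q (P v) = v
  P_one : P 1 = 1
  P_last : P N = N
  T_ge : ∀ v x, 1 ≤ v → v ≤ x → x ≤ N → P v ≤ T x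
  T_at : ∀ x, 1 ≤ x → x ≤ N → 1 ≤ T x ∧ T x ≤ N ∧ Q (T x) ≤ x
  R_ge : ∀ v y, 1 ≤ v → v ≤ N → y ≤ N → P v ≤ y → v ≤ R y
  R_at : ∀ y, 1 ≤ y → y ≤ N → 1 ≤ R y ∧ R y ≤ N ∧ P (R y) ≤ y
  S_le : ∀ x v, 1 ≤ x → x ≤ v → v ≤ N → S x ≤ P v
  S_at : ∀ x, 1 ≤ x → x ≤ N → ∃ v, x ≤ v ∧ v ≤ N ∧ P v = S x
  S_end : S (N + 1) = N + 1

/-- The points `d` and `v` of the permutation are equal or form an inversion. -/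
def Covers (P : ℕ → ℕ) (d v : ℕ) : Prop := (d ≤ v ∧ P v ≤ P d) ∨ (v ≤ d ∧ P d ≤ P v)

/-- The points in `L` dominate all points that do not lie to the upper right of `(X, Y)`. -/
def Good (N : ℕ) (P : ℕ → ℕ) (L : Set ℕ) (X Y : ℕ) : Prop :=
  ∀ v, 1 < v → v ≤ N → ¬ (X < v ∧ Y < P v) → ∃ d ∈ L, 1 ≤ d ∧ d ≤ N ∧ Covers P d v

/-- The frontiers `(X, Y)` that are reached with `c` points. -/
inductive Reach (N : ℕ) (P T R : ℕ → ℕ) : ℕ → ℕ → ℕ → Prop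
  | zero : Reach N P T R 0 1 1
  | right {c X Y : ℕ} : Reach N P T R c X Y → Reach N P T R (c + 1) (R Y) Y
  | up {c X Y : ℕ} : Reach N P T R c X Y → Reach N P T R (c + 1) X (T X)
  | single {c X Y : ℕ} (u : ℕ) : Reach N P T R c X Y → 1 < u → u ≤ N →
      (∀ v, X < v → v < u → Y < P v → P u ≤ P v) → Reach N P T R (c + 1) u (P u)
  | double {c X Y : ℕ} (l b : ℕ) : Reach N P T R c X Y → 1 < l → l < b → b ≤ N → P b < P l →
      (∀ v, X < v → v < l → Y < P v → P b ≤ P v) → Reach N P T R (c + 2) b (P l)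

/-- The frontier `(X, Y)` lies within the range of the permutation, on its inversion side. -/
def InRange (N : ℕ) (T R : ℕ → ℕ) (X Y : ℕ) : Prop :=
  1 ≤ X ∧ X ≤ N ∧ 1 ≤ Y ∧ Y ≤ N ∧ X ≤ R Y ∧ Y ≤ T X

/-- The list `L` witnesses that the frontier `(X, Y)` costs at most `c` points. -/
def Sound (N : ℕ) (P T R : ℕ → ℕ) (c : ℕ) (L : List ℕ) (X Y : ℕ) : Prop :=
  L.length ≤ c ∧ Good N P {d | d ∈ L} X Y ∧ InRange N T R X Y

section

variable {N : ℕ} {P Q T R S : ℕ → ℕ}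

namespace PermData

variable (h : PermData N P Q T R S)
include h

theorem inj {v w : ℕ} (hv : 1 ≤ v) (hv' : v ≤ N) (hw : 1 ≤ w) (hw' : w ≤ N) (e : P v = P w) :
    v = w := by
  rw [← h.QP v hv hv', e, h.QP w hw hw']

theorem one_lt_P {v : ℕ} (hv : 1 < v) (hv' : v ≤ N) : 1 < P v := by
  have h1 := (h.P_mem v hv.le hv').1
  have h2 : P v ≠ 1 := fun e => by
    have := h.inj hv.le hv' le_rfl (by omega) (e.trans h.P_one.symm)
    omega
  omega

theorem R_mono {y y' : ℕ} (hy : 1 ≤ y) (hyy : y ≤ y') (hy' : y' ≤ N) : R y ≤ R y' := by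
  have := h.R_at y hy (by omega)
  exact h.R_ge _ _ this.1 this.2.1 hy' (by omega)

theorem P_Q_T {x : ℕ} (hx : 1 ≤ x) (hx' : x ≤ N) : P (Q (T x)) = T x :=
  h.PQ _ (h.T_at x hx hx').1 (h.T_at x hx hx').2.1

theorem Q_T_mem {x : ℕ} (hx : 1 ≤ x) (hx' : x ≤ N) : 1 ≤ Q (T x) ∧ Q (T x) ≤ N :=
  h.Q_mem _ (h.T_at x hx hx').1 (h.T_at x hx hx').2.1

theorem T_mono {x x' : ℕ} (hx : 1 ≤ x) (hxx : x ≤ x') (hx' : x' ≤ N) : T x ≤ T x' := by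
  have h1 := h.T_at x hx (by omega)
  have h2 := h.Q_T_mem hx (by omega)
  rw [← h.P_Q_T hx (by omega)]
  exact h.T_ge _ _ h2.1 (by omega) hx'

theorem inner_single {u : ℕ} (hu : 1 ≤ u) (hu' : u ≤ N) : InRange N T R u (P u) := by
  have := h.P_mem u hu hu'
  exact ⟨hu, hu', this.1, this.2, h.R_ge _ _ hu hu' this.2 le_rfl, h.T_ge _ _ hu le_rfl hu'⟩

theorem inner_right {X Y : ℕ} (i : InRange N T R X Y) : InRange N T R (R Y) Y := by
  obtain ⟨h1, h2, h3, h4, h5, h6⟩ := i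
  have := h.R_at Y h3 h4
  exact ⟨this.1, this.2.1, h3, h4, le_rfl, h6.trans (h.T_mono h1 h5 this.2.1)⟩

theorem inner_up {X Y : ℕ} (i : InRange N T R X Y) : InRange N T R X (T X) := by
  obtain ⟨h1, h2, h3, h4, h5, h6⟩ := i
  have := h.T_at X h1 h2
  exact ⟨h1, h2, this.1, this.2.1, h5.trans (h.R_mono h3 h6 this.2.1), le_rfl⟩

theorem inner_of_reach {c X Y : ℕ} (r : Reach N P T R c X Y) : InRange N T R X Y := by
  have := h.two_le
  induction r with
  | zero => simpa [h.P_one] using h.inner_single le_rfl (by omega)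
  | right _ ih => exact h.inner_right ih
  | up _ ih => exact h.inner_up ih
  | single u _ hu hu' _ ih => exact h.inner_single hu.le hu'
  | double l b _ hl hlb hb hP _ ih =>
    have h1 := h.P_mem l (by omega) (by omega)
    exact ⟨by omega, hb, h1.1, h1.2, h.R_ge _ _ (by omega) hb h1.2 hP.le,
      h.T_ge _ _ (by omega) hlb.le hb⟩

theorem sound_root : Sound N P T R 0 [] 1 1 := by
  have := h.two_le
  refine ⟨le_rfl, fun v hv hv' hn => absurd ⟨hv, h.one_lt_P hv hv'⟩ hn, ?_⟩
  simpa [h.P_one] using h.inner_single le_rfl (by omega)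

/-- A newly included point is beyond `(X, Y)` but at or before column `R Y`. Its value exceeds `Y`,
hence that of the point `R Y`, which therefore dominates it. -/
theorem sound_right {c X Y : ℕ} {L : List ℕ} (s : Sound N P T R c L X Y) :
    Sound N P T R (c + 1) (R Y :: L) (R Y) Y := by
  obtain ⟨s1, s2, s3⟩ := s
  have hR := h.R_at Y s3.2.2.1 s3.2.2.2.1
  refine ⟨by simpa using s1, fun v hv hv' hn => ?_, h.inner_right s3⟩
  by_cases e : X < v ∧ Y < P v
  · exact ⟨R Y, by simp, hR.1, hR.2.1, Or.inr ⟨by omega, by omega⟩⟩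
  · obtain ⟨d, hd, r⟩ := s2 v hv hv' e
    exact ⟨d, by simpa using Or.inr hd, r⟩

/-- The mirror image of `sound_right`: the highest of the first `X` points dominates what lies to
its right and not above it. -/
theorem sound_up {c X Y : ℕ} {L : List ℕ} (s : Sound N P T R c L X Y) :
    Sound N P T R (c + 1) (Q (T X) :: L) X (T X) := by
  obtain ⟨s1, s2, s3⟩ := s
  have hT := h.T_at X s3.1 s3.2.1
  have hT' := h.Q_T_mem s3.1 s3.2.1
  have hT2 := h.P_Q_T s3.1 s3.2.1
  refine ⟨by simpa using s1, fun v hv hv' hn => ?_, h.inner_up s3⟩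
  by_cases e : X < v ∧ Y < P v
  · exact ⟨_, by simp, hT'.1, hT'.2, Or.inl ⟨by omega, by omega⟩⟩
  · obtain ⟨d, hd, r⟩ := s2 v hv hv' e
    exact ⟨d, by simpa using Or.inr hd, r⟩

/-- The hypothesis puts the not yet dominated points left of `u` above `u`; those right of `u` that
the new frontier includes lie below `u`. In both cases they form an inversion with `u`. -/
theorem sound_single {c X Y u : ℕ} {L : List ℕ} (s : Sound N P T R c L X Y) (hu : 1 < u)
    (hu' : u ≤ N) (hX : ∀ v, X < v → v < u → Y < P v → P u ≤ P v) :
    Sound N P T R (c + 1) (u :: L) u (P u) := by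
  obtain ⟨s1, s2, s3⟩ := s
  refine ⟨by simpa using s1, fun v hv hv' hn => ?_, h.inner_single hu.le hu'⟩
  by_cases e : X < v ∧ Y < P v
  · refine ⟨u, by simp, hu.le, hu', ?_⟩
    by_cases h1 : v < u
    · exact Or.inr ⟨h1.le, hX v e.1 h1 e.2⟩
    · rcases Nat.eq_or_lt_of_not_lt h1 with rfl | h2
      · exact Or.inr ⟨le_rfl, le_rfl⟩
      · exact Or.inl ⟨by omega, by omega⟩
  · obtain ⟨d, hd, r⟩ := s2 v hv hv' e
    exact ⟨d, by simpa using Or.inr hd, r⟩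

/-- Stated for a column bound `x` and a row bound `y` rather than for an actual pair: the highest
point up to column `x` and the rightmost point up to row `y` do at least as well as any pair `(l,
b)` with `l = x` and `P b ≤ y`, and they are available from the tables. -/
theorem sound_double {c X Y x y : ℕ} {L : List ℕ} (s : Sound N P T R c L X Y) (hx : 1 ≤ x)
    (hx' : x ≤ N) (hy : 1 ≤ y) (hy' : y ≤ N) (hxy : x ≤ R y) (hyx : y ≤ T x)
    (hX : ∀ v, X < v → v < x → Y < P v → y ≤ P v) :
    Sound N P T R (c + 2) (R y :: Q (T x) :: L) (R y) (T x) := by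
  obtain ⟨s1, s2, s3⟩ := s
  have hT := h.T_at x hx hx'
  have hT' := h.Q_T_mem hx hx'
  have hT2 := h.P_Q_T hx hx'
  have hR := h.R_at y hy hy'
  refine ⟨by simpa using s1, fun v hv hv' hn => ?_, hR.1, hR.2.1, hT.1, hT.2.1,
    h.R_mono hy hyx hT.2.1, h.T_mono hx hxy hR.2.1⟩
  by_cases e : X < v ∧ Y < P v
  · have := hX v e.1
    -- A point that the high point misses either lies before column `x`, so `hX` puts it at height
    -- at least `y`, or lies above `T x`. Either way it is not below the right point, and it is not
    -- to the right of it.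
    by_cases h1 : Q (T x) ≤ v ∧ P v ≤ T x
    · exact ⟨Q (T x), by simp, hT'.1, hT'.2, Or.inl ⟨h1.1, by omega⟩⟩
    · exact ⟨R y, by simp, hR.1, hR.2.1, Or.inr ⟨by omega, by omega⟩⟩
  · obtain ⟨d, hd, r⟩ := s2 v hv hv' e
    exact ⟨d, by simpa using Or.inr (Or.inr hd), r⟩

end PermData

theorem Sound.mono {c c' X Y : ℕ} {L : List ℕ} (s : Sound N P T R c L X Y) (hc : c ≤ c') :
    Sound N P T R c' L X Y := ⟨s.1.trans hc, s.2⟩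

/-! ### Completeness: dominating sets are matched by reachable frontiers -/

/-- `(X, Y)` is the upper right corner of the bounding box of `D` and `(1, 1)`. -/
def Front (P : ℕ → ℕ) (D : Finset ℕ) (X Y : ℕ) : Prop :=
  (∀ d ∈ D, d ≤ X ∧ P d ≤ Y) ∧ (X = 1 ∨ X ∈ D) ∧ (Y = 1 ∨ ∃ d ∈ D, P d = Y)

theorem exists_front (P : ℕ → ℕ) (D : Finset ℕ) (hD : ∀ d ∈ D, 1 ≤ d ∧ 1 ≤ P d) :
    ∃ X Y, Front P D X Y := by
  rcases D.eq_empty_or_nonempty with rfl | hne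
  · exact ⟨1, 1, by simp [Front]⟩
  · obtain ⟨r, hr, hr'⟩ := D.exists_max_image id hne
    obtain ⟨t, ht, ht'⟩ := D.exists_max_image P hne
    exact ⟨r, P t, fun d hd => ⟨hr' d hd, ht' d hd⟩, Or.inr hr, Or.inr ⟨t, ht, rfl⟩⟩

namespace PermData

variable (h : PermData N P Q T R S)
include h

/-- A point to the upper right of the bounding box of `D` is not needed for the points that do not
lie to the upper right of it. -/
theorem exists_covers_of_covers {D : Finset ℕ} (hD : ∀ d ∈ D, 1 < d ∧ d ≤ N) {X Y d v : ℕ}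
    (f : Front P D X Y) (hX : X < d) (hY : Y < P d) (hv : 1 < v) (hv' : v ≤ N)
    (hn : ¬ (X < v ∧ Y < P v)) (c : Covers P d v) : ∃ e ∈ D, 1 ≤ e ∧ e ≤ N ∧ Covers P e v := by
  obtain ⟨f1, f2, f3⟩ := f
  have hv2 := h.one_lt_P hv hv'
  rcases c with ⟨c1, c2⟩ | ⟨c1, c2⟩
  · rcases f3 with rfl | ⟨e, he, rfl⟩
    · omega
    · have := hD e he
      have := f1 e he
      exact ⟨e, he, by omega, by omega, Or.inl ⟨by omega, by omega⟩⟩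
  · rcases f2 with rfl | he
    · omega
    · have := hD X he
      have := f1 X he
      exact ⟨X, he, by omega, by omega, Or.inr ⟨by omega, by omega⟩⟩

/-- Every dominating set is reached at no more than its cardinality. -/
theorem exists_reach (D : Finset ℕ) (hD : ∀ d ∈ D, 1 < d ∧ d ≤ N) {X Y : ℕ} (f : Front P D X Y)
    (g : Good N P D X Y) : ∃ c ≤ D.card, ∃ X' Y', X ≤ X' ∧ Y ≤ Y' ∧ Reach N P T R c X' Y' := by
  induction hk : D.card using Nat.strong_induction_on generalizing D X Y with
  | _ k ih =>
  subst hk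
  have hfr : ∀ E ⊆ D, ∃ X Y, Front P E X Y := fun E hE =>
    exists_front P E fun d hd => ⟨(hD d (hE hd)).1.le,
      (h.one_lt_P (hD d (hE hd)).1 (hD d (hE hd)).2).le⟩
  have f' := f
  obtain ⟨f1, f2, f3⟩ := f
  rcases D.eq_empty_or_nonempty with rfl | ⟨d0, hd0⟩
  · simp only [Finset.notMem_empty, or_false, false_and, exists_false] at f2 f3
    subst f2 f3
    exact ⟨0, by simp, 1, 1, le_rfl, le_rfl, .zero⟩
  have hr : X ∈ D := by
    refine f2.resolve_left fun e => ?_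
    have := hD d0 hd0
    have := f1 d0 hd0
    omega
  obtain ⟨t, ht, htY⟩ : ∃ d ∈ D, P d = Y := by
    refine f3.resolve_left fun e => ?_
    have := h.one_lt_P (hD d0 hd0).1 (hD d0 hd0).2
    have := f1 d0 hd0
    omega
  clear f2 f3
  have hrN := hD X hr
  have htN := hD t ht
  have hrP := h.one_lt_P hrN.1 hrN.2
  have htP := h.one_lt_P htN.1 htN.2
  have inj : ∀ d ∈ D, ∀ e ∈ D, P d = P e → d = e := fun d hd e he =>
    h.inj (hD d hd).1.le (hD d hd).2 (hD e he).1.le (hD e he).2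
  rcases eq_or_ne X t with hrt | hrt
  · subst hrt
    -- One point is both rightmost and topmost, so all others lie to its lower left. They already
    -- dominate everything not beyond their own front, and the last point is a `single` move.
    obtain ⟨X', Y', fe⟩ := hfr (D.erase X) (Finset.erase_subset _ _)
    have hlt : ∀ d ∈ D.erase X, d < X ∧ P d < P X := by
      intro d hd
      rw [Finset.mem_erase] at hd
      have h1 := f1 d hd.2
      have h2 : P d ≠ P X := fun e => hd.1 (inj d hd.2 X hr e)
      omega
    have hX' : X' < X := by
      rcases fe.2.1 with e | e
      · omega
      · exact (hlt _ e).1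
    have hY' : Y' < P X := by
      rcases fe.2.2 with e | ⟨d, hd, rfl⟩
      · omega
      · exact (hlt _ hd).2
    have hD' : ∀ d ∈ D.erase X, 1 < d ∧ d ≤ N := fun d hd => hD d (Finset.mem_of_mem_erase hd)
    have ge : Good N P (D.erase X : Finset ℕ) X' Y' := by
      intro v hv hv' hn
      obtain ⟨d, hd, h1, h2, h3⟩ := g v hv hv' (by omega)
      by_cases e : d = X
      · subst e
        exact h.exists_covers_of_covers hD' fe hX' hY' hv hv' hn h3
      · exact ⟨d, by simp [e, hd], h1, h2, h3⟩
    have hcard := Finset.card_erase_add_one hr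
    obtain ⟨c, hc, X'', Y'', hx, hy, r⟩ := ih _ (by omega) _ hD' fe ge rfl
    refine ⟨c + 1, by omega, X, P X, le_rfl, htY.ge, .single X r hrN.1 hrN.2 ?_⟩
    intro v hv1 hv2 hv3
    by_contra hlt'
    have hX1 : 1 ≤ X'' := (h.inner_of_reach r).1
    obtain ⟨d, hd, h1, h2, h3⟩ := g v (by omega) (by omega) (by omega)
    by_cases e : d = X
    · subst e
      rcases h3 with h3 | h3 <;> omega
    -- The point `v` lies strictly beyond all earlier points, so none of them can dominate it.
    · have := fe.1 d (by simpa using ⟨e, hd⟩)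
      rcases h3 with h3 | h3 <;> omega
  have hXt : t < X ∧ P X < P t := by
    have h1 := f1 t ht
    have h2 := f1 X hr
    have h3 : P X ≠ P t := fun e => hrt (inj X hr t ht e)
    omega
  obtain ⟨X1, Y1, fr⟩ := hfr (D.erase X) (Finset.erase_subset _ _)
  obtain ⟨X2, Y2, ft⟩ := hfr (D.erase t) (Finset.erase_subset _ _)
  have hcr := Finset.card_erase_add_one hr
  have hct := Finset.card_erase_add_one ht
  have htr : t ∈ D.erase X := by simpa using ⟨hrt.symm, ht⟩
  have hrt' : X ∈ D.erase t := by simpa using ⟨hrt, hr⟩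
  have hY1 : Y1 = Y := by
    have := fr.1 t htr
    rcases fr.2.2 with e | ⟨d, hd, e⟩
    · omega
    · have := f1 d (Finset.mem_of_mem_erase hd)
      omega
  have hX1 : X1 ≤ X := by
    rcases fr.2.1 with e | e
    · omega
    · exact (f1 _ (Finset.mem_of_mem_erase e)).1
  have hX2 : X2 = X := by
    have := ft.1 X hrt'
    rcases ft.2.1 with e | e
    · omega
    · have := f1 _ (Finset.mem_of_mem_erase e)
      omega
  have hY2 : Y2 ≤ Y := by
    rcases ft.2.2 with e | ⟨d, hd, rfl⟩
    · omega
    · exact (f1 _ (Finset.mem_of_mem_erase hd)).2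
  subst hY1 hX2
  -- If the rest suffices for its own front without the rightmost point, a `right` move regains
  -- column `X2`, since the row reached is at least that of `X2`.
  by_cases gr : Good N P (D.erase X2 : Finset ℕ) X1 Y1
  · obtain ⟨c, hc, X', Y', hx, hy, r⟩ := ih _ (by omega) _
      (fun d hd => hD d (Finset.mem_of_mem_erase hd)) fr gr rfl
    have i := h.inner_of_reach r
    exact ⟨c + 1, by omega, R Y', Y', h.R_ge _ _ hrN.1.le hrN.2 i.2.2.2.1 (by omega), hy,
      .right r⟩
  -- The same for the topmost point `t` and an `up` move.
  by_cases gt : Good N P (D.erase t : Finset ℕ) X2 Y2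
  · obtain ⟨c, hc, X', Y', hx, hy, r⟩ := ih _ (by omega) _
      (fun d hd => hD d (Finset.mem_of_mem_erase hd)) ft gt rfl
    have i := h.inner_of_reach r
    refine ⟨c + 1, by omega, X', T X', hx, ?_, .up r⟩
    rw [← htY]
    exact h.T_ge _ _ htN.1.le (by omega) i.2.1
  -- Both extreme points are needed, so each has a private point: within `D`, only `X2` dominates
  -- `a`, and only `t` dominates `b`.
  simp only [Good, not_forall] at gr gt
  obtain ⟨a, ha, ha', hna, hca⟩ := gr
  obtain ⟨b, hb, hb', hnb, hcb⟩ := gt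
  have hca : ∀ d ∈ D, d ≠ X2 → ¬ Covers P d a := fun d hd hne hc =>
    hca ⟨d, by simp [hne, hd], (hD d hd).1.le, (hD d hd).2, hc⟩
  have hcb : ∀ d ∈ D, d ≠ t → ¬ Covers P d b := fun d hd hne hc =>
    hcb ⟨d, by simp [hne, hd], (hD d hd).1.le, (hD d hd).2, hc⟩
  have ha2 := h.one_lt_P ha ha'
  have hb2 := h.one_lt_P hb hb'
  have hA : a < t ∧ P a < P t ∧ P X2 ≤ P a := by
    obtain ⟨d, hd, -, -, h3⟩ := g a ha ha' (by omega)
    have e : d = X2 := by by_contra e; exact hca d hd e h3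
    have h4 := hca t ht hrt.symm
    subst e
    simp only [Covers] at h3 h4
    have h5 : a < t := by
      by_contra h5
      rcases fr.2.1 with e | e
      · omega
      · have h7 := hca X1 (Finset.mem_of_mem_erase e) (Finset.ne_of_mem_erase e)
        have h8 := fr.1 X1 e
        simp only [Covers] at h7
        omega
    omega
  have hB : t ≤ b ∧ b < X2 ∧ P b < P X2 := by
    obtain ⟨d, hd, -, -, h3⟩ := g b hb hb' (by omega)
    have e : d = t := by by_contra e; exact hcb d hd e h3
    have h4 := hcb X2 hr hrt
    subst e
    simp only [Covers] at h3 h4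
    have h5 : P b < P X2 := by
      by_contra h5
      rcases ft.2.2 with e | ⟨e, he, he'⟩
      · omega
      · have h7 := hcb e (Finset.mem_of_mem_erase he) (Finset.ne_of_mem_erase he)
        have h8 := ft.1 e he
        simp only [Covers] at h7
        omega
    omega
  -- Any other chosen point forms no inversion with `a` or `b`. As `a` is to the upper left of `b`,
  -- it must lie to the lower left of both or to the upper right of both.
  have hab : ∀ d ∈ D, d ≠ X2 → d ≠ t →
      (d < a ∧ P d < P b) ∨ (b < d ∧ P a < P d) := by
    intro d hd h1 h2
    have h3 := hca d hd h1
    have h4 := hcb d hd h2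
    simp only [Covers] at h3 h4
    omega
  -- A chosen point `u` on the upper right lies strictly between `t` and `X2` in both coordinates.
  -- Whatever it dominates, `t` dominates on its right side and `X2` on its left side, so `u` can be
  -- dropped without changing the front.
  by_cases hU : ∃ d ∈ D, d ≠ X2 ∧ d ≠ t ∧ b < d ∧ P a < P d
  · obtain ⟨u, hu, hu1, hu2, hu3, hu4⟩ := hU
    have hU1 : P u < P t := by
      have := f1 u hu
      have : P u ≠ P t := fun e => hu2 (inj u hu t ht e)
      omega
    have hU2 : u < X2 := by
      have := f1 u hu
      omega
    have hcu := Finset.card_erase_add_one hu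
    have fu : Front P (D.erase u) X2 Y1 :=
      ⟨fun d hd => f1 d (Finset.mem_of_mem_erase hd), Or.inr (by simpa using ⟨hu1.symm, hr⟩),
        Or.inr ⟨t, by simpa using ⟨hu2.symm, ht⟩, htY⟩⟩
    obtain ⟨c, hc, r⟩ := ih _ (by omega) _ (fun d hd => hD d (Finset.mem_of_mem_erase hd)) fu
      (by
        intro v hv hv' hn
        obtain ⟨d, hd, h1, h2, h3⟩ := g v hv hv' hn
        by_cases e : d = u
        · subst e
          rcases h3 with h3 | h3
          · exact ⟨t, by simp [hu2.symm, ht], by omega, by omega,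
              Or.inl ⟨by omega, by omega⟩⟩
          · exact ⟨X2, by simp [hu1.symm, hr], by omega, by omega,
              Or.inr ⟨by omega, by omega⟩⟩
        · exact ⟨d, by simp [e, hd], h1, h2, h3⟩) rfl
    exact ⟨c, by omega, r⟩
  · have hsw : ∀ d ∈ (D.erase X2).erase t, d < a ∧ P d < P b := by
      intro d hd
      simp only [Finset.mem_erase] at hd
      rcases hab d hd.2.2 hd.2.1 hd.1 with e | e
      · exact e
      · exact absurd ⟨d, hd.2.2, hd.2.1, hd.1, e⟩ hU
    obtain ⟨X0, Y0, f0⟩ := hfr ((D.erase X2).erase t)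
      ((Finset.erase_subset _ _).trans (Finset.erase_subset _ _))
    have hX0 : X0 < a := by
      rcases f0.2.1 with e | e
      · omega
      · exact (hsw _ e).1
    have hY0 : Y0 < P b := by
      rcases f0.2.2 with e | ⟨d, hd, rfl⟩
      · omega
      · exact (hsw _ hd).2
    have hD' : ∀ d ∈ (D.erase X2).erase t, 1 < d ∧ d ≤ N := fun d hd =>
      hD d (Finset.mem_of_mem_erase (Finset.mem_of_mem_erase hd))
    have hcard := Finset.card_erase_add_one htr
    obtain ⟨c, hc, X', Y', hx, hy, r⟩ := ih _ (by omega) _ hD' f0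
      (by
        intro v hv hv' hn
        obtain ⟨d, hd, h1, h2, h3⟩ := g v hv hv' (by omega)
        by_cases e : d = t
        · subst e
          exact h.exists_covers_of_covers hD' f0 (by omega) (by omega) hv hv' hn h3
        by_cases e' : d = X2
        · subst e'
          exact h.exists_covers_of_covers hD' f0 (by omega) (by omega) hv hv' hn h3
        · exact ⟨d, by simp [e, e', hd], h1, h2, h3⟩) rfl
    -- With everything else to the lower left of `a` and `b`, the points `t` and `X2` are added as a
    -- pair. A violation of the pair condition would be a point that neither they nor the earlier
    -- points dominate.
    refine ⟨c + 2, by omega, X2, P t, le_rfl, htY.ge, .double t X2 r htN.1 hXt.1 hrN.2 hXt.2 ?_⟩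
    intro v hv1 hv2 hv3
    by_contra hlt
    have hX1 : 1 ≤ X' := (h.inner_of_reach r).1
    obtain ⟨d, hd, h1, h2, h3⟩ := g v (by omega) (by omega) (by omega)
    by_cases e : d = t
    · subst e
      rcases h3 with h3 | h3 <;> omega
    by_cases e' : d = X2
    · subst e'
      rcases h3 with h3 | h3 <;> omega
    · have := f0.1 d (by simpa using ⟨e, e', hd⟩)
      rcases h3 with h3 | h3 <;> omega

end PermData

end

/-! ### Shared witness lists, and the window of a sweep -/

section

variable {N : ℕ} {P Q T R S : ℕ → ℕ}

/-- Following the predecessors `A` from the node `i`, one reads the labels `L`. -/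
inductive Chain (A B : ℕ → ℕ) : ℕ → List ℕ → Prop
  | nil : Chain A B 0 []
  | cons {i : ℕ} {L : List ℕ} : A i < i → Chain A B (A i) L → Chain A B i (B i :: L)

theorem Chain.congr {A B A' B' : ℕ → ℕ} {k i : ℕ} {L : List ℕ} (h : Chain A B i L)
    (hA : ∀ j < k, A' j = A j) (hB : ∀ j < k, B' j = B j) (hi : i < k) : Chain A' B' i L := by
  induction h with
  | nil => exact .nil
  | @cons i L h1 h2 ih =>
    rw [← hB i hi]
    refine .cons (by rw [hA i hi]; exact h1) ?_
    rw [hA i hi]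
    exact ih (by omega)

/-- Among the first `k` nodes, the node `i` lists points that witness the frontier `(X, Y)`. -/
def Node (N : ℕ) (P T R A B : ℕ → ℕ) (k c i X Y : ℕ) : Prop :=
  i < k ∧ ∃ L, Chain A B i L ∧ Sound N P T R c L X Y

theorem Node.mono {A B : ℕ → ℕ} {k c c' i X Y : ℕ} (h : Node N P T R A B k c i X Y)
    (hc : c ≤ c') : Node N P T R A B k c' i X Y :=
  ⟨h.1, h.2.imp fun _ hL => ⟨hL.1, hL.2.mono hc⟩⟩

/-- Predecessor pointers lead to smaller indices, so writing at the fresh index `k` disturbs no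
existing chain. -/
theorem Node.push {A B : ℕ → ℕ} {k c i X Y : ℕ} (h : Node N P T R A B k c i X Y) (a b : ℕ) :
    Node N P T R (Function.update A k a) (Function.update B k b) (k + 1) c i X Y := by
  obtain ⟨h1, L, h2, h3⟩ := h
  exact ⟨by omega, L, h2.congr (fun j hj => Function.update_of_ne hj.ne _ _)
    (fun j hj => Function.update_of_ne hj.ne _ _) h1, h3⟩

theorem Node.new {A B : ℕ → ℕ} {k c c' i X Y X' Y' b : ℕ} (h : Node N P T R A B k c i X Y)
    (hs : ∀ L, Sound N P T R c L X Y → Sound N P T R c' (b :: L) X' Y') :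
    Node N P T R (Function.update A k i) (Function.update B k b) (k + 1) c' k X' Y' := by
  have h' := h.push i b
  obtain ⟨h1, L, h2, h3⟩ := h
  obtain ⟨-, L', h2', h3'⟩ := h'
  refine ⟨by omega, b :: L, ?_, hs L h3⟩
  have := Chain.cons (A := Function.update A k i) (B := Function.update B k b) (i := k) (L := L)
    (by simpa using h1) (by
      rw [Function.update_self]
      exact h2.congr (fun j hj => Function.update_of_ne hj.ne _ _)
        (fun j hj => Function.update_of_ne hj.ne _ _) h1)
  simpa using this

theorem Node.new_two {A B : ℕ → ℕ} {k c c' i X Y X' Y' b b' : ℕ}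
    (h : Node N P T R A B k c i X Y)
    (hs : ∀ L, Sound N P T R c L X Y → Sound N P T R c' (b' :: b :: L) X' Y') :
    Node N P T R (Function.update (Function.update A k i) (k + 1) k)
      (Function.update (Function.update B k b) (k + 1) b') (k + 2) c' (k + 1) X' Y' := by
  obtain ⟨h1, L, h2, h3⟩ := h
  have e1 : Chain (Function.update A k i) (Function.update B k b) k (b :: L) := by
    have := Chain.cons (A := Function.update A k i) (B := Function.update B k b) (i := k) (L := L)
      (by simpa using h1) (by
        rw [Function.update_self]
        exact h2.congr (fun j hj => Function.update_of_ne hj.ne _ _)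
          (fun j hj => Function.update_of_ne hj.ne _ _) h1)
    simpa using this
  refine ⟨by omega, b' :: b :: L, ?_, hs L h3⟩
  have := Chain.cons (A := Function.update (Function.update A k i) (k + 1) k)
    (B := Function.update (Function.update B k b) (k + 1) b') (i := k + 1) (L := b :: L)
    (by simp) (by
      rw [Function.update_self]
      exact e1.congr (fun j hj => Function.update_of_ne hj.ne _ _)
        (fun j hj => Function.update_of_ne hj.ne _ _) (Nat.lt_succ_self k))
  simpa using this

/-- The window between the frontier column `z` and the column `x` of a sweep: `mu` is the largest
value up to `q` in it, `nu` the smallest larger value, and no frontier to the right of `z`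
survives the sweep. The frontier in column `z` has the row `F z`, where `0` means none. -/
structure Window (N : ℕ) (P F : ℕ → ℕ) (pp p q x z mu nu : ℕ) : Prop where
  le_z : pp ≤ z
  z_le : z ≤ p
  mu_ge : ∀ v, z < v → v < x → P v ≤ q → P v ≤ mu
  mu_at : mu = 0 ∨ ∃ v, z < v ∧ v < x ∧ P v = mu ∧ P v ≤ q
  nu_le : ∀ v, z < v → v < x → q < P v → nu ≤ P v
  nu_at : nu = N + 1 ∨ ∃ v, z < v ∧ v < x ∧ P v = nu
  q_lt : q < nu
  gone : ∀ z', z < z' → z' ≤ p → F z' ≠ 0 → ∃ v, z' < v ∧ v < x ∧ F z' < P v ∧ P v ≤ q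

/-- No frontier survives the sweep. -/
def Extinct (P F : ℕ → ℕ) (pp p q x mu nu : ℕ) : Prop :=
  nu = 0 ∧ mu = 0 ∧
    ∀ z', pp ≤ z' → z' ≤ p → F z' ≠ 0 → ∃ v, z' < v ∧ v < x ∧ F z' < P v ∧ P v ≤ q

variable {F : ℕ → ℕ} {pp p q x z mu nu : ℕ}

theorem Window.init (hp : pp ≤ p) (hq : q ≤ N) : Window N P F pp p q (p + 1) p 0 (N + 1) where
  le_z := hp
  z_le := le_rfl
  mu_ge v h1 h2 := by omega
  mu_at := Or.inl rfl
  nu_le v h1 h2 := by omega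
  nu_at := Or.inl rfl
  q_lt := by omega
  gone z' h1 h2 := by omega

theorem Window.right_low (w : Window N P F pp p q x z mu nu) (hx : p < x) (h : P x ≤ q) :
    Window N P F pp p q (x + 1) z (max mu (P x)) nu where
  le_z := w.le_z
  z_le := w.z_le
  mu_ge v h1 h2 h3 := by
    rcases Nat.lt_succ_iff_lt_or_eq.1 h2 with h4 | rfl
    · exact (w.mu_ge v h1 h4 h3).trans (le_max_left _ _)
    · exact le_max_right _ _
  mu_at := by
    have := w.z_le
    rcases le_total (P x) mu with h1 | h1
    · rw [max_eq_left h1]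
      exact w.mu_at.imp_right fun ⟨v, h2, h3, h4⟩ => ⟨v, h2, by omega, h4⟩
    · rw [max_eq_right h1]
      exact Or.inr ⟨x, by omega, by omega, rfl, h⟩
  nu_le v h1 h2 h3 := by
    rcases Nat.lt_succ_iff_lt_or_eq.1 h2 with h4 | rfl
    · exact w.nu_le v h1 h4 h3
    · omega
  nu_at := w.nu_at.imp_right fun ⟨v, h2, h3, h4⟩ => ⟨v, h2, by omega, h4⟩
  q_lt := w.q_lt
  gone z' h1 h2 h3 := (w.gone z' h1 h2 h3).imp fun v h => ⟨h.1, by omega, h.2.2⟩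

theorem Window.right_high (w : Window N P F pp p q x z mu nu) (hx : p < x) (h : q < P x) :
    Window N P F pp p q (x + 1) z mu (min nu (P x)) where
  le_z := w.le_z
  z_le := w.z_le
  mu_ge v h1 h2 h3 := by
    rcases Nat.lt_succ_iff_lt_or_eq.1 h2 with h4 | rfl
    · exact w.mu_ge v h1 h4 h3
    · omega
  mu_at := w.mu_at.imp_right fun ⟨v, h2, h3, h4⟩ => ⟨v, h2, by omega, h4⟩
  nu_le v h1 h2 h3 := by
    rcases Nat.lt_succ_iff_lt_or_eq.1 h2 with h4 | rfl
    · exact (min_le_left _ _).trans (w.nu_le v h1 h4 h3)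
    · exact min_le_right _ _
  nu_at := by
    have := w.z_le
    rcases le_total nu (P x) with h1 | h1
    · rw [min_eq_left h1]
      exact w.nu_at.imp_right fun ⟨v, h2, h3, h4⟩ => ⟨v, h2, by omega, h4⟩
    · rw [min_eq_right h1]
      exact Or.inr ⟨x, by omega, by omega, rfl⟩
  q_lt := lt_min w.q_lt h
  gone z' h1 h2 h3 := (w.gone z' h1 h2 h3).imp fun v h => ⟨h.1, by omega, h.2.2⟩

/-- The point of value `mu` is beyond the frontier of column `z` and has value at most `q`, so it
blocks every later move from there to a value above `q`. -/
theorem Window.gone_self (w : Window N P F pp p q x z mu nu) (hF : F z < mu) :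
    ∃ v, z < v ∧ v < x ∧ F z < P v ∧ P v ≤ q := by
  rcases w.mu_at with h | ⟨v, h1, h2, h3, h4⟩
  · omega
  · exact ⟨v, h1, h2, by omega, h4⟩

theorem Window.extinct (w : Window N P F pp p q x z mu nu) (hF : F z < mu) (hz : z ≤ pp) :
    Extinct P F pp p q x 0 0 := by
  refine ⟨rfl, rfl, fun z' h1 h2 h3 => ?_⟩
  rcases Nat.eq_or_lt_of_le (hz.trans h1) with rfl | h4
  · exact w.gone_self hF
  · exact w.gone z' h4 h2 h3

/-- When the frontier column retreats, the point of the old column `z` itself enters the window, so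
its value has to be merged into `mu` (or into `nu`, in `left_high`). -/
theorem Window.left_low (w : Window N P F pp p q x z mu nu) (hx : p < x) (hF : F z < mu)
    (hz : pp < z) (h : P z ≤ q) : Window N P F pp p q x (z - 1) (max mu (P z)) nu where
  le_z := by omega
  z_le := by have := w.z_le; omega
  mu_ge v h1 h2 h3 := by
    rcases Nat.eq_or_lt_of_le (show z ≤ v by omega) with rfl | h4
    · exact le_max_right _ _
    · exact (w.mu_ge v h4 h2 h3).trans (le_max_left _ _)
  mu_at := by
    have := w.z_le
    rcases le_total (P z) mu with h1 | h1
    · rw [max_eq_left h1]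
      exact w.mu_at.imp_right fun ⟨v, h2, h3, h4⟩ => ⟨v, by omega, h3, h4⟩
    · rw [max_eq_right h1]
      exact Or.inr ⟨z, by omega, by omega, rfl, h⟩
  nu_le v h1 h2 h3 := by
    rcases Nat.eq_or_lt_of_le (show z ≤ v by omega) with rfl | h4
    · omega
    · exact w.nu_le v h4 h2 h3
  nu_at := w.nu_at.imp_right fun ⟨v, h2, h3, h4⟩ => ⟨v, by omega, h3, h4⟩
  q_lt := w.q_lt
  gone z' h1 h2 h3 := by
    rcases Nat.eq_or_lt_of_le (show z ≤ z' by omega) with rfl | h4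
    · exact w.gone_self hF
    · exact w.gone z' h4 h2 h3

theorem Window.left_high (w : Window N P F pp p q x z mu nu) (hx : p < x) (hF : F z < mu)
    (hz : pp < z) (h : q < P z) : Window N P F pp p q x (z - 1) mu (min nu (P z)) where
  le_z := by omega
  z_le := by have := w.z_le; omega
  mu_ge v h1 h2 h3 := by
    rcases Nat.eq_or_lt_of_le (show z ≤ v by omega) with rfl | h4
    · omega
    · exact w.mu_ge v h4 h2 h3
  mu_at := w.mu_at.imp_right fun ⟨v, h2, h3, h4⟩ => ⟨v, by omega, h3, h4⟩
  nu_le v h1 h2 h3 := by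
    rcases Nat.eq_or_lt_of_le (show z ≤ v by omega) with rfl | h4
    · exact min_le_right _ _
    · exact (min_le_left _ _).trans (w.nu_le v h4 h2 h3)
  nu_at := by
    have := w.z_le
    rcases le_total nu (P z) with h1 | h1
    · rw [min_eq_left h1]
      exact w.nu_at.imp_right fun ⟨v, h2, h3, h4⟩ => ⟨v, by omega, h3, h4⟩
    · rw [min_eq_right h1]
      exact Or.inr ⟨z, by omega, by omega, rfl⟩
  q_lt := lt_min w.q_lt h
  gone z' h1 h2 h3 := by
    rcases Nat.eq_or_lt_of_le (show z ≤ z' by omega) with rfl | h4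
    · exact w.gone_self hF
    · exact w.gone z' h4 h2 h3

/-- If nothing above the frontier in column `z'` and left of `x` is below row `y`, then the
sweep has survived up to `x`, and `nu` is at least `y`. -/
theorem Window.of_clear (hw : Window N P F pp p q x z mu nu ∨ Extinct P F pp p q x mu nu)
    {z' y : ℕ} (h1 : pp ≤ z') (h2 : z' ≤ p) (h3 : F z' ≠ 0) (hF : F z' ≤ q) (hy : q < y)
    (hyN : y ≤ N) (hc : ∀ v, z' < v → v < x → F z' < P v → y ≤ P v) :
    Window N P F pp p q x z mu nu ∧ y ≤ nu := by
  have key : ¬ ∃ v, z' < v ∧ v < x ∧ F z' < P v ∧ P v ≤ q := by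
    rintro ⟨v, h4, h5, h6, h7⟩
    have := hc v h4 h5 h6
    omega
  rcases hw with w | w
  · have hz : z' ≤ z := by
      by_contra h
      exact key (w.gone z' (by omega) h2 h3)
    refine ⟨w, ?_⟩
    have := w.q_lt
    rcases w.nu_at with h4 | ⟨v, h4, h5, h6⟩
    · omega
    · have := hc v (by omega) h5 (by omega)
      omega
  · exact absurd (w.2.2 z' h1 h2 h3) key

namespace PermData

variable (h : PermData N P Q T R S)
include h

/-- Strictness comes from injectivity: if `nu` is a value at all, it belongs to a column before `x`,
and `u` is not one of these. -/
theorem lt_of_clear (hw : Window N P F pp p q x z mu nu ∨ Extinct P F pp p q x mu nu)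
    {z' u : ℕ} (h1 : pp ≤ z') (h2 : z' ≤ p) (h3 : F z' ≠ 0) (hF : F z' ≤ q) (hu : q < P u)
    (hu1 : 1 ≤ u) (huN : u ≤ N) (hxu : x ≤ u)
    (hc : ∀ v, z' < v → v < u → F z' < P v → P u ≤ P v) :
    Window N P F pp p q x z mu nu ∧ P u < nu := by
  have := h.P_mem u hu1 huN
  obtain ⟨w, hle⟩ := Window.of_clear hw h1 h2 h3 hF hu this.2
    fun v h4 h5 h6 => hc v h4 (by omega) h6
  refine ⟨w, ?_⟩
  rcases w.nu_at with h4 | ⟨v, h4, h5, h6⟩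
  · omega
  · rcases Nat.eq_or_lt_of_le hle with e | e
    · have := h.inj hu1 huN (by omega) (by omega) (e.trans h6.symm)
      omega
    · exact e

/-- Once `nu` is at most all the remaining values, no single point can follow. -/
theorem no_single_of_le (hw : Window N P F pp p q x z mu nu ∨ Extinct P F pp p q x mu nu)
    {z' u : ℕ} (h1 : pp ≤ z') (h2 : z' ≤ p) (h3 : F z' ≠ 0) (hF : F z' ≤ q) (hu : q < P u)
    (hx1 : 1 ≤ x) (huN : u ≤ N) (hxu : x ≤ u) (hS : nu ≤ S x) :
    ¬ ∀ v, z' < v → v < u → F z' < P v → P u ≤ P v := by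
  intro hc
  have := (h.lt_of_clear hw h1 h2 h3 hF hu (by omega) huN hxu hc).2
  have := h.S_le x u hx1 hxu huN
  omega

/-- Once `nu` is at most all the remaining values, no pair of points can follow. -/
theorem no_double_of_le (hw : Window N P F pp p q x z mu nu ∨ Extinct P F pp p q x mu nu)
    {z' l b : ℕ} (h1 : pp ≤ z') (h2 : z' ≤ p) (h3 : F z' ≠ 0) (hF : F z' ≤ q) (hb : q < P b)
    (hx1 : 1 ≤ x) (hbN : b ≤ N) (hxl : x ≤ l) (hlb : l < b) (hS : nu ≤ S x) :
    ¬ ∀ v, z' < v → v < l → F z' < P v → P b ≤ P v := by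
  intro hc
  have hbm := h.P_mem b (by omega) hbN
  obtain ⟨w, hle⟩ := Window.of_clear hw h1 h2 h3 hF hb hbm.2
    fun v h4 h5 h6 => hc v h4 (by omega) h6
  have h4 := h.S_le x b hx1 (by omega) hbN
  rcases w.nu_at with h5 | ⟨v, h5, h6, h7⟩
  · omega
  · have := h.inj (by omega) hbN (by omega) (by omega) (show P b = P v by omega)
    omega

/-- Beyond the frontier of `z`, the window contains no value up to `q`, since these are at most `mu`
and hence at most `F z`; all others are at least `nu`. -/
theorem sound_window_single {c : ℕ} {L : List ℕ} (w : Window N P F pp p q x z mu nu)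
    (hF : mu ≤ F z) (s : Sound N P T R c L z (F z)) (hx : 1 < x) (hxN : x ≤ N)
    (hq : P x < nu) : Sound N P T R (c + 1) (x :: L) x (P x) := by
  refine h.sound_single s hx hxN fun v h1 h2 h3 => ?_
  by_cases h4 : P v ≤ q
  · have := w.mu_ge v h1 h2 h4
    omega
  · have := w.nu_le v h1 h2 (by omega)
    omega

/-- A value below `nu` still occurs at or after column `x`, and `R nu` is at least its column. The
stopping test of the sweep thus provides what a pair needs. -/
theorem le_R_of_S_lt (hx : 1 ≤ x) (hxN : x ≤ N) (hnu : nu ≤ N) (hS : S x < nu) : x ≤ R nu := by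
  obtain ⟨v, h1, h2, h3⟩ := h.S_at x hx hxN
  exact h1.trans (h.R_ge v nu (by omega) h2 hnu (by omega))

theorem nu_le_T (w : Window N P F pp p q x z mu nu) (hxN : x ≤ N) (hnu : nu ≤ N) :
    nu ≤ T x := by
  rcases w.nu_at with h1 | ⟨v, h1, h2, rfl⟩
  · omega
  · exact h.T_ge _ _ (by omega) h2.le hxN

/-- The row bound `nu` is the largest one that the window allows, so it gives the strongest pair
whose left point is in column `x`. -/
theorem sound_window_double {c : ℕ} {L : List ℕ} (w : Window N P F pp p q x z mu nu)
    (hF : mu ≤ F z) (s : Sound N P T R c L z (F z)) (hx : 1 ≤ x) (hxN : x ≤ N)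
    (hnu : nu ≤ N) (hS : S x < nu) :
    Sound N P T R (c + 2) (R nu :: Q (T x) :: L) (R nu) (T x) := by
  have hq := w.q_lt
  refine h.sound_double s hx hxN (by omega) hnu (h.le_R_of_S_lt hx hxN hnu hS)
    (h.nu_le_T w hxN hnu) fun v h1 h2 h3 => ?_
  by_cases h4 : P v ≤ q
  · have := w.mu_ge v h1 h2 h4
    omega
  · exact w.nu_le v h1 h2 (by omega)

end PermData

end

/-! ### The stored frontiers of three consecutive levels -/

section

variable {N : ℕ} {P Q T R S F G Y D A B : ℕ → ℕ} {c pp p q par t k np nq nqn : ℕ}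

/-- The stored frontiers while level `c` is processed. The cell `2 * X + par` of `Y` holds the row
of a frontier in column `X`, and the same cell of `D` its node. The frontiers of level `c`, with
rows `F`, lie in the columns from `pp` to `p` and have the parity `par`; those of level `c + 1`
have the other parity, and those of level `c + 2` the parity `par` and columns beyond `p`.
The largest column and row of level `c + 1` so far are `np` and `nq`. -/
structure Heap (N : ℕ) (P T R F G : ℕ → ℕ) (c pp p q par t : ℕ) (Y D A B : ℕ → ℕ)
    (k np nq nqn : ℕ) : Prop where
  k_pos : 0 < k
  cur : ∀ X, pp ≤ X → X ≤ p → Y (2 * X + par) = F X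
  cur_node : ∀ X, pp ≤ X → X ≤ p → F X ≠ 0 → Node N P T R A B k c (D (2 * X + par)) X (F X)
  far : ∀ X, p < X → Y (2 * X + par) ≠ 0 →
    Node N P T R A B k (c + 2) (D (2 * X + par)) X (Y (2 * X + par))
  next : ∀ X, p ≤ X → Y (2 * X + (1 - par)) ≠ 0 →
    Node N P T R A B k (c + 1) (D (2 * X + (1 - par))) X (Y (2 * X + (1 - par)))
  best : ∃ X, Node N P T R A B k (c + 1) nqn X nq
  np_cell : np = p ∨ Y (2 * np + (1 - par)) ≠ 0
  p_le : p ≤ np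
  np_le : np ≤ N
  R_le : R q ≤ np
  T_le : T p ≤ nq
  nq_le : nq ≤ N
  nq_le_T : nq ≤ T t
  G_le : ∀ X, G X ≤ Y (2 * X + (1 - par))
  next_le : ∀ X, Y (2 * X + (1 - par)) ≤ nq
  far_le : ∀ X, Y (2 * X + par) ≤ T t

namespace Heap

theorem push (H : Heap N P T R F G c pp p q par t Y D A B k np nq nqn) (a b : ℕ) :
    Heap N P T R F G c pp p q par t Y D (Function.update A k a) (Function.update B k b) (k + 1)
      np nq nqn where
  k_pos := Nat.succ_pos k
  cur := H.cur
  cur_node X h1 h2 h3 := (H.cur_node X h1 h2 h3).push a b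
  far X h1 h2 := (H.far X h1 h2).push a b
  next X h1 h2 := (H.next X h1 h2).push a b
  best := H.best.imp fun X h => h.push a b
  np_cell := H.np_cell
  p_le := H.p_le
  np_le := H.np_le
  R_le := H.R_le
  T_le := H.T_le
  nq_le := H.nq_le
  nq_le_T := H.nq_le_T
  G_le := H.G_le
  next_le := H.next_le
  far_le := H.far_le

theorem mono_t (H : Heap N P T R F G c pp p q par t Y D A B k np nq nqn) {t' : ℕ}
    (ht : T t ≤ T t') : Heap N P T R F G c pp p q par t' Y D A B k np nq nqn :=
  { H with
    far_le := fun X => (H.far_le X).trans ht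
    nq_le_T := H.nq_le_T.trans ht }

/-- The column of the best row is immaterial, because only a `right` move will be made from it. -/
theorem raise_q (H : Heap N P T R F G c pp p q par t Y D A B k np nq nqn) {i X y : ℕ}
    (hi : Node N P T R A B k (c + 1) i X y) (hy : nq ≤ y) (hyN : y ≤ N) (hyT : y ≤ T t) :
    Heap N P T R F G c pp p q par t Y D A B k np y i :=
  { H with
    best := ⟨X, hi⟩
    T_le := H.T_le.trans hy
    nq_le := hyN
    nq_le_T := hyT
    next_le := fun X => (H.next_le X).trans hy }

theorem raise_p (H : Heap N P T R F G c pp p q par t Y D A B k np nq nqn) {X : ℕ}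
    (hX : np ≤ X) (hXN : X ≤ N) (hY : Y (2 * X + (1 - par)) ≠ 0) :
    Heap N P T R F G c pp p q par t Y D A B k X nq nqn :=
  { H with
    np_cell := Or.inr hY
    p_le := H.p_le.trans hX
    np_le := hXN
    R_le := H.R_le.trans hX }

/-- Levels `c` and `c + 1` use cells of different parity, so the level under treatment is not
overwritten. -/
theorem record_next (H : Heap N P T R F G c pp p q par t Y D A B k np nq nqn) {i X y : ℕ}
    (hi : Node N P T R A B k (c + 1) i X y) (hpar : par ≤ 1) (hy : y ≤ nq)
    (hlt : Y (2 * X + (1 - par)) < y) :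
    Heap N P T R F G c pp p q par t (Function.update Y (2 * X + (1 - par)) y)
      (Function.update D (2 * X + (1 - par)) i) A B k np nq nqn := by
  have e1 : ∀ X', 2 * X' + par ≠ 2 * X + (1 - par) := fun X' => by omega
  have e2 : ∀ X', 2 * X' + (1 - par) = 2 * X + (1 - par) ↔ X' = X := fun X' => by omega
  refine { H with cur := ?_, cur_node := ?_, far := ?_, next := ?_, np_cell := ?_, G_le := ?_,
                  next_le := ?_, far_le := ?_ } <;>
    simp only [Function.update_apply, e1, e2, if_false]
  · exact H.cur
  · exact H.cur_node
  · exact H.far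
  · intro X' h1 h2
    split_ifs with h3
    · exact h3 ▸ hi
    · rw [if_neg h3] at h2
      exact H.next X' h1 h2
  · refine H.np_cell.imp_right fun h3 => ?_
    split_ifs
    · omega
    · exact h3
  · intro X'
    have := H.G_le X'
    split_ifs with h3
    · subst h3; omega
    · exact this
  · intro X'
    split_ifs
    · exact hy
    · exact H.next_le X'
  · exact H.far_le

/-- Levels `c` and `c + 2` share a parity; they stay apart because the former lies in columns up to
`p` and the latter is only recorded beyond `p`. -/
theorem record_far (H : Heap N P T R F G c pp p q par t Y D A B k np nq nqn) {i X y : ℕ}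
    (hi : Node N P T R A B k (c + 2) i X y) (hpar : par ≤ 1) (hX : p < X) (hy : y ≤ T t) :
    Heap N P T R F G c pp p q par t (Function.update Y (2 * X + par) y)
      (Function.update D (2 * X + par) i) A B k np nq nqn := by
  have e1 : ∀ X', 2 * X' + (1 - par) ≠ 2 * X + par := fun X' => by omega
  have e2 : ∀ X', 2 * X' + par = 2 * X + par ↔ X' = X := fun X' => by omega
  refine { H with cur := ?_, cur_node := ?_, far := ?_, next := ?_, np_cell := ?_, G_le := ?_,
                  next_le := ?_, far_le := ?_ } <;>
    simp only [Function.update_apply, e1, e2, if_false]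
  · intro X' h1 h2
    rw [if_neg (by omega)]
    exact H.cur X' h1 h2
  · intro X' h1 h2
    rw [if_neg (by omega)]
    exact H.cur_node X' h1 h2
  · intro X' h1 h2
    split_ifs with h3
    · exact h3 ▸ hi
    · rw [if_neg h3] at h2
      exact H.far X' h1 h2
  · exact H.next
  · exact H.np_cell
  · exact H.G_le
  · exact H.next_le
  · intro X'
    split_ifs
    · exact hy
    · exact H.far_le X'

end Heap

/-- All frontiers that arise from level `c` in columns before `x` are dominated by stored ones,
or by the ones that extend the largest column or row. -/
structure Found (N : ℕ) (P R F : ℕ → ℕ) (pp p q par x : ℕ) (Y : ℕ → ℕ) (np nq : ℕ) : Prop where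
  single : ∀ u, p < u → u < x → q < P u → ∀ z, pp ≤ z → z ≤ p → F z ≠ 0 →
    (∀ v, z < v → v < u → F z < P v → P u ≤ P v) →
    P u ≤ Y (2 * u + (1 - par)) ∧ u ≤ np ∧ P u ≤ nq
  double : ∀ l b, p < l → l < x → l < b → b ≤ N → P b < P l → q < P b →
    ∀ z, pp ≤ z → z ≤ p → F z ≠ 0 → (∀ v, z < v → v < l → F z < P v → P b ≤ P v) →
    P l ≤ nq ∨ ∃ X, b ≤ X ∧ X ≤ R nq ∧ P l ≤ Y (2 * X + par)

/-- Cells and maxima only grow, and the bound `R nq` on the column of a stored pair grows with `nq`.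
-/
theorem Found.mono (h : PermData N P Q T R S) {x : ℕ} (f : Found N P R F pp p q par x Y np nq)
    {Y' : ℕ → ℕ} {np' nq' : ℕ} (hY : ∀ i, Y i ≤ Y' i) (hp : np ≤ np') (hq : nq ≤ nq')
    (h1 : 1 ≤ nq) (hN : nq' ≤ N) : Found N P R F pp p q par x Y' np' nq' where
  single u g1 g2 g3 z g4 g5 g6 g7 := by
    obtain ⟨a, b, d⟩ := f.single u g1 g2 g3 z g4 g5 g6 g7
    exact ⟨a.trans (hY _), b.trans hp, d.trans hq⟩
  double l b g1 g2 g3 g4 g5 g6 z g7 g8 g9 g10 := by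
    rcases f.double l b g1 g2 g3 g4 g5 g6 z g7 g8 g9 g10 with a | ⟨X, a, d, e⟩
    · exact Or.inl (a.trans hq)
    · exact Or.inr ⟨X, a, d.trans (h.R_mono h1 hq hN), e.trans (hY _)⟩

/-- One more column of a sweep, if the pair that the sweep meets there has been stored. -/
theorem Found.succ (h : PermData N P Q T R S) {x z mu nu : ℕ}
    (f : Found N P R F pp p q par x Y np nq) (hpx : p < x) (hxN : x ≤ N)
    (hF : ∀ X, pp ≤ X → X ≤ p → F X ≤ q)
    (hw : Window N P F pp p q x z mu nu ∨ Extinct P F pp p q x mu nu)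
    (hq : 1 ≤ q) (hnq : nq ≤ N) (hnu : nu ≤ nq ∨ nu = N + 1)
    (hd : nu ≤ N → T x ≤ Y (2 * R nu + par))
    (hs : q < P x → P x < nu → P x ≤ Y (2 * x + (1 - par)) ∧ x ≤ np ∧ P x ≤ nq) :
    Found N P R F pp p q par (x + 1) Y np nq where
  single u g1 g2 g3 z' g4 g5 g6 g7 := by
    rcases Nat.lt_succ_iff_lt_or_eq.1 g2 with g2 | rfl
    · exact f.single u g1 g2 g3 z' g4 g5 g6 g7
    · exact hs g3 (h.lt_of_clear hw g4 g5 g6 (hF _ g4 g5) g3 (by omega) hxN le_rfl g7).2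
  double l b g1 g2 g3 g4 g5 g6 z' g7 g8 g9 g10 := by
    rcases Nat.lt_succ_iff_lt_or_eq.1 g2 with g2 | rfl
    · exact f.double l b g1 g2 g3 g4 g5 g6 z' g7 g8 g9 g10
    · have hb := h.P_mem b (by omega) g4
      have hl := h.P_mem l (by omega) hxN
      have hle := (Window.of_clear hw g7 g8 g9 (hF _ g7 g8) g6 hb.2 g10).2
      -- If `nu` is a value, the pair is dominated by the stored frontier `(R nu, T x)`. If `nu = N
      -- + 1`, nothing above `q` has been seen, so `x` itself was emitted as a single point; then `P
      -- l ≤ nq`, and the `right` move of the next level will absorb the pair.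
      rcases hnu with hnu | hnu
      · have hlT := h.T_ge l l (by omega) le_rfl hxN
        exact Or.inr ⟨R nu, h.R_ge b nu (by omega) g4 (by omega) hle,
          h.R_mono (by omega) hnu hnq, hlT.trans (hd (by omega))⟩
      · exact Or.inl (hs (by omega) (by omega)).2.2

end

/-! ### Commands that emit new frontiers -/

namespace RAM

open RAM.Cmd RAM.Expr

variable {B off : ℕ}

@[simp] theorem Cmd.wp_assign {x : Var} {e : Expr} {Q : St → Prop} {s : St} :
    (assign x e).wp B off Q s ↔ e.ok B off s ∧ Q (s.set x (e.eval s)) := Iff.rfl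
@[simp] theorem Cmd.wp_store {k : Arr} {i e : Expr} {Q : St → Prop} {s : St} :
    (store k i e).wp B off Q s ↔ i.ok B off s ∧ e.ok B off s ∧ off + 16 * (i.eval s + 1) ≤ B ∧
      Q (s.put k (i.eval s) (e.eval s)) := Iff.rfl
@[simp] theorem Cmd.wp_write {i e : Expr} {Q : St → Prop} {s : St} :
    (write i e).wp B off Q s ↔ i.ok B off s ∧ e.ok B off s ∧ i.eval s < off ∧
      Q (s.out (i.eval s) (e.eval s)) := Iff.rfl
@[simp] theorem Cmd.wp_seq_iff {c d : Cmd} {Q : St → Prop} {s : St} :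
    (c ;; d).wp B off Q s ↔ c.wp B off (d.wp B off Q) s := Iff.rfl
@[simp] theorem Cmd.wp_ite {a b : Expr} {c d : Cmd} {Q : St → Prop} {s : St} :
    (ite a b c d).wp B off Q s ↔ a.ok B off s ∧ b.ok B off s ∧
      (a.eval s < b.eval s → c.wp B off Q s.tick) ∧
      (¬ a.eval s < b.eval s → d.wp B off Q s.tick) := Iff.rfl

/-- A command without effect. -/
def skip : Cmd := assign .t (.var .t)

/-- The cell of column `X` for the current parity. -/
def cell (X : Expr) : Expr := .add (.mul (.lit 2) X) (.var .par)

/-- The cell of column `X` for the other parity. -/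
def cell' (X : Expr) : Expr := .add (.mul (.lit 2) X) (.sub (.lit 1) (.var .par))

/-- A new node with predecessor `i` and label `b`. -/
def newNode (i b : Expr) : Cmd :=
  store .PAR (.var .cnt) i ;; store .PT (.var .cnt) b ;; assign .cnt (.add (.var .cnt) (.lit 1))

/-- Record the latest node in the cell `t` if its row `key` improves on the present one. -/
def record : Cmd :=
  ite (.arr .Y (.var .t)) (.var .key)
    (store .Y (.var .t) (.var .key) ;; store .ND (.var .t) (.sub (.var .cnt) (.lit 1))) skip

theorem wp_record {Q : St → Prop} {s : St} (hB : off + 16 * (s.v .t + 1) ≤ B)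
    (hQ : ∀ (Y D : ℕ → ℕ) (s' : St), s'.clk ≤ s.clk + 3 → (∀ y, s'.v y = s.v y) →
      (∀ k, k ≠ .Y → k ≠ .ND → s'.a k = s.a k) → s'.a .Y = Y → s'.a .ND = D →
      (∀ i, s.a .Y i ≤ Y i) → s.v .key ≤ Y (s.v .t) →
      (s.a .Y (s.v .t) < s.v .key ∧ Y = Function.update (s.a .Y) (s.v .t) (s.v .key) ∧
        D = Function.update (s.a .ND) (s.v .t) (s.v .cnt - 1) ∨ Y = s.a .Y ∧ D = s.a .ND) →
      Q s') : record.wp B off Q s := by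
  simp only [record, skip, wp_ite, ok, eval, wp_seq_iff, wp_store, wp_assign, St.tick_v,
    St.tick_a, true_and, and_true, St.put_v, hB]
  refine ⟨fun hlt => ⟨by omega, ?_⟩, fun hge => ?_⟩
  · refine hQ _ _ _ ?_ ?_ ?_ rfl rfl ?_ ?_ (Or.inl ⟨hlt, ?_, ?_⟩)
    · simp
    · simp
    · intro k h1 h2; simp [h1, h2]
    · intro i
      simp only [St.put_a, reduceCtorEq, if_true, if_false, Function.update_apply, St.tick_a]
      split_ifs with h
      · subst h; exact hlt.le
      · exact le_rfl
    · simp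
    · simp
    · simp
  · refine hQ _ _ _ ?_ ?_ ?_ rfl rfl ?_ ?_ (Or.inr ⟨?_, ?_⟩)
    · simp
    · intro y
      simp +contextual
    · intro k h1 h2; simp
    · intro i; simp
    · simpa using hge
    · simp
    · simp

/-- The data of a level that do not change while it is processed. -/
structure LevelCtx (N : ℕ) (P Q T R S F : ℕ → ℕ) (pp p q par B off : ℕ) : Prop where
  perm : PermData N P Q T R S
  par_le : par ≤ 1
  pp_pos : 1 ≤ pp
  p_lt : p < N
  q_pos : 1 ≤ q
  q_le : q ≤ T p
  F_le : ∀ X, pp ≤ X → X ≤ p → F X ≤ q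
  room : off + 16 * (20 * N + 40) ≤ B

/-- The state contains the data of the level. -/
def Static (N : ℕ) (P Q T R S : ℕ → ℕ) (pp p q par : ℕ) (s : St) : Prop :=
  (s.a .P = P ∧ s.a .Q = Q ∧ s.a .T = T ∧ s.a .R = R ∧ s.a .S = S) ∧
    s.v .m = N ∧ s.v .pp = pp ∧ s.v .p = p ∧ s.v .q = q ∧ s.v .par = par

theorem Static.of_eq {N : ℕ} {P Q T R S : ℕ → ℕ} {pp p q par : ℕ} {s s' : St}
    (h : Static N P Q T R S pp p q par s)
    (hv : ∀ y ∈ [Var.m, .pp, .p, .q, .par], s'.v y = s.v y)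
    (ha : ∀ k ∈ [Arr.P, .Q, .T, .R, .S], s'.a k = s.a k) :
    Static N P Q T R S pp p q par s' := by
  simp only [List.mem_cons, List.not_mem_nil, or_false, forall_eq_or_imp, forall_eq] at hv ha
  simpa [Static, hv, ha] using h

/-- The invariant of the sweep of a level. -/
structure LevelInv (N : ℕ) (P Q T R S F G : ℕ → ℕ) (c pp p q par t K : ℕ) (s : St) : Prop where
  stat : Static N P Q T R S pp p q par s
  heap : Heap N P T R F G c pp p q par t (s.a .Y) (s.a .ND) (s.a .PAR) (s.a .PT) (s.v .cnt)
    (s.v .np) (s.v .nq) (s.v .nqn)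
  win : Window N P F pp p q (s.v .x) (s.v .z) (s.v .mu) (s.v .nu) ∨
    Extinct P F pp p q (s.v .x) (s.v .mu) (s.v .nu)
  z_mem : pp ≤ s.v .z ∧ s.v .z ≤ p
  found : Found N P R F pp p q par (s.v .x) (s.a .Y) (s.v .np) (s.v .nq)
  p_lt : p < s.v .x
  x_le : s.v .x ≤ N + 1
  close : s.v .x ≤ s.v .np + 1 ∨ q < S (s.v .x) ∧ S (s.v .x) < s.v .nu
  nu_le : s.v .nu ≤ s.v .nq ∨ s.v .nu = N + 1
  cnt_le : s.v .cnt ≤ K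

/-- Emit the frontier that a pair of points reaches at the present position of the sweep. -/
def emitDouble : Cmd :=
  ite (.var .nu) (.add (.var .m) (.lit 1))
    (newNode (.arr .ND (cell (.var .z))) (.arr .Q (.arr .T (.var .x))) ;;
      newNode (.sub (.var .cnt) (.lit 1)) (.arr .R (.var .nu)) ;;
      assign .t (cell (.arr .R (.var .nu))) ;;
      assign .key (.arr .T (.var .x)) ;; record) skip

variable {N : ℕ} {P Q T R S F G : ℕ → ℕ} {c pp p q par t K : ℕ}

/-- The pair is emitted before it is known whether `x` is a single point, so that `nu` still
describes the columns before `x`. Two nodes are allocated, which accounts for `K + 2`. -/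
theorem wp_emitDouble (ctx : LevelCtx N P Q T R S F pp p q par B off) {s : St}
    (I : LevelInv N P Q T R S F G c pp p q par (s.v .x - 1) K s) (hK : K ≤ 8 * N + 2) (hS : S (s.v .x) < s.v .nu)
    (hmu : s.v .mu ≤ F (s.v .z)) (hz : F (s.v .z) ≠ 0) :
    emitDouble.wp B off (fun s' => LevelInv N P Q T R S F G c pp p q par (s.v .x) (K + 2) s' ∧
      (∀ y, y ≠ .cnt → y ≠ .t → y ≠ .key → s'.v y = s.v y) ∧ s'.clk ≤ s.clk + 12 ∧
      (s.v .nu ≤ N → T (s.v .x) ≤ s'.a .Y (2 * R (s.v .nu) + par))) s := by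
  have h := ctx.perm
  have hpar := ctx.par_le
  have hroom := ctx.room
  -- `S (N + 1) = N + 1` is an upper bound for `nu`, so the strict test fails behind the last
  -- column.
  have hxN : s.v .x ≤ N := by
    by_contra hx
    have h1 : s.v .x = N + 1 := by have := I.x_le; omega
    have h2 := h.S_end
    rw [h1, h2] at hS
    have := I.nu_le
    have := I.heap.nq_le
    omega
  have hx := I.p_lt
  have hpp := ctx.pp_pos
  have hp := ctx.p_lt
  obtain ⟨hz1, hz2⟩ := I.z_mem
  -- Extinction sets `nu` to zero, which the test `S x < nu` excludes.
  have w : Window N P F pp p q (s.v .x) (s.v .z) (s.v .mu) (s.v .nu) := by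
    refine I.win.resolve_right fun e => ?_
    have := e.1
    omega
  have hT := h.T_at (s.v .x) (by omega) hxN
  have hTm : T (s.v .x - 1) ≤ T (s.v .x) := h.T_mono (by omega) (by omega) hxN
  have hcnt := I.cnt_le
  obtain ⟨⟨aP, aQ, aT, aR, aS⟩, vm, vpp, vp, vq, vpar⟩ := I.stat
  simp only [emitDouble, newNode, cell, skip, wp_ite, ok, eval, wp_seq_iff, wp_store, wp_assign,
    St.tick_v, St.tick_a, St.put_v, St.put_a, St.set_v, St.set_a, reduceCtorEq, ↓reduceIte,
    true_and, and_true, vm, vpar, aQ, aT, aR]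
  refine ⟨by omega, fun hlt => ?_, fun hge => ?_⟩
  · have hR := h.R_at (s.v .nu) (by omega) (by omega)
    have hxR := h.le_R_of_S_lt (by omega) hxN (by omega) hS
    repeat refine ⟨by omega, ?_⟩
    refine wp_record (by simp; omega) fun Y D s' hclk hv ha hY hD hYm hkey hor => ?_
    simp only [St.tick_v, St.tick_a, St.put_v, St.put_a, St.set_v, St.set_a, reduceCtorEq,
      ↓reduceIte] at hv ha hY hD hYm hkey hor
    have hvy : ∀ y, y ≠ .cnt → y ≠ .t → y ≠ .key → s'.v y = s.v y := fun y h1 h2 h3 => by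
      simp [hv, h1, h2, h3]
    have hcnt' : s'.v .cnt = s.v .cnt + 2 := by simp [hv]
    have hA := ha .PAR (by simp) (by simp)
    have hB := ha .PT (by simp) (by simp)
    simp only [reduceCtorEq, ↓reduceIte, Nat.add_sub_cancel] at hA hB
    have hnode := (I.heap.cur_node _ hz1 hz2 hz).new_two fun L hL =>
      h.sound_window_double w hmu hL (by omega) hxN (by omega) hS
    have H2 := ((I.heap.push (s.a .ND (2 * s.v .z + par)) (Q (T (s.v .x)))).push (s.v .cnt)
      (R (s.v .nu))).mono_t hTm
    refine ⟨⟨?_, ?_, ?_, ?_, ?_, ?_, ?_, ?_, ?_, ?_⟩, hvy, ?_, fun _ => ?_⟩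
    · exact I.stat.of_eq (by simp [hvy]) (by simp [ha])
    · rw [hY, hD, hA, hB, hcnt']
      simp only [hvy, ne_eq, reduceCtorEq, not_false_eq_true]
      rcases hor with ⟨h1, rfl, rfl⟩ | ⟨rfl, rfl⟩
      · exact H2.record_far hnode hpar (by omega) le_rfl
      · exact H2
    · simpa [hvy] using I.win
    · simpa [hvy] using I.z_mem
    · simp only [hvy, ne_eq, reduceCtorEq, not_false_eq_true, hY]
      exact I.found.mono h hYm le_rfl le_rfl (by have := I.heap.T_le; have := ctx.q_le; have := ctx.q_pos; omega)
        I.heap.nq_le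
    · simpa [hvy] using hx
    · simpa [hvy] using I.x_le
    · simpa [hvy] using I.close
    · simpa [hvy] using I.nu_le
    · omega
    · simpa using hclk
    · rw [hY]; exact hkey
  · refine ⟨⟨?_, ?_, ?_, ?_, ?_, ?_, ?_, ?_, ?_, ?_⟩, ?_, ?_, fun _ => ?_⟩
    · exact I.stat.of_eq (by simp) (by simp)
    · simpa using I.heap.mono_t hTm
    · simpa using I.win
    · simpa using I.z_mem
    · simpa using I.found
    · simpa using hx
    · simpa using I.x_le
    · simpa using I.close
    · simpa using I.nu_le
    · simp; omega
    · intro y h1 h2 h3; simp [h2]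
    · simp
    · omega

/-- Emit the frontier that the point at the present position of the sweep reaches, and go on. -/
def emitSingle : Cmd :=
  newNode (.arr .ND (cell (.var .z))) (.var .x) ;;
  assign .t (cell' (.var .x)) ;; assign .key (.var .y) ;; record ;;
  assign .nu (.var .y) ;;
  ite (.var .np) (.var .x) (assign .np (.var .x)) skip ;;
  ite (.var .nq) (.var .y) (assign .nq (.var .y) ;; assign .nqn (.sub (.var .cnt) (.lit 1))) skip ;;
  assign .x (.add (.var .x) (.lit 1))

/-- The new point becomes the smallest value above `q` in the window, so `nu` drops to `P x`. The
hypothesis `hd`, left by the preceding pair emission, is what `Found.succ` needs for pairs whose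
left point is `x`. -/
theorem wp_emitSingle (ctx : LevelCtx N P Q T R S F pp p q par B off) {s : St}
    (I : LevelInv N P Q T R S F G c pp p q par (s.v .x) K s) (hK : K ≤ 8 * N + 4)
    (hS : S (s.v .x) < s.v .nu) (hxN : s.v .x ≤ N)
    (hmu : s.v .mu ≤ F (s.v .z)) (hz : F (s.v .z) ≠ 0)
    (hd : s.v .nu ≤ N → T (s.v .x) ≤ s.a .Y (2 * R (s.v .nu) + par))
    (hy : s.v .y = P (s.v .x)) (hqy : q < P (s.v .x)) (hyn : P (s.v .x) < s.v .nu) :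
    emitSingle.wp B off (fun s' => LevelInv N P Q T R S F G c pp p q par (s'.v .x - 1) (K + 1) s' ∧
      s'.v .x = s.v .x + 1 ∧ s'.v .z = s.v .z ∧ s'.v .mu = s.v .mu ∧
      s'.clk ≤ s.clk + 20) s := by
  have h := ctx.perm
  have hpar := ctx.par_le
  have hroom := ctx.room
  have hx := I.p_lt
  have hpp := ctx.pp_pos
  have hp := ctx.p_lt
  obtain ⟨hz1, hz2⟩ := I.z_mem
  have w : Window N P F pp p q (s.v .x) (s.v .z) (s.v .mu) (s.v .nu) := by
    refine I.win.resolve_right fun e => ?_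
    have := e.1
    omega
  have hcnt := I.cnt_le
  have hPx := h.P_mem (s.v .x) (by omega) hxN
  have hnp := I.heap.np_le
  have hnq := I.heap.nq_le
  obtain ⟨⟨aP, aQ, aT, aR, aS⟩, vm, vpp, vp, vq, vpar⟩ := I.stat
  simp only [emitSingle, newNode, cell, cell', skip, wp_ite, ok, eval, wp_seq_iff, wp_store,
    wp_assign, St.tick_v, St.tick_a, St.put_v, St.put_a, St.set_v, St.set_a, reduceCtorEq,
    ↓reduceIte, true_and, and_true, vm, vpar, aQ, aT, aR]
  repeat refine ⟨by omega, ?_⟩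
  refine wp_record (by simp; omega) fun Y D s1 hclk hv ha hY hD hYm hkey hor => ?_
  simp only [St.tick_v, St.tick_a, St.put_v, St.put_a, St.set_v, St.set_a, reduceCtorEq,
    ↓reduceIte, hy] at hv ha hY hD hYm hkey hor
  have hA := ha .PAR (by simp) (by simp)
  have hB := ha .PT (by simp) (by simp)
  simp only [reduceCtorEq, ↓reduceIte, Nat.add_sub_cancel] at hA hB
  have hnode := (I.heap.cur_node _ hz1 hz2 hz).new fun L hL =>
    h.sound_window_single w hmu hL (by omega) hxN hyn
  have hvy : ∀ y, y ≠ .cnt → y ≠ .t → y ≠ .key → s1.v y = s.v y := fun y h1 h2 h3 => by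
    simp [hv, h1, h2, h3]
  have hcnt' : s1.v .cnt = s.v .cnt + 1 := by simp [hv]
  have H1 := I.heap.push (s.a .ND (2 * s.v .z + par)) (s.v .x)
  -- The row bound is raised first: recording a cell requires its row to be at most `nq`.
  have H2 : ∃ nqn', (s.v .nq < P (s.v .x) → nqn' = s.v .cnt) ∧
      (¬ s.v .nq < P (s.v .x) → nqn' = s.v .nqn) ∧
      Heap N P T R F G c pp p q par (s.v .x) (s.a .Y) (s.a .ND) (s1.a .PAR) (s1.a .PT)
        (s1.v .cnt) (s.v .np) (max (s.v .nq) (P (s.v .x))) nqn' := by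
    rw [hA, hB, hcnt']
    by_cases e : s.v .nq < P (s.v .x)
    · refine ⟨s.v .cnt, fun _ => rfl, fun e' => absurd e e', ?_⟩
      rw [max_eq_right e.le]
      exact H1.raise_q hnode e.le hPx.2 (h.T_ge _ _ (by omega) le_rfl hxN)
    · refine ⟨s.v .nqn, fun e' => absurd e' e, fun _ => rfl, ?_⟩
      rw [max_eq_left (not_lt.1 e)]
      exact H1
  obtain ⟨nqn', hn1, hn2, H2⟩ := H2
  have H3 : Heap N P T R F G c pp p q par (s.v .x) Y D (s1.a .PAR) (s1.a .PT)
      (s1.v .cnt) (s.v .np) (max (s.v .nq) (P (s.v .x))) nqn' := by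
    rcases hor with ⟨h1, rfl, rfl⟩ | ⟨rfl, rfl⟩
    · refine H2.record_next ?_ hpar (le_max_right _ _) h1
      rw [hA, hB, hcnt', Nat.add_sub_cancel]
      exact hnode
    · exact H2
  have H4 : Heap N P T R F G c pp p q par (s.v .x) Y D (s1.a .PAR) (s1.a .PT)
      (s1.v .cnt) (max (s.v .np) (s.v .x)) (max (s.v .nq) (P (s.v .x))) nqn' := by
    rcases le_total (s.v .x) (s.v .np) with e | e
    · rw [max_eq_left e]; exact H3
    · rw [max_eq_right e]; exact H3.raise_p e hxN (by omega)
  have hf : Found N P R F pp p q par (s.v .x + 1) Y (max (s.v .np) (s.v .x))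
      (max (s.v .nq) (P (s.v .x))) := by
    have hnl := I.nu_le
    have hq1 := ctx.q_pos
    have hTp := I.heap.T_le
    have hqT := ctx.q_le
    refine Found.succ h (I.found.mono h hYm (le_max_left _ _) (le_max_left _ _) (by omega)
      (by omega)) hx hxN ctx.F_le I.win hq1 (by omega) (by omega)
      (fun e => (hd e).trans (hYm _)) fun _ _ => ⟨hkey, le_max_right _ _, le_max_right _ _⟩
  have wn := w.right_high hx hqy
  rw [min_eq_right hyn.le] at wn
  have fin : ∀ s' : St, Static N P Q T R S pp p q par s' → s'.a .Y = Y → s'.a .ND = D →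
      s'.a .PAR = s1.a .PAR → s'.a .PT = s1.a .PT → s'.v .cnt = s1.v .cnt →
      s'.v .np = max (s.v .np) (s.v .x) → s'.v .nq = max (s.v .nq) (P (s.v .x)) →
      s'.v .nqn = nqn' → s'.v .x = s.v .x + 1 → s'.v .z = s.v .z → s'.v .mu = s.v .mu →
      s'.v .nu = P (s.v .x) →
      LevelInv N P Q T R S F G c pp p q par (s.v .x + 1 - 1) (K + 1) s' := by
    intro s' e0 e1 e2 e3 e4 e5 e6 e7 e8 e9 e10 e11 e12
    refine ⟨e0, ?_, ?_, ?_, ?_, ?_, ?_, ?_, ?_, ?_⟩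
    · rw [e1, e2, e3, e4, e5, e6, e7, e8, Nat.add_sub_cancel]; exact H4
    · rw [e9, e10, e11, e12]; exact Or.inl wn
    · rw [e10]; exact ⟨hz1, hz2⟩
    · rw [e1, e6, e7, e9]; exact hf
    · omega
    · omega
    · left; omega
    · left; omega
    · omega
  have hst : Static N P Q T R S pp p q par s1 := I.stat.of_eq (by simp [hvy]) (by simp [ha])
  simp only [St.tick_clk, St.put_clk, St.set_clk] at hclk
  simp only [wp_ite, ok, eval, wp_seq_iff, wp_store,
    wp_assign, St.tick_v, St.tick_a, St.put_v, St.put_a, St.set_v, St.set_a, reduceCtorEq,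
    ↓reduceIte, true_and, and_true, hvy, ne_eq, not_false_eq_true, hcnt', hy]
  refine ⟨fun e1 => ⟨fun e2 => ⟨by omega, by omega, ?_⟩, fun e2 => ⟨by omega, ?_⟩⟩,
    fun e1 => ⟨fun e2 => ⟨by omega, by omega, ?_⟩, fun e2 => ⟨by omega, ?_⟩⟩⟩
  all_goals
    refine ⟨fin _ ?_ ?_ ?_ ?_ ?_ ?_ ?_ ?_ ?_ ?_ ?_ ?_ ?_, ?_⟩
  all_goals first
    | (exact hst.of_eq (by simp) (by simp))
    | (simp [hY, hD, hvy]; done)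
    | (simp [hvy, hcnt', hy]; omega)

end RAM

/-! ### The sweep of one level -/

namespace RAM

open RAM.Cmd RAM.Expr

variable {B off : ℕ} {N : ℕ} {P Q T R S F G : ℕ → ℕ} {c pp p q par t K : ℕ}

/-- The part of the invariant that is independent of the window is kept by changes of the
window. -/
theorem LevelInv.change_window {s s' : St} (I : LevelInv N P Q T R S F G c pp p q par t K s)
    (ha : s'.a = s.a) (hv : ∀ y ∈ [Var.m, .pp, .p, .q, .par, .cnt, .np, .nq, .nqn], s'.v y = s.v y)
    (hw : Window N P F pp p q (s'.v .x) (s'.v .z) (s'.v .mu) (s'.v .nu) ∨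
      Extinct P F pp p q (s'.v .x) (s'.v .mu) (s'.v .nu))
    (hz : pp ≤ s'.v .z ∧ s'.v .z ≤ p)
    (hf : Found N P R F pp p q par (s'.v .x) (s.a .Y) (s.v .np) (s.v .nq))
    (hx : p < s'.v .x) (hx' : s'.v .x ≤ N + 1)
    (hc : s'.v .x ≤ s.v .np + 1 ∨ q < S (s'.v .x) ∧ S (s'.v .x) < s'.v .nu)
    (hn : s'.v .nu ≤ s.v .nq ∨ s'.v .nu = N + 1) :
    LevelInv N P Q T R S F G c pp p q par t K s' := by
  simp only [List.mem_cons, List.not_mem_nil, or_false, forall_eq_or_imp, forall_eq] at hv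
  obtain ⟨h1, h2, h3, h4, h5, h6, h7, h8, h9⟩ := hv
  refine ⟨I.stat.of_eq (by simp [*]) (by simp [ha]), ?_, hw, hz, ?_, hx, hx', ?_, ?_, ?_⟩
  · rw [ha, h6, h7, h8, h9]; exact I.heap
  · rw [ha, h7, h8]; exact hf
  · rw [h7]; exact hc
  · rw [h8]; exact hn
  · rw [h6]; exact I.cnt_le

/-- Move the frontier column of the window one step to the left, or end the sweep. -/
def retreat : Cmd :=
  ite (.var .pp) (.var .z) (assign .z (.sub (.var .z) (.lit 1)))
    (assign .nu (.lit 0) ;; assign .mu (.lit 0))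

/-- Move the frontier column of the window to the left until its frontier survives. -/
def shrink : Cmd :=
  .loop (.arr .Y (cell (.var .z))) (.var .mu)
    (assign .w (.arr .P (.var .z)) ;;
      ite (.var .q) (.var .w)
        (ite (.var .w) (.var .nu) (assign .nu (.var .w)) skip)
        (ite (.var .mu) (.var .w) (assign .mu (.var .w)) skip) ;;
      retreat)

/-- A column without a frontier has row 0 and is skipped, because `mu` is positive. The potential `z
+ min mu 1` drops in each round: either `z` retreats, or at `pp` the sweep becomes extinct and `mu`
becomes 0, which also ends this loop. -/
theorem wp_shrink (ctx : LevelCtx N P Q T R S F pp p q par B off) {s : St}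
    (I : LevelInv N P Q T R S F G c pp p q par t K s) (hx : s.v .x ≤ s.v .np + 1)
    (hmu : s.v .mu ≠ 0) :
    shrink.wp B off (fun s' => LevelInv N P Q T R S F G c pp p q par t K s' ∧
      s'.v .x = s.v .x ∧ s'.v .mu ≤ F (s'.v .z) ∧ (s'.v .nu ≠ 0 → F (s'.v .z) ≠ 0) ∧
      s'.clk + 8 * s'.v .z ≤ s.clk + 8 * s.v .z + 9) s := by
  have h := ctx.perm
  have hpar := ctx.par_le
  have hroom := ctx.room
  have hpp := ctx.pp_pos
  have hpN := ctx.p_lt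
  refine wp_while (fun s' => LevelInv N P Q T R S F G c pp p q par t K s' ∧
    s'.v .x = s.v .x ∧ s'.v .np = s.v .np ∧ (s'.v .nu ≠ 0 → s'.v .mu ≠ 0) ∧
      s'.clk + 8 * (s'.v .z + min (s'.v .mu) 1) ≤ s.clk + 8 * s.v .z + 8)
    (fun s' => s'.v .z + min (s'.v .mu) 1) ⟨I, rfl, rfl, fun _ => hmu, by omega⟩ ?_
  rintro s1 ⟨I1, hx1, hnp1, hm1, hclk⟩
  obtain ⟨hz1, hz2⟩ := I1.z_mem
  have hcur := I1.heap.cur _ hz1 hz2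
  have hxp := I1.p_lt
  have hxN := I1.x_le
  obtain ⟨⟨aP, aQ, aT, aR, aS⟩, vm, vpp, vp, vq, vpar⟩ := I1.stat
  simp only [cell, skip, wp_ite, ok, eval, wp_seq_iff, wp_store, wp_assign, St.tick_v, St.tick_a,
    St.put_v, St.put_a, St.set_v, St.set_a, reduceCtorEq, ↓reduceIte, true_and, and_true, vpar,
    aP, vpp, vq, hcur]
  refine ⟨by omega, fun hlt => ?_, fun hge => ?_⟩
  · refine ⟨by omega, ?_⟩
    have w : Window N P F pp p q (s1.v .x) (s1.v .z) (s1.v .mu) (s1.v .nu) := by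
      refine I1.win.resolve_right fun e => ?_
      have := e.2.1
      omega
    have hTp := I1.heap.T_le
    have hPT := h.T_ge (s1.v .z) p (by omega) hz2 hpN.le
    have hP := h.P_mem (s1.v .z) (by omega) (by omega)
    have hnu := I1.nu_le
    have step : ∀ mu' nu', mu' ≠ 0 → (nu' ≤ s1.v .nq ∨ nu' = N + 1) →
        (pp < s1.v .z → Window N P F pp p q (s1.v .x) (s1.v .z - 1) mu' nu') →
        ∀ s2 : St, s2.a = s1.a → (∀ y, y ≠ .w → y ≠ .mu → y ≠ .nu → s2.v y = s1.v y) →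
        s2.v .mu = mu' → s2.v .nu = nu' → s2.clk ≤ s1.clk + 5 →
        retreat.wp B off (fun s' =>
          (LevelInv N P Q T R S F G c pp p q par t K s' ∧ s'.v .x = s.v .x ∧
            s'.v .np = s.v .np ∧ (s'.v .nu ≠ 0 → s'.v .mu ≠ 0) ∧
            s'.clk + 8 * (s'.v .z + min (s'.v .mu) 1) ≤ s.clk + 8 * s.v .z + 8) ∧
            s'.v .z + min (s'.v .mu) 1 < s1.v .z + min (s1.v .mu) 1) s2 := by
      intro mu' nu' hmu' hnu' hw s2 ha hv hmu2 hnu2 hclk2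
      simp only [retreat, wp_ite, ok, eval, wp_seq_iff, wp_assign, true_and, St.tick_v, St.tick_a,
        St.set_v, St.set_a, reduceCtorEq, ↓reduceIte, hv, ne_eq, not_false_eq_true, vpp, hmu2,
        hnu2, St.set_clk, St.tick_clk]
      refine ⟨fun hl => ⟨by omega, ⟨?_, hx1, hnp1, fun _ => hmu', by omega⟩, by omega⟩,
        fun hl => ⟨by omega, by omega, ⟨?_, hx1, hnp1, fun e => absurd trivial e, by omega⟩, by omega⟩⟩
      · refine I1.change_window (by simp [ha]) (by simp [hv]) ?_ ?_ ?_ ?_ ?_ ?_ ?_ <;>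
          simp only [St.set_v, St.tick_v, reduceCtorEq, ↓reduceIte, hv, ne_eq, not_false_eq_true,
            hmu2, hnu2]
        · exact Or.inl (hw hl)
        · omega
        · exact I1.found
        · exact hxp
        · exact hxN
        · left; omega
        · exact hnu'
      · refine I1.change_window (by simp [ha]) (by simp [hv]) ?_ ?_ ?_ ?_ ?_ ?_ ?_ <;>
          simp only [St.set_v, St.tick_v, reduceCtorEq, ↓reduceIte, hv, ne_eq, not_false_eq_true,
            hmu2, hnu2]
        · exact Or.inr (w.extinct hlt (by omega))
        · omega
        · exact I1.found
        · exact hxp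
        · exact hxN
        · left; omega
        · left; omega
    refine ⟨fun hq => ⟨fun hn => ?_, fun hn => ?_⟩, fun hq => ⟨fun hm => ?_, fun hm => ?_⟩⟩
    · refine step (s1.v .mu) (P (s1.v .z)) (by omega) (by omega) (fun hl => ?_) _ rfl ?_ ?_ ?_ ?_
      · have := w.left_high hxp hlt hl hq
        rwa [min_eq_right hn.le] at this
      · intro y h1 h2 h3; simp [h1, h2, h3]
      all_goals simp
    · refine step (s1.v .mu) (s1.v .nu) (by omega) (by omega) (fun hl => ?_) _ rfl ?_ ?_ ?_ ?_
      · have := w.left_high hxp hlt hl hq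
        rwa [min_eq_left (by omega)] at this
      · intro y h1 h2 h3; simp [h1, h2, h3]; rintro rfl; rfl
      all_goals simp
    · refine step (P (s1.v .z)) (s1.v .nu) (by omega) (by omega) (fun hl => ?_) _ rfl ?_ ?_ ?_ ?_
      · have := w.left_low hxp hlt hl (by omega)
        rwa [max_eq_right hm.le] at this
      · intro y h1 h2 h3; simp [h1, h2, h3]
      all_goals simp
    · refine step (s1.v .mu) (s1.v .nu) (by omega) (by omega) (fun hl => ?_) _ rfl ?_ ?_ ?_ ?_
      · have := w.left_low hxp hlt hl (by omega)
        rwa [max_eq_left (by omega)] at this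
      · intro y h1 h2 h3; simp [h1, h2, h3]; rintro rfl; rfl
      all_goals simp
  · refine ⟨I1.change_window rfl (by simp) I1.win I1.z_mem I1.found hxp hxN I1.close I1.nu_le,
      hx1, by omega, fun e => ?_, ?_⟩
    · have := hm1 e
      omega
    · simp only [St.tick_clk]
      omega

/-- The sweep of a level. -/
def sweep : Cmd :=
  .loop (.arr .S (.var .x)) (.var .nu)
    (emitDouble ;; assign .y (.arr .P (.var .x)) ;;
      ite (.var .q) (.var .y)
        (ite (.var .y) (.var .nu) emitSingle (assign .x (.add (.var .x) (.lit 1))))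
        (ite (.var .mu) (.var .y) (assign .mu (.var .y)) skip ;;
          assign .x (.add (.var .x) (.lit 1)) ;; shrink))

/-- The invariant of the sweep between two columns. -/
structure SweepInv (N : ℕ) (P Q T R S F G : ℕ → ℕ) (c pp p q par : ℕ) (s : St) : Prop where
  inv : LevelInv N P Q T R S F G c pp p q par (s.v .x - 1) (5 * p + 2 + 3 * (s.v .x - 1 - p)) s
  mu_le : s.v .mu ≤ F (s.v .z)
  ne_zero : s.v .nu ≠ 0 → F (s.v .z) ≠ 0

theorem LevelInv.weaken {t' K' : ℕ} {s : St} (I : LevelInv N P Q T R S F G c pp p q par t K s)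
    (ht : T t ≤ T t') (hK : K ≤ K') : LevelInv N P Q T R S F G c pp p q par t' K' s :=
  { I with heap := I.heap.mono_t ht, cnt_le := I.cnt_le.trans hK }

/-- Every round advances `x` and costs at most 50 apart from retreats; every retreat costs 8 and is
paid for by the decrease of `z` from `p` towards `pp`. -/
theorem wp_sweep (ctx : LevelCtx N P Q T R S F pp p q par B off) {s : St}
    (I : SweepInv N P Q T R S F G c pp p q par s) (hx : s.v .x = p + 1) (hz : s.v .z = p) :
    sweep.wp B off (fun s' => SweepInv N P Q T R S F G c pp p q par s' ∧ s'.v .nu ≤ S (s'.v .x) ∧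
      s'.clk + 8 * pp ≤ s.clk + 50 * (s'.v .x - 1 - p) + 8 * p + 1) s := by
  have h := ctx.perm
  have hpar := ctx.par_le
  have hroom := ctx.room
  have hpp := ctx.pp_pos
  have hpN := ctx.p_lt
  refine wp_while (fun s' => SweepInv N P Q T R S F G c pp p q par s' ∧
    s'.clk + 8 * s'.v .z ≤ s.clk + 50 * (s'.v .x - 1 - p) + 8 * p) (fun s' => N + 1 - s'.v .x)
    ⟨I, by omega⟩ ?_
  rintro s1 ⟨I1, hclk1⟩
  have hS := I1.inv.stat.1.2.2.2.2
  have hxN := I1.inv.x_le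
  have hzp := I1.inv.z_mem
  have hxp := I1.inv.p_lt
  refine ⟨?_, trivial, fun hlt => ?_, fun hge => ?_⟩
  · simp only [ok, eval]; exact ⟨trivial, by omega⟩
  · simp only [eval, hS] at hlt
    have hxN' : s1.v .x ≤ N := by
      by_contra hx
      have h1 : s1.v .x = N + 1 := by omega
      have h2 := h.S_end
      rw [h1, h2] at hlt
      have := I1.inv.nu_le
      have := I1.inv.heap.nq_le
      omega
    have I1' : LevelInv N P Q T R S F G c pp p q par (s1.tick.v .x - 1)
        (5 * p + 2 + 3 * (s1.v .x - 1 - p)) s1.tick := by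
      have I := I1.inv
      exact ⟨I.stat, I.heap, I.win, I.z_mem, I.found, I.p_lt, I.x_le, I.close, I.nu_le, I.cnt_le⟩
    have hnz := I1.ne_zero (by omega)
    refine wp_seq (wp_emitDouble ctx I1' (by omega) hlt I1.mu_le hnz) ?_
    rintro s2 ⟨I2, hv, hclk2, hd⟩
    simp only [St.tick_v, St.tick_clk] at hv hclk2 hd
    have vx := hv .x (by simp) (by simp) (by simp)
    have vz := hv .z (by simp) (by simp) (by simp)
    have vmu := hv .mu (by simp) (by simp) (by simp)
    have vnu := hv .nu (by simp) (by simp) (by simp)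
    simp only [St.tick_v, ← vx] at I2
    rw [← vx, ← vnu] at hlt
    have hd : s2.v .nu ≤ N → T (s2.v .x) ≤ s2.a .Y (2 * R (s2.v .nu) + par) := by
      rw [vx, vnu]; exact hd
    have hmu : s2.v .mu ≤ F (s2.v .z) := by rw [vmu, vz]; exact I1.mu_le
    have hnz2 : F (s2.v .z) ≠ 0 := by rw [vz]; exact hnz
    have hK : s2.v .x - 1 - p = s1.v .x - 1 - p := by rw [vx]
    have hx2 : p < s2.v .x := I2.p_lt
    have hxN2 : s2.v .x ≤ N := by omega
    have hPx := h.P_mem (s2.v .x) (by omega) hxN2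
    have w : Window N P F pp p q (s2.v .x) (s2.v .z) (s2.v .mu) (s2.v .nu) := by
      refine I2.win.resolve_right fun e => ?_
      have := e.1
      omega
    have hT1 := I2.heap.T_le
    have hnq := I2.heap.nq_le
    have hqT := ctx.q_le
    have hq1 := ctx.q_pos
    have hnl := I2.nu_le
    have hnp := I2.heap.np_le
    have succ := fun hs => Found.succ h I2.found hx2 hxN2 ctx.F_le I2.win hq1 hnq (by omega) hd hs
    obtain ⟨⟨aP, aQ, aT, aR, aS⟩, vm, vpp, vp, vq, vpar⟩ := id I2.stat
    -- The case of a value up to `q`: the point enters `mu` and may block the current frontier. Its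
    -- column is at most `R q`, hence at most `np`, which keeps the sweep within the range of the
    -- next level.
    have kill : ∀ s3 : St, P (s2.v .x) ≤ q → s3.a = s2.a →
        (∀ y, y ≠ .mu → y ≠ .x → s3.v y = (s2.set .y (P (s2.v .x))).v y) →
        s3.v .mu = max (s2.v .mu) (P (s2.v .x)) → s3.v .x = s2.v .x + 1 → s3.clk ≤ s2.clk + 5 →
        shrink.wp B off (fun s' => (SweepInv N P Q T R S F G c pp p q par s' ∧
          s'.clk + 8 * s'.v .z ≤ s.clk + 50 * (s'.v .x - 1 - p) + 8 * p) ∧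
          N + 1 - s'.v .x < N + 1 - s1.v .x) s3 := by
      intro s3 hPq ha3 hv3 mu3 x3 c3
      have hv3' : ∀ y, y ≠ .mu → y ≠ .x → y ≠ .y → s3.v y = s2.v y := fun y h1 h2 h3 => by
        simp [hv3, h1, h2, h3]
      have hxR := h.R_ge (s2.v .x) q (by omega) hxN2 (by omega) hPq
      have hR := I2.heap.R_le
      have np3 := hv3' .np (by simp) (by simp) (by simp)
      have I3 : LevelInv N P Q T R S F G c pp p q par (s2.v .x)
          (5 * p + 2 + 3 * (s2.v .x - 1 - p) + 2) s3 := by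
        refine I2.change_window ha3 (by simp [hv3']) ?_ (by simpa [hv3'] using I2.z_mem) ?_ ?_ ?_ ?_
          (by simpa [hv3'] using I2.nu_le)
        · rw [x3, mu3, hv3' .z (by simp) (by simp) (by simp), hv3' .nu (by simp) (by simp) (by simp)]
          exact Or.inl (w.right_low hx2 hPq)
        · rw [x3]
          exact succ fun e => absurd hPq (by omega)
        · omega
        · omega
        · left; omega
      refine wp_mono ?_ (wp_shrink ctx I3 (by omega) (by omega))
      rintro s4 ⟨I4, x4, mu4, nu4, c4⟩
      rw [hv3' .z (by simp) (by simp) (by simp)] at c4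
      refine ⟨⟨⟨I4.weaken ?_ ?_, mu4, nu4⟩, ?_⟩, ?_⟩
      · rw [x4, x3, Nat.add_sub_cancel]
      · omega
      · omega
      · omega
    simp only [skip, wp_ite, ok, eval, wp_seq_iff, wp_assign, St.tick_v, St.tick_a, St.set_v,
      St.set_a, reduceCtorEq, ↓reduceIte, true_and, and_true, aP, vq]
    refine ⟨by omega, fun hq => ⟨fun hn => ?_, fun hn => ⟨by omega, ?_, ?_⟩⟩,
      fun hq => ⟨fun hm => ⟨by omega, ?_⟩, fun hm => ⟨by omega, ?_⟩⟩⟩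
    · have I3 : LevelInv N P Q T R S F G c pp p q par (s2.v .x)
          (5 * p + 2 + 3 * (s2.v .x - 1 - p) + 2)
          (s2.set .y (P (s2.v .x))).tick.tick :=
        I2.change_window rfl (by simp) (by simpa using I2.win) (by simpa using I2.z_mem)
          (by simpa using I2.found) (by simpa using hx2) (by simpa using I2.x_le)
          (by simpa using I2.close) (by simpa using I2.nu_le)
      refine wp_mono ?_ (wp_emitSingle ctx (K := 5 * p + 2 + 3 * (s2.v .x - 1 - p) + 2)
        (by simpa using I3) (by omega) (by simpa using hlt) (by simpa using hxN2)
        (by simpa using hmu) (by simpa using hnz2) (by simpa using hd) (by simp) (by simpa using hq)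
        (by simpa using hn))
      rintro s3 ⟨I4, x4, z4, mu4, c4⟩
      simp only [St.tick_v, St.set_v, reduceCtorEq, ↓reduceIte, St.tick_clk, St.set_clk]
        at x4 z4 mu4 c4
      refine ⟨⟨⟨I4.weaken le_rfl (by omega), ?_, fun _ => ?_⟩, ?_⟩, ?_⟩
      · rw [mu4, z4]; exact hmu
      · rw [z4]; exact hnz2
      · omega
      · omega
    · refine ⟨⟨?_, ?_, fun _ => ?_⟩, ?_⟩
      · refine LevelInv.weaken (t := s2.v .x) (K := 5 * p + 2 + 3 * (s2.v .x - 1 - p) + 2) ?_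
          (by simp) (by simp; omega)
        refine I2.change_window rfl (by simp) ?_ (by simpa using I2.z_mem) ?_ ?_ ?_ ?_
          (by simpa using I2.nu_le) <;>
          simp only [St.tick_v, St.set_v, reduceCtorEq, ↓reduceIte]
        · have := w.right_high hx2 hq
          rw [min_eq_left (by omega)] at this
          exact Or.inl this
        · exact succ fun _ e => absurd e hn
        · omega
        · omega
        -- This column yields nothing, but by the loop test some later `v` has value below `nu`. If
        -- that value is at most `q`, then `v ≤ R q ≤ np`; otherwise the minimum after `x` still
        -- lies between `q` and `nu`, so the loop cannot end here.
        · obtain ⟨v, h1, h2, h3⟩ := h.S_at (s2.v .x) (by omega) hxN2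
          rcases Nat.eq_or_lt_of_le h1 with e | e
          · rw [← e] at h3; omega
          · by_cases h4 : P v ≤ q
            · left
              have := h.R_ge v q (by omega) h2 (by omega) h4
              have := I2.heap.R_le
              omega
            · right
              have := h.S_le (s2.v .x + 1) v (by omega) e h2
              by_cases h6 : s2.v .x + 1 ≤ N
              · obtain ⟨v', g1, g2, g3⟩ := h.S_at (s2.v .x + 1) (by omega) h6
                have := h.S_le (s2.v .x) v' (by omega) (by omega) g2
                omega
              · omega
      · simpa using hmu
      · simpa using hnz2
      · simp; omega
    · simp; omega
    · refine kill _ (by omega) rfl ?_ ?_ ?_ ?_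
      · intro y h1 h2; simp [h1, h2]
      · simp [max_eq_right hm.le]
      · simp
      · simp
    · refine kill _ (by omega) rfl ?_ ?_ ?_ ?_
      · intro y h1 h2; simp [h1, h2]; rintro rfl; rfl
      · simp [max_eq_left (not_lt.1 hm)]
      · simp
      · simp
  · simp only [eval, hS, not_lt] at hge
    refine ⟨⟨?_, I1.mu_le, I1.ne_zero⟩, hge, ?_⟩
    · have I := I1.inv
      exact ⟨I.stat, I.heap, I.win, I.z_mem, I.found, I.p_lt, I.x_le, I.close, I.nu_le, I.cnt_le⟩
    · simp only [St.tick_v, St.tick_clk]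
      omega

end RAM

/-! ### Opening a level, and the invariant from one level to the next -/

namespace RAM

open RAM.Cmd RAM.Expr

variable {B off : ℕ} {N : ℕ} {P Q T R S F G : ℕ → ℕ} {c pp p q par t K : ℕ}

/-- The pair `(l, b)` may follow the frontier `(X, Y)`. -/
def Follows (N : ℕ) (P : ℕ → ℕ) (X Y l b : ℕ) : Prop :=
  1 < l ∧ l < b ∧ b ≤ N ∧ P b < P l ∧ ∀ v, X < v → v < l → Y < P v → P b ≤ P v

/-- The invariant between two levels: the stored frontiers dominate all those of level `c`, and
those of level `c + 1` that arise from level `c - 1`, and no frontier of a lower level reaches the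
last column. -/
structure LevelStart (N : ℕ) (P Q T R S : ℕ → ℕ) (c pp p q par : ℕ) (s : St) : Prop where
  stat : Static N P Q T R S pp p q par s
  par_le : par ≤ 1
  pp_pos : 1 ≤ pp
  pp_le : pp ≤ p
  p_le : p ≤ N
  q_pos : 1 ≤ q
  q_le : q ≤ T p
  F_p : s.a .Y (2 * p + par) ≠ 0
  F_le : ∀ X, s.a .Y (2 * X + par) ≤ q
  G_le : ∀ X, s.a .Y (2 * X + (1 - par)) ≤ T p
  cur : ∀ X, pp ≤ X → s.a .Y (2 * X + par) ≠ 0 → Node N P T R (s.a .PAR) (s.a .PT) (s.v .cnt) c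
    (s.a .ND (2 * X + par)) X (s.a .Y (2 * X + par))
  next : ∀ X, p ≤ X → s.a .Y (2 * X + (1 - par)) ≠ 0 → Node N P T R (s.a .PAR) (s.a .PT)
    (s.v .cnt) (c + 1) (s.a .ND (2 * X + (1 - par))) X (s.a .Y (2 * X + (1 - par)))
  best : ∃ X, Node N P T R (s.a .PAR) (s.a .PT) (s.v .cnt) c (s.v .qn) X q
  cnt_le : s.v .cnt ≤ 5 * p
  reached : ∀ X Y, Reach N P T R c X Y →
    ∃ z, pp ≤ z ∧ z ≤ p ∧ X ≤ z ∧ Y ≤ s.a .Y (2 * z + par)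
  pending : ∀ c' X Y l b, c' + 1 = c → Reach N P T R c' X Y → Follows N P X Y l b →
    P l ≤ q ∨ b ≤ p ∨ ∃ X', b ≤ X' ∧ X' ≤ R q ∧ P l ≤ s.a .Y (2 * X' + (1 - par))
  not_last : ∀ c' < c, ∀ Y, ¬ Reach N P T R c' N Y

theorem LevelStart.ctx (h : PermData N P Q T R S) {s : St}
    (L : LevelStart N P Q T R S c pp p q par s) (hp : p < N) (hB : off + 16 * (20 * N + 40) ≤ B) :
    LevelCtx N P Q T R S (fun X => s.a .Y (2 * X + par)) pp p q par B off :=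
  ⟨h, L.par_le, L.pp_pos, hp, L.q_pos, L.q_le, fun X _ _ => L.F_le X, hB⟩

/-- The state after allocating the node of the `up` move from column `p`. The `right` move has not
been made yet, so the bound `R q ≤ np` is not available; the value 1 takes the place of `q`
meanwhile. -/
theorem LevelStart.heap (h : PermData N P Q T R S) {s : St}
    (L : LevelStart N P Q T R S c pp p q par s) (hp : p < N) :
    Heap N P T R (fun X => s.a .Y (2 * X + par)) (fun X => s.a .Y (2 * X + (1 - par))) c pp p 1 par
      p (s.a .Y) (s.a .ND)
      (Function.update (s.a .PAR) (s.v .cnt) (s.a .ND (2 * p + par)))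
      (Function.update (s.a .PT) (s.v .cnt) (Q (T p))) (s.v .cnt + 1) p (T p) (s.v .cnt) ∧
    Node N P T R (Function.update (s.a .PAR) (s.v .cnt) (s.a .ND (2 * p + par)))
      (Function.update (s.a .PT) (s.v .cnt) (Q (T p))) (s.v .cnt + 1) (c + 1) (s.v .cnt) p (T p) := by
  have hnode := (L.cur p L.pp_le L.F_p).new fun L hL => h.sound_up hL
  have hpp := L.pp_pos
  have hpp' := L.pp_le
  refine ⟨?_, hnode⟩
  constructor
  · omega
  · intro X _ _; rfl
  · intro X h1 h2 h3; exact (L.cur X h1 h3).push _ _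
  · intro X h1 h3; exact ((L.cur X (by omega) h3).mono (by omega)).push _ _
  · intro X h1 h3; exact (L.next X h1 h3).push _ _
  · exact ⟨p, hnode⟩
  · exact Or.inl rfl
  · exact le_rfl
  · exact hp.le
  -- The point of value at most 1 is the sentinel, so `R 1 = 1`.
  · have h2 := h.two_le
    have h1 := h.R_at 1 le_rfl (by omega)
    have h3 := h.P_mem (R 1) h1.1 h1.2.1
    have := h.inj h1.1 h1.2.1 le_rfl (by omega) (show P (R 1) = P 1 by rw [h.P_one]; omega)
    omega
  · exact le_rfl
  · exact (h.T_at p (by omega) hp.le).2.1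
  · exact le_rfl
  · intro X; exact le_rfl
  · exact L.G_le
  · intro X; exact (L.F_le X).trans L.q_le

/-- The frontier in column `p` is in range, so `p` is at most `R` of its row, and that row is at
most `q`. -/
theorem LevelStart.le_R (h : PermData N P Q T R S) {s : St}
    (L : LevelStart N P Q T R S c pp p q par s) : p ≤ R q := by
  obtain ⟨-, l, -, -, hs⟩ := L.cur p L.pp_le L.F_p
  have h1 := L.F_p
  have h2 := L.q_le
  have h3 := h.T_at p (L.pp_pos.trans L.pp_le) L.p_le
  exact hs.2.2.2.2.2.1.trans (h.R_mono (by omega) (L.F_le p) (by omega))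

/-- Start a level: extend the frontiers of the largest column and row, and initialize the sweep. -/
def openLevel : Cmd :=
  newNode (.arr .ND (cell (.var .p))) (.arr .Q (.arr .T (.var .p))) ;;
  assign .t (cell' (.var .p)) ;; assign .key (.arr .T (.var .p)) ;; record ;;
  assign .nq (.arr .T (.var .p)) ;; assign .nqn (.sub (.var .cnt) (.lit 1)) ;;
  newNode (.var .qn) (.arr .R (.var .q)) ;;
  assign .t (cell' (.arr .R (.var .q))) ;; assign .key (.var .q) ;; record ;;
  assign .np (.arr .R (.var .q)) ;; assign .x (.add (.var .p) (.lit 1)) ;;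
  assign .z (.var .p) ;; assign .mu (.lit 0) ;; assign .nu (.add (.var .m) (.lit 1))

/-- The function `G` freezes the rows of the next level after these two moves, as lower bounds that
the sweep only improves. It thereby preserves both the pairs pending from the level before and the
two moves themselves. -/
theorem wp_openLevel (h : PermData N P Q T R S) (hB : off + 16 * (20 * N + 40) ≤ B) {s : St}
    (L : LevelStart N P Q T R S c pp p q par s) (hp : p < N) :
    openLevel.wp B off (fun s' => ∃ G : ℕ → ℕ,
      SweepInv N P Q T R S (fun X => s.a .Y (2 * X + par)) G c pp p q par s' ∧
      (∀ X, s.a .Y (2 * X + (1 - par)) ≤ G X) ∧ q ≤ G (R q) ∧ T p ≤ G p ∧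
      s'.v .x = p + 1 ∧ s'.v .z = p ∧ s'.clk ≤ s.clk + 23) s := by
  have hpar := L.par_le
  have hpp := L.pp_pos
  have hpp' := L.pp_le
  have hT := h.T_at p (by omega) hp.le
  have hq1 := L.q_pos
  have hqT := L.q_le
  have hR := h.R_at q hq1 (by omega)
  have hQ := h.Q_mem (T p) hT.1 hT.2.1
  have hcnt := L.cnt_le
  obtain ⟨H0, n0⟩ := L.heap h hp
  have hpR : p ≤ R q := by
    obtain ⟨-, l, -, -, hs⟩ := L.cur p hpp' L.F_p
    have := L.F_p
    exact hs.2.2.2.2.2.1.trans (h.R_mono (by omega) (L.F_le p) (by omega))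
  obtain ⟨⟨aP, aQ, aT, aR, aS⟩, vm, vpp, vp, vq, vpar⟩ := L.stat
  simp only [openLevel, newNode, cell, cell', wp_ite, ok, eval, wp_seq_iff, wp_store, wp_assign,
    St.tick_v, St.tick_a, St.put_v, St.put_a, St.set_v, St.set_a, reduceCtorEq, ↓reduceIte,
    true_and, and_true, vpar, vp, aQ, aT]
  repeat refine ⟨by omega, ?_⟩
  refine wp_record (by simp; omega) fun Y1 D1 s1 hclk1 hv1 ha1 hY1 hD1 hYm1 hkey1 hor1 => ?_
  simp only [St.tick_v, St.tick_a, St.put_v, St.put_a, St.set_v, St.set_a, reduceCtorEq,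
    ↓reduceIte, Nat.add_sub_cancel, St.set_clk, St.put_clk] at hv1 ha1 hY1 hD1 hYm1 hkey1 hor1 hclk1
  have hA1 := ha1 .PAR (by simp) (by simp)
  have hB1 := ha1 .PT (by simp) (by simp)
  simp only [reduceCtorEq, ↓reduceIte] at hA1 hB1
  have hv1' : ∀ y, y ≠ .cnt → y ≠ .t → y ≠ .key → s1.v y = s.v y := fun y h1 h2 h3 => by
    simp [hv1, h1, h2, h3]
  have ha1' : ∀ k, k ≠ .PAR → k ≠ .PT → k ≠ .Y → k ≠ .ND → s1.a k = s.a k :=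
    fun k h1 h2 h3 h4 => by simp [ha1, h1, h2, h3, h4]
  have hcnt1 : s1.v .cnt = s.v .cnt + 1 := by simp [hv1]
  have H1 : Heap N P T R (fun X => s.a .Y (2 * X + par)) (fun X => s.a .Y (2 * X + (1 - par))) c pp
      p 1 par p Y1 D1 (s1.a .PAR) (s1.a .PT) (s1.v .cnt) p (T p) (s.v .cnt) := by
    rw [hA1, hB1, hcnt1]
    rcases hor1 with ⟨h1, rfl, rfl⟩ | ⟨rfl, rfl⟩
    · exact H0.record_next n0 hpar le_rfl h1
    · exact H0
  have hbest : ∃ X, Node N P T R (s1.a .PAR) (s1.a .PT) (s1.v .cnt) c (s.v .qn) X q := by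
    rw [hA1, hB1, hcnt1]
    exact L.best.imp fun X hX => hX.push _ _
  simp only [newNode, cell, cell', wp_ite, ok, eval, wp_seq_iff, wp_store, wp_assign,
    St.tick_v, St.tick_a, St.put_v, St.put_a, St.set_v, St.set_a, reduceCtorEq, ↓reduceIte,
    true_and, and_true, hv1', ha1', ne_eq, not_false_eq_true, vpar, vp, vq, vm, aQ, aT, aR, hcnt1]
  repeat refine ⟨by omega, ?_⟩
  refine wp_record (by simp [hv1']; omega) fun Y2 D2 s2 hclk2 hv2 ha2 hY2 hD2 hYm2 hkey2 hor2 => ?_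
  simp only [St.tick_v, St.tick_a, St.put_v, St.put_a, St.set_v, St.set_a, reduceCtorEq,
    ↓reduceIte, Nat.add_sub_cancel, St.set_clk, St.put_clk] at hv2 ha2 hY2 hD2 hYm2 hkey2 hor2 hclk2
  rw [hY1] at hYm2 hor2
  rw [hD1] at hor2
  have hA2 := ha2 .PAR (by simp) (by simp)
  have hB2 := ha2 .PT (by simp) (by simp)
  simp only [reduceCtorEq, ↓reduceIte] at hA2 hB2
  have hcnt2 : s2.v .cnt = s1.v .cnt + 1 := by simp [hv2, hcnt1]
  obtain ⟨X0, hX0⟩ := hbest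
  have n2 := hX0.new fun L hL => h.sound_right hL
  rw [← hcnt1] at hA2 hB2
  have H2 : Heap N P T R (fun X => s.a .Y (2 * X + par)) (fun X => Y2 (2 * X + (1 - par))) c pp
      p q par p Y2 D2 (s2.a .PAR) (s2.a .PT) (s2.v .cnt) (R q) (T p) (s.v .cnt) := by
    have H : Heap N P T R (fun X => s.a .Y (2 * X + par)) (fun X => s.a .Y (2 * X + (1 - par))) c pp
        p 1 par p Y2 D2 (s2.a .PAR) (s2.a .PT) (s2.v .cnt) p (T p) (s.v .cnt) := by
      rw [hA2, hB2, hcnt2]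
      have H := H1.push (s.v .qn) (R q)
      rcases hor2 with ⟨h1, rfl, rfl⟩ | ⟨rfl, rfl⟩
      · rw [← hcnt1]
        exact H.record_next n2 hpar hqT h1
      · exact H
    have H' := H.raise_p hpR hR.2.1 (by omega)
    exact { H' with R_le := le_rfl, G_le := fun X => le_rfl }
  have hst : Static N P Q T R S pp p q par s2 := by
    refine L.stat.of_eq ?_ ?_
    · simp [hv2, hv1]
    · simp [ha2, ha1]
  have v2 : s2.v .nq = T p ∧ s2.v .nqn = s.v .cnt := by simp [hv2]
  have v2' : s2.v .p = p ∧ s2.v .m = N ∧ s2.v .q = q := by simp [hv2, hv1, vp, vm, vq]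
  have a2 : s2.a .R = R := by simp [ha2, ha1, aR]
  simp only [wp_ite, ok, eval, wp_seq_iff, wp_store, wp_assign, St.tick_v, St.tick_a, St.put_v,
    St.put_a, St.set_v, St.set_a, reduceCtorEq, ↓reduceIte, true_and, and_true, v2', a2]
  refine ⟨by omega, by omega, by omega, by omega, ?_⟩
  refine ⟨fun X => Y2 (2 * X + (1 - par)), ⟨⟨?_, ?_, ?_, ?_, ?_, ?_, ?_, ?_, ?_, ?_⟩, ?_, ?_⟩,
    fun X => (hYm1 _).trans (hYm2 _), hkey2, hkey1.trans (hYm2 _), ?_⟩ <;>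
  try simp only [St.tick_v, St.tick_a, St.put_v, St.put_a, St.set_v, St.set_a, reduceCtorEq,
    ↓reduceIte, Nat.add_sub_cancel, St.set_clk, St.put_clk, St.tick_clk, hY2, hD2, v2]
  · exact hst.of_eq (by simp) (by simp)
  · exact H2
  · exact Or.inl (Window.init hpp' (by omega))
  · omega
  · exact ⟨fun u h1 h2 => by omega, fun l b h1 h2 => by omega⟩
  · omega
  · omega
  · left; omega
  · right; trivial
  · omega
  · omega
  · exact fun _ => L.F_p
  · omega

/-- What holds between two columns holds at the end of the sweep for the next level. -/
theorem LevelStart.next_level (h : PermData N P Q T R S) {s s' s2 : St} {np nq : ℕ}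
    (L : LevelStart N P Q T R S c pp p q par s) (hp : p < N)
    (I : SweepInv N P Q T R S (fun X => s.a .Y (2 * X + par)) G c pp p q par s')
    (hG : ∀ X, s.a .Y (2 * X + (1 - par)) ≤ G X) (hGq : q ≤ G (R q)) (hGp : T p ≤ G p)
    (hS : s'.v .nu ≤ S (s'.v .x)) (hnp : s'.v .np = np) (hnq : s'.v .nq = nq)
    (ha : s2.a = s'.a) (hcnt : s2.v .cnt = s'.v .cnt) (hqn : s2.v .qn = s'.v .nqn)
    (hst : Static N P Q T R S p np nq (1 - par) s2) :
    LevelStart N P Q T R S (c + 1) p np nq (1 - par) s2 ∧ p < np ∧ s'.v .x ≤ np + 1 := by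
  have hpar := L.par_le
  have e : 1 - (1 - par) = par := by omega
  have hpp := L.pp_pos
  have hpp' := L.pp_le
  have hq1 := L.q_pos
  have hqT := L.q_le
  have hT := h.T_at p (by omega) hp.le
  have hR := h.R_at q hq1 (by omega)
  have H := I.inv.heap
  have win := I.inv.win
  have fnd := I.inv.found
  rw [hnp, hnq] at H fnd
  have hx : s'.v .x ≤ np + 1 := by
    rcases I.inv.close with h1 | h1
    · rwa [hnp] at h1
    · omega
  have hxp := I.inv.p_lt
  have hTq := H.T_le
  have hRp := H.R_le
  have hnpN := H.np_le
  have hpR := L.le_R h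
  have hnqN := H.nq_le
  -- Progress. If the point in column `p + 1` has value at most `q`, the `right` move passes it.
  -- Otherwise it can follow the frontier in column `p`, with no column in between, so the sweep
  -- cannot have stopped before it and has emitted it.
  have hlt : p < np := by
    by_cases h1 : P (p + 1) ≤ q
    · have := h.R_ge (p + 1) q (by omega) (by omega) (by omega) h1
      omega
    · by_cases h2 : s'.v .x = p + 1
      · exact absurd (fun v _ _ _ => by omega) (h.no_single_of_le (u := p + 1) win hpp' le_rfl L.F_p
          (L.F_le p) (by omega) (by omega) (by omega) (by omega) hS)
      · have := (fnd.single (p + 1) (by omega) (by omega) (by omega) p hpp' le_rfl L.F_p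
          (fun v _ _ _ => by omega)).2.1
        omega
  have hTm : T (s'.v .x - 1) ≤ T np := h.T_mono (by omega) (by omega) hnpN
  have hcp : s'.a .Y (2 * np + (1 - par)) ≠ 0 := H.np_cell.resolve_left (by omega)
  have hRq : R q ≤ R nq := h.R_mono hq1 (by omega) hnqN
  have hnqT : nq ≤ T np := H.nq_le_T.trans hTm
  refine ⟨⟨hst, by omega, by omega, by omega, hnpN, by omega, hnqT, ?_, ?_, ?_, ?_, ?_, ?_, ?_, ?_,
    ?_, ?_⟩, hlt, hx⟩
  · rw [ha]; exact hcp
  · rw [ha]; exact H.next_le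
  · rw [ha, e]; exact fun X => (H.far_le X).trans hTm
  · rw [ha, hcnt]; exact fun X hX h1 => H.next X hX h1
  · rw [ha, hcnt, e]; exact fun X hX h1 => H.far X (by omega) h1
  · rw [ha, hcnt, hqn]; exact H.best
  · have := I.inv.cnt_le
    omega
  · rw [ha]
    -- Two regions are covered by the opening moves: what lies below `(R q, q)`, and what lies below
    -- `(p, T p)`. Only points beyond `p` with values above `q` are left to the sweep.
    have hA : ∀ X Y, X ≤ R q → Y ≤ q →
        ∃ z, p ≤ z ∧ z ≤ np ∧ X ≤ z ∧ Y ≤ s'.a .Y (2 * z + (1 - par)) := fun X Y hX hY =>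
      ⟨R q, hpR, hRp, hX, hY.trans (hGq.trans (H.G_le _))⟩
    have hB : ∀ X Y, X ≤ p → Y ≤ T p →
        ∃ z, p ≤ z ∧ z ≤ np ∧ X ≤ z ∧ Y ≤ s'.a .Y (2 * z + (1 - par)) := fun X Y hX hY =>
      ⟨p, le_rfl, hlt.le, hX, hY.trans (hGp.trans (H.G_le _))⟩
    intro X' Y' hr
    have hr' := hr
    -- A frontier of cost `c + 1` that ends in a pair comes from level `c - 1`; that case is settled
    -- by `pending`, the others by level `c`.
    rcases hr with _ | ⟨hr⟩ | ⟨hr⟩ | ⟨u, hr, hu, huN, hc⟩ | ⟨l, b, hr, hl, hlb, hbN, hbl, hc⟩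
    · obtain ⟨z, z1, z2, z3, z4⟩ := L.reached _ _ hr
      have hi := h.inner_of_reach hr
      have := L.F_le z
      exact hA _ _ (h.R_mono hi.2.2.1 (by omega) (by omega)) (by omega)
    · obtain ⟨z, z1, z2, z3, z4⟩ := L.reached _ _ hr
      have hi := h.inner_of_reach hr
      exact hB _ _ (by omega) (h.T_mono hi.1 (by omega) hp.le)
    · obtain ⟨z, z1, z2, z3, z4⟩ := L.reached _ _ hr
      have hi := h.inner_of_reach hr
      by_cases h1 : P X' ≤ q
      · exact hA _ _ (h.R_ge X' q (by omega) huN (by omega) h1) h1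
      by_cases h2 : X' ≤ p
      · exact hB _ _ h2 (h.T_ge X' p (by omega) h2 hp.le)
      have hY := hi.2.2.1
      have hFz : s.a .Y (2 * z + par) ≠ 0 := by omega
      have hc' : ∀ v, z < v → v < X' → s.a .Y (2 * z + par) < P v → P X' ≤ P v :=
        fun v g1 g2 g3 => hc v (by omega) g2 (by omega)
      by_cases h3 : X' < s'.v .x
      · obtain ⟨g1, g2, g3⟩ := fnd.single X' (by omega) h3 (by omega) z z1 z2 hFz hc'
        exact ⟨X', by omega, g2, le_rfl, g1⟩
      · exact absurd hc' (h.no_single_of_le win z1 z2 hFz (L.F_le z) (by omega) (by omega)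
          huN (by omega) hS)
    · rcases L.pending _ _ _ l _ rfl hr ⟨hl, hlb, hbN, hbl, hc⟩ with h1 | h1 | ⟨X1, h1, h2, h3⟩
      · exact hA _ _ (h.R_ge _ q (by omega) hbN (by omega) (by omega)) h1
      · exact hB _ _ h1 (h.T_ge l p (by omega) (by omega) hp.le)
      · by_cases h4 : X1 ≤ p
        · exact hB _ _ (by omega) (h.T_ge l p (by omega) (by omega) hp.le)
        · exact ⟨X1, by omega, by omega, h1, h3.trans ((hG X1).trans (H.G_le _))⟩
  · rw [ha, e]
    intro c' X Y l b hc' hr hf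
    obtain rfl : c' = c := by omega
    obtain ⟨z, z1, z2, z3, z4⟩ := L.reached X Y hr
    obtain ⟨f1, f2, f3, f4, f5⟩ := hf
    have hY := (h.inner_of_reach hr).2.2.1
    -- Pairs starting at level `c`: those with `l ≤ p` do not rise above `T p`, those with `P b ≤ q`
    -- do not pass `R q`, and the sweep has dealt with the rest.
    by_cases h1 : l ≤ p
    · left
      have := h.T_ge l p (by omega) h1 hp.le
      omega
    by_cases h2 : P b ≤ q
    · right; left
      have := h.R_ge b q (by omega) f3 (by omega) h2
      omega
    have hc : ∀ v, z < v → v < l → s.a .Y (2 * z + par) < P v → P b ≤ P v :=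
      fun v g1 g2 g3 => f5 v (by omega) g2 (by omega)
    by_cases h3 : l < s'.v .x
    · exact (fnd.double l b (by omega) h3 f2 f3 f4 (by omega) z z1 z2 (by omega) hc).imp_right
        Or.inr
    · exact absurd hc (h.no_double_of_le win z1 z2 (by omega) (L.F_le z) (by omega) (by omega) f3
        (by omega) f2 hS)
  · intro c' hc' Y hr
    rcases Nat.lt_succ_iff_lt_or_eq.1 hc' with h1 | rfl
    · exact L.not_last c' h1 Y hr
    -- Level `c` lies in columns up to `p`, and `p < N`.
    · obtain ⟨z, z1, z2, z3, z4⟩ := L.reached N Y hr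
      omega

end RAM

/-! ### The loop over the levels, and the output -/

namespace RAM

open RAM.Cmd RAM.Expr

variable {B off : ℕ} {N : ℕ} {P Q T R S : ℕ → ℕ} {c pp p q par : ℕ}

/-- Pass to the next level. -/
def closeLevel : Cmd :=
  assign .pp (.var .p) ;; assign .p (.var .np) ;; assign .q (.var .nq) ;;
  assign .qn (.var .nqn) ;; assign .par (.sub (.lit 1) (.var .par))

/-- Process all levels until the last column is reached. -/
def levels : Cmd := .loop (.var .p) (.var .m) (openLevel ;; sweep ;; closeLevel)

theorem LevelStart.tick {s : St} (L : LevelStart N P Q T R S c pp p q par s) :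
    LevelStart N P Q T R S c pp p q par s.tick :=
  ⟨L.1, L.2, L.3, L.4, L.5, L.6, L.7, L.8, L.9, L.10, L.11, L.12, L.13, L.14, L.15, L.16, L.17⟩

theorem wp_levels (h : PermData N P Q T R S) (hB : off + 16 * (20 * N + 40) ≤ B) {s : St}
    (L : LevelStart N P Q T R S 0 1 1 1 0 s) :
    levels.wp B off (fun s' => (∃ c pp q par, c < N ∧ LevelStart N P Q T R S c pp N q par s') ∧
      s'.clk ≤ s.clk + 90 * N) s := by
  -- A level costs at most `30 + 50 * (np - p) + 8 * (p - pp)`. As `p < np`, the potential `80 * p +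
  -- 8 * pp` pays for it; its initial value is 88.
  refine wp_while (fun s' => ∃ c pp p q par, c < p ∧ LevelStart N P Q T R S c pp p q par s' ∧
    s'.clk + 88 ≤ s.clk + 80 * p + 8 * pp) (fun s' => N - s'.v .p)
    ⟨0, 1, 1, 1, 0, by omega, L, by omega⟩ ?_
  rintro s1 ⟨c, pp, p, q, par, hc, L1, hclk⟩
  obtain ⟨⟨aP, aQ, aT, aR, aS⟩, vm, vpp, vp, vq, vpar⟩ := L1.stat
  have hN := h.two_le
  have hpar := L1.par_le
  have hpp := L1.pp_pos
  have hppp := L1.pp_le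
  simp only [ok, eval, vp, vm, true_and]
  refine ⟨fun hp => ?_, fun hp => ?_⟩
  · refine wp_seq (wp_openLevel h hB L1.tick hp) ?_
    rintro s2 ⟨G, I2, g1, g2, g3, x2, z2, c2⟩
    refine wp_seq (wp_sweep (L1.tick.ctx h hp hB) I2 x2 z2) ?_
    rintro s3 ⟨I3, hS, c3⟩
    obtain ⟨⟨bP, bQ, bT, bR, bS⟩, wm, wpp, wp, wq, wpar⟩ := id I3.inv.stat
    simp only [closeLevel, wp_seq_iff, wp_assign, ok, eval, St.set_v, reduceCtorEq, ↓reduceIte,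
      true_and, wpar, and_true]
    refine ⟨by omega, ?_⟩
    obtain ⟨s4, hs4⟩ : ∃ s4, s4 = ((((s3.set .pp (s3.v .p)).set .p (s3.v .np)).set .q
      (s3.v .nq)).set .qn (s3.v .nqn)).set .par (1 - par) := ⟨_, rfl⟩
    rw [← hs4]
    have hst : Static N P Q T R S p (s3.v .np) (s3.v .nq) (1 - par) s4 := by
      simp [hs4, Static, bP, bQ, bT, bR, bS, wm, wp]
    have hclk4 : s4.clk = s3.clk + 5 := by simp [hs4]
    have hp4 : s4.v .p = s3.v .np := by simp [hs4]
    obtain ⟨L4, h4, h5⟩ := L1.tick.next_level h hp I3 g1 g2 g3 hS rfl rfl (by simp [hs4])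
      (by simp [hs4]) (by simp [hs4]) hst
    have := L4.p_le
    refine ⟨⟨c + 1, p, _, _, _, by omega, L4, ?_⟩, by omega⟩
    simp only [St.tick_clk] at c2
    omega
  · have := L1.p_le
    obtain rfl : p = N := by omega
    refine ⟨⟨c, pp, q, par, hc, L1.tick⟩, ?_⟩
    simp only [St.tick_clk]
    omega

/-- Write the original indices of the points of the solution to the output. -/
def output : Cmd :=
  assign .i (.arr .ND (cell (.var .m))) ;; assign .j (.lit 0) ;;
  .loop (.lit 0) (.var .i)
    (ite (.lit 1) (.arr .PT (.var .i))
      (ite (.arr .PT (.var .i)) (.var .m)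
        (assign .j (.add (.var .j) (.lit 1)) ;;
          write (.var .j) (.arr .OX (.sub (.arr .PT (.var .i)) (.lit 2)))) skip) skip ;;
      assign .i (.arr .PAR (.var .i))) ;;
  write (.lit 0) (.var .j)

/-- Indices strictly decrease along a chain down to the root 0, which ends the loop. The labels 1
and `N` are sentinels and are not written. -/
theorem wp_output {s : St} {L : List ℕ} (hm : s.v .m = N) (hpar : s.v .par = par) (h1 : par ≤ 1)
    (hL : Chain (s.a .PAR) (s.a .PT) (s.a .ND (2 * N + par)) L) (hlen : L.length < off)
    (hnode : s.a .ND (2 * N + par) ≤ 5 * N)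
    (hB : off + 16 * (20 * N + 40) ≤ B) :
    output.wp B off (fun s' => s'.clk ≤ s.clk + 6 * L.length + 4 ∧ s'.io 0 ≤ L.length ∧
      (List.range (s'.io 0)).map (fun a => s'.io (a + 1)) =
        (L.filter fun v => 1 < v ∧ v < N).map fun v => s.a .OX (v - 2)) s := by
  simp only [output, wp_seq_iff, wp_assign, cell, ok, eval, hm, hpar, true_and, St.set_v, St.set_a,
    reduceCtorEq, ↓reduceIte, and_true]
  refine ⟨by omega, by omega, ?_⟩
  refine wp_while (fun s' => s'.a = s.a ∧ s'.v .m = N ∧ s'.v .i ≤ 5 * N ∧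
    ∃ L1 L2, L = L1 ++ L2 ∧ Chain (s.a .PAR) (s.a .PT) (s'.v .i) L2 ∧
      s'.v .j = (L1.filter fun v => 1 < v ∧ v < N).length ∧
      (List.range (s'.v .j)).map (fun a => s'.io (a + 1)) =
        ((L1.filter fun v => 1 < v ∧ v < N).map fun v => s.a .OX (v - 2)) ∧
      s'.clk ≤ s.clk + 6 * L1.length + 2) (fun s' => s'.v .i)
    ⟨by simp, by simp [hm], by simpa using hnode, [], L, by simp, by simpa using hL, by simp,
      by simp, by simp⟩ ?_
  rintro s1 ⟨e1, e2, e3, L1, L2, rfl, e4, e5, e6, e7⟩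
  simp only [ok, eval, Nat.zero_le, true_and]
  rw [List.length_append] at hlen
  have hfl : (L1.filter fun v => 1 < v ∧ v < N).length ≤ L1.length := List.length_filter_le _ _
  refine ⟨fun hi => ?_, fun hi => ?_⟩
  · obtain ⟨i0, hi0⟩ : ∃ i0, s1.v .i = i0 := ⟨_, rfl⟩
    rw [hi0] at e4
    rcases e4 with _ | ⟨g1, g2⟩
    · omega
    simp only [List.length_cons] at hlen
    have hap : ∀ (v : ℕ) (L3 : List ℕ), L1 ++ v :: L3 = (L1 ++ [v]) ++ L3 := by simp
    simp only [skip, wp_seq_iff, wp_ite, wp_assign, wp_write, ok, eval, e1, e2, hi0, true_and,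
      St.set_v, St.set_a, St.set_io, St.tick_v, St.tick_a, St.out_v, St.out_a, reduceCtorEq,
      ↓reduceIte, and_true]
    refine ⟨by omega, by omega, fun h1 => ⟨by omega, fun h2 => ⟨by omega, by omega, by omega,
      by omega, ?_, by omega⟩, fun h2 => ⟨by omega, ?_, by omega⟩⟩, fun h1 => ⟨by omega, ?_, by omega⟩⟩
    all_goals refine ⟨by omega, _, _, hap _ _, g2, ?_⟩
    · simp [List.filter_append, h1, h2, e5, List.range_succ, Function.update_apply]
      simp [e5] at e6
      refine ⟨?_, by omega⟩
      rw [← e6]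
      refine List.map_congr_left fun a ha => ?_
      rw [List.mem_range] at ha
      rw [if_neg (by omega)]
    · simp [List.filter_append, h1, h2, e5]
      simp [e5] at e6
      exact ⟨e6, by omega⟩
    · simp [List.filter_append, h1, e5]
      simp [e5] at e6
      exact ⟨e6, by omega⟩
  · have hi0 : s1.v .i = 0 := by omega
    rw [hi0] at e4
    rcases e4 with _ | ⟨g1, g2⟩
    · simp only [wp_write, ok, eval, St.tick_v, St.tick_io, St.out_clk, St.tick_clk, St.out_io,
        Function.update_self, List.append_nil, true_and, Nat.zero_le, ne_eq, Nat.succ_ne_zero,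
        not_false_eq_true, Function.update_of_ne]
      exact ⟨by omega, by omega, by omega, e6⟩
    · omega

end RAM

/-! ### Radix sort -/

/-- One pass of radix sort: distribute a list over buckets and collect it again. -/
def bucketPass (b : ℕ) (g : ℕ → ℕ) (l : List ℕ) : List ℕ :=
  (List.range b).flatMap fun d => l.filter fun a => g a = d

theorem bucketPass_perm {b : ℕ} {g : ℕ → ℕ} {l : List ℕ} (hl : l.Nodup) (hg : ∀ a ∈ l, g a < b) :
    (bucketPass b g l).Perm l := by
  refine (List.perm_ext_iff_of_nodup ?_ hl).2 fun a => ?_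
  · rw [bucketPass, List.nodup_flatMap]
    refine ⟨fun d _ => hl.filter _, ?_⟩
    refine List.nodup_range.imp_of_mem fun {d d'} _ _ hne => ?_
    intro a h1 h2
    simp only [List.mem_filter, decide_eq_true_eq] at h1 h2
    exact hne (h1.2.symm.trans h2.2)
  · simp only [bucketPass, List.mem_flatMap, List.mem_range, List.mem_filter, decide_eq_true_eq]
    exact ⟨fun ⟨_, _, h, _⟩ => h, fun h => ⟨_, hg a h, h, rfl⟩⟩

/-- Stability: filtering keeps the order inside each bucket, where the new digit is constant and the
lower digits are already sorted; between buckets the new digit decides. -/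
theorem bucketPass_sorted {b w : ℕ} {f : ℕ → ℕ} {l : List ℕ} (hw : 0 < w)
    (hl : l.Pairwise fun i j => f i % w ≤ f j % w) :
    (bucketPass b (fun a => f a / w % b) l).Pairwise fun i j => f i % (w * b) ≤ f j % (w * b) := by
  have key : ∀ a, f a % (w * b) = f a % w + w * (f a / w % b) := fun a => Nat.mod_mul
  rw [bucketPass, List.pairwise_flatMap]
  refine ⟨fun d _ => ?_, ?_⟩
  · refine (hl.filter _).imp_of_mem fun {i j} hi hj h => ?_
    simp only [List.mem_filter, decide_eq_true_eq] at hi hj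
    rw [key, key, hi.2, hj.2]
    omega
  · refine List.pairwise_lt_range.imp fun {d d'} hlt i hi j hj => ?_
    simp only [List.mem_filter, decide_eq_true_eq] at hi hj
    rw [key, key, hi.2, hj.2]
    have h1 := Nat.mod_lt (f i) hw
    have h2 := Nat.mul_le_mul_left w (Nat.succ_le_of_lt hlt)
    rw [Nat.mul_succ] at h2
    omega

namespace RAM

open RAM.Cmd RAM.Expr

variable {B off : ℕ}

/-- Distribute the indices in `O` over buckets, according to a digit of their keys `K`. -/
def distribute (K O : Arr) : Cmd :=
  assign .i (.lit 0) ;;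
  .loop (.var .i) (.var .n)
    (assign .e (.arr O (.var .i)) ;;
      assign .d (.sub (.div (.arr K (.var .e)) (.var .pw))
        (.mul (.div (.div (.arr K (.var .e)) (.var .pw)) (.var .b)) (.var .b))) ;;
      store .BUCK (.add (.mul (.var .d) (.var .b)) (.arr .CNT (.var .d))) (.var .e) ;;
      store .CNT (.var .d) (.add (.arr .CNT (.var .d)) (.lit 1)) ;;
      assign .i (.add (.var .i) (.lit 1)))

/-- The contents of the bucket `d`. -/
def bucket (b : ℕ) (C U : ℕ → ℕ) (d : ℕ) : List ℕ :=
  (List.range (C d)).map fun j => U (d * b + j)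

/-- All buckets are shorter than `b`, so the address `d * b + j` determines `d` and `j`. -/
theorem bucket_update {b : ℕ} {C U : ℕ → ℕ} {d e : ℕ} (hC : ∀ d, C d < b) (d' : ℕ) :
    bucket b (Function.update C d (C d + 1)) (Function.update U (d * b + C d) e) d' =
      bucket b C U d' ++ if d' = d then [e] else [] := by
  have h : ∀ j < C d', d' ≠ d ∨ j < C d → d' * b + j ≠ d * b + C d := by
    intro j hj hor he
    have h1 := hC d
    have h2 := hC d'
    have h3 : (d' * b + j) / b = (d * b + C d) / b := by rw [he]
    rw [mul_comm d', mul_comm d, Nat.mul_add_div (by omega), Nat.mul_add_div (by omega),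
      Nat.div_eq_of_lt (by omega), Nat.div_eq_of_lt h1] at h3
    obtain rfl : d' = d := by omega
    omega
  by_cases e1 : d' = d
  · subst e1
    simp only [bucket, Function.update_self, List.range_succ, List.map_append, List.map_cons,
      List.map_nil, if_true]
    congr 1
    refine List.map_congr_left fun j hj => ?_
    rw [List.mem_range] at hj
    rw [Function.update_of_ne (h j hj (Or.inr hj))]
  · simp only [bucket, Function.update_of_ne e1, if_neg e1, List.append_nil]
    refine List.map_congr_left fun j hj => ?_
    rw [List.mem_range] at hj
    rw [Function.update_of_ne (h j hj (Or.inl e1))]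

theorem wp_distribute {K O : Arr} {n b w : ℕ} {s : St} (hK : K ≠ .BUCK ∧ K ≠ .CNT)
    (hO : O ≠ .BUCK ∧ O ≠ .CNT) (hn : s.v .n = n) (hb : s.v .b = b) (hnb : b = n + 2)
    (hw : s.v .pw = w) (hC : ∀ d, s.a .CNT d = 0) (hOn : ∀ i < n, s.a O i < n)
    (hB : off + 16 * (b * b + b + 1) ≤ B) (hKB : ∀ i < n, s.a K i ≤ B) :
    (distribute K O).wp B off (fun s' => s'.clk ≤ s.clk + 6 * n + 2 ∧ ∀ d,
      bucket b (s'.a .CNT) (s'.a .BUCK) d =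
        ((List.range n).map (s.a O)).filter fun a => s.a K a / w % b = d) s := by
  simp only [distribute, wp_seq_iff, wp_assign, ok, eval, Nat.zero_le, true_and]
  refine wp_while (fun s' => (s'.a K = s.a K ∧ s'.a O = s.a O ∧ s'.v .n = n ∧ s'.v .b = b ∧
    s'.v .pw = w ∧ s'.v .i ≤ n) ∧ s'.clk ≤ s.clk + 6 * s'.v .i + 1 ∧
    ∀ d, bucket b (s'.a .CNT) (s'.a .BUCK) d =
      ((List.range (s'.v .i)).map (s.a O)).filter fun a => s.a K a / w % b = d)
    (fun s' => n - s'.v .i) ⟨by simp [hn, hb, hw], by simp, by simp [bucket, hC]⟩ ?_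
  rintro s1 ⟨⟨e1, e2, e3, e4, e5, e6⟩, e7, e8⟩
  have hC1 : ∀ d, s1.a .CNT d ≤ s1.v .i := by
    intro d
    have h1 := congrArg List.length (e8 d)
    have h2 := List.length_filter_le (fun a => decide (s.a K a / w % b = d))
      ((List.range (s1.v .i)).map (s.a O))
    simp only [bucket, List.length_map, List.length_range] at h1 h2
    omega
  simp only [ok, eval, true_and, e3]
  refine ⟨fun hi => ?_, fun hi => ?_⟩
  · have ho := hOn _ hi
    -- The machine has no remainder instruction; the digit is obtained from a quotient.
    have hd : s.a K (s.a O (s1.v .i)) / w - s.a K (s.a O (s1.v .i)) / w / b * b =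
        s.a K (s.a O (s1.v .i)) / w % b := by
      have := Nat.div_add_mod (s.a K (s.a O (s1.v .i)) / w) b
      rw [mul_comm] at this
      omega
    have hdb : s.a K (s.a O (s1.v .i)) / w % b < b := Nat.mod_lt _ (by omega)
    have hKb : s.a K (s.a O (s1.v .i)) / w / b * b ≤ B :=
      (Nat.div_mul_le_self _ _).trans ((Nat.div_le_self _ _).trans (hKB _ ho))
    have hCd := hC1 (s.a K (s.a O (s1.v .i)) / w % b)
    have hbb : s.a K (s.a O (s1.v .i)) / w % b * b + b ≤ b * b := by
      have := Nat.mul_le_mul_right b (Nat.succ_le_of_lt hdb)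
      rwa [Nat.succ_mul] at this
    simp only [wp_seq_iff, wp_assign, wp_store, ok, eval, true_and, and_true, St.set_v, St.set_a,
      St.put_v, St.put_a, St.tick_v, St.tick_a, reduceCtorEq, ↓reduceIte, hK, hO, e1, e2, e4, e5,
      hd, Function.update_self, ne_eq, not_false_eq_true]
    repeat refine ⟨by omega, ?_⟩
    refine ⟨⟨⟨e3, by omega⟩, ?_, ?_⟩, by omega⟩
    · simp only [St.set_clk, St.put_clk, St.tick_clk]; omega
    · intro d
      rw [bucket_update (fun d => by have := hC1 d; omega), e8]
      simp only [List.range_succ, List.map_append, List.map_cons, List.map_nil, List.filter_append]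
      congr 1
      simp only [List.filter_cons, List.filter_nil, decide_eq_true_eq, @eq_comm _ d]
  · obtain rfl : s1.v .i = n := by omega
    exact ⟨by simp only [St.tick_clk]; omega, e8⟩

/-- Collect the buckets in `O`, and empty them. -/
def collect (O : Arr) : Cmd :=
  assign .i (.lit 0) ;; assign .d (.lit 0) ;;
  .loop (.var .d) (.var .b)
    (assign .j (.lit 0) ;;
      .loop (.var .j) (.arr .CNT (.var .d))
        (store O (.var .i) (.arr .BUCK (.add (.mul (.var .d) (.var .b)) (.var .j))) ;;
          assign .i (.add (.var .i) (.lit 1)) ;; assign .j (.add (.var .j) (.lit 1))) ;;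
      store .CNT (.var .d) (.lit 0) ;; assign .d (.add (.var .d) (.lit 1)))

theorem map_range_update (f : ℕ → ℕ) (i a : ℕ) :
    (List.range (i + 1)).map (Function.update f i a) = (List.range i).map f ++ [a] := by
  rw [List.range_succ, List.map_append, List.map_singleton, Function.update_self]
  congr 1
  refine List.map_congr_left fun j hj => ?_
  rw [List.mem_range] at hj
  rw [Function.update_of_ne (by omega)]

theorem wp_collect {O : Arr} {b : ℕ} {s : St} (hO : O ≠ .BUCK ∧ O ≠ .CNT) (hb : s.v .b = b)
    (hC : ∀ d, s.a .CNT d ≤ b) (hC0 : ∀ d, b ≤ d → s.a .CNT d = 0)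
    (hB : off + 16 * (b * b + b + 1) ≤ B) :
    (collect O).wp B off (fun s' => ∃ i, s'.clk ≤ s.clk + 4 * i + 5 * b + 3 ∧
      (∀ d, s'.a .CNT d = 0) ∧ (List.range i).map (s'.a O) =
        (List.range b).flatMap (bucket b (s.a .CNT) (s.a .BUCK))) s := by
  simp only [collect, wp_seq_iff, wp_assign, ok, eval, Nat.zero_le, true_and]
  refine wp_while (fun s' => (s'.a .BUCK = s.a .BUCK ∧ s'.v .b = b ∧ s'.v .d ≤ b ∧
    (∀ d, s'.a .CNT d = if d < s'.v .d then 0 else s.a .CNT d) ∧ s'.v .i ≤ s'.v .d * b) ∧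
    s'.clk ≤ s.clk + 4 * s'.v .i + 5 * s'.v .d + 2 ∧
    (List.range (s'.v .i)).map (s'.a O) =
      (List.range (s'.v .d)).flatMap (bucket b (s.a .CNT) (s.a .BUCK)))
    (fun s' => b - s'.v .d) ⟨by simp [hb], by simp, by simp⟩ ?_
  rintro s1 ⟨⟨e1, e2, e3, e4, e5⟩, e6, e7⟩
  simp only [ok, eval, true_and, e2]
  refine ⟨fun hd => ?_, fun hd => ?_⟩
  · simp only [wp_seq_iff, wp_assign, ok, eval, Nat.zero_le, true_and]
    have hdb : s1.v .d * b + b ≤ b * b := by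
      have := Nat.mul_le_mul_right b (Nat.succ_le_of_lt hd)
      rwa [Nat.succ_mul] at this
    have hCd := hC (s1.v .d)
    refine wp_while (fun s' => (s'.a .BUCK = s.a .BUCK ∧ s'.v .b = b ∧ s'.v .d = s1.v .d ∧
      s'.a .CNT = s1.a .CNT ∧ s'.v .j ≤ s.a .CNT (s1.v .d) ∧
      s'.v .i ≤ s1.v .d * b + s'.v .j) ∧ s'.clk ≤ s.clk + 4 * s'.v .i + 5 * s1.v .d + 4 ∧
      (List.range (s'.v .i)).map (s'.a O) =
        (List.range (s1.v .d)).flatMap (bucket b (s.a .CNT) (s.a .BUCK)) ++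
          (List.range (s'.v .j)).map fun j => s.a .BUCK (s1.v .d * b + j))
      (fun s' => s.a .CNT (s1.v .d) - s'.v .j) ⟨by simp [e1, e2, e5], by simp; omega,
        by simpa using e7⟩ ?_
    rintro s2 ⟨⟨f1, f2, f3, f4, f5, f6⟩, f7, f8⟩
    simp only [ok, eval, true_and, f3, f4, e4, lt_irrefl, if_false]
    refine ⟨by omega, fun hj => ?_, fun hj => ?_⟩
    · simp only [wp_seq_iff, wp_assign, wp_store, ok, eval, true_and, and_true, St.set_v, St.set_a,
        St.put_v, St.put_a, St.tick_v, St.tick_a, reduceCtorEq, ↓reduceIte, f1, f2, f3, hO.1.symm,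
        hO.2.symm, f4]
      repeat refine ⟨by omega, ?_⟩
      refine ⟨⟨⟨by omega, by omega⟩, ?_, ?_⟩, by omega⟩
      · simp only [St.set_clk, St.put_clk, St.tick_clk]; omega
      · rw [map_range_update, f8, List.range_succ (n := s2.v .j), List.map_append,
          List.append_assoc, List.map_singleton]
    · simp only [wp_seq_iff, wp_assign, wp_store, ok, eval, true_and, and_true, St.set_v, St.set_a,
        St.put_v, St.put_a, St.tick_v, St.tick_a, reduceCtorEq, ↓reduceIte, f1, f2, f3]
      have hj' : s2.v .j = s.a .CNT (s1.v .d) := by omega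
      refine ⟨by omega, by omega, by omega, ⟨⟨by omega, ?_, ?_⟩, ?_, ?_⟩, by omega⟩
      · intro d
        rw [Function.update_apply, f4, e4]
        split_ifs <;> first | rfl | omega
      · rw [Nat.succ_mul]; omega
      · simp only [St.set_clk, St.put_clk, St.tick_clk]; omega
      · rw [if_neg hO.2, f8, List.range_succ (n := s1.v .d), List.flatMap_append, hj']
        simp [bucket]
  · obtain rfl : s1.v .d = b := by omega
    refine ⟨s1.v .i, by simp only [St.tick_clk]; omega, fun d => ?_, e7⟩
    rw [St.tick_a, e4]
    split_ifs with h
    · rfl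
    · exact hC0 d (by omega)

/-- Sort the indices below `n` in `O` by their keys `K`, which are below `km`. -/
def radixSort (K O : Arr) : Cmd :=
  assign .i (.lit 0) ;;
  .loop (.var .i) (.var .n)
    (store O (.var .i) (.var .i) ;; assign .i (.add (.var .i) (.lit 1))) ;;
  assign .pw (.lit 1) ;;
  .loop (.var .pw) (.var .km)
    (distribute K O ;; collect O ;; assign .pw (.mul (.var .pw) (.var .b)))

/-- The base is `b = n + 2`, so a pass costs a multiple of `b`, and keys below `b ^ E` need at most
`E` passes. -/
theorem wp_radixSort {K O : Arr} {n b E : ℕ} {s : St} (hK : K ≠ .BUCK ∧ K ≠ .CNT)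
    (hO : O ≠ .BUCK ∧ O ≠ .CNT) (hKO : K ≠ O) (hn : s.v .n = n) (hb : s.v .b = b)
    (hnb : b = n + 2) (hC : ∀ d, s.a .CNT d = 0) (hB : off + 16 * (b * b + b + 1) ≤ B)
    (hK1 : ∀ i < n, s.a K i < s.v .km) (hkm : s.v .km ≤ b ^ E) (hE : b ^ (E + 1) ≤ B) :
    (radixSort K O).wp B off (fun s' => s'.clk ≤ s.clk + (E + 1) * (20 * b) ∧
      (∀ d, s'.a .CNT d = 0) ∧ ((List.range n).map (s'.a O)).Perm (List.range n) ∧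
      ((List.range n).map (s'.a O)).Pairwise fun i j => s.a K i ≤ s.a K j) s := by
  simp only [radixSort, wp_seq_iff, wp_assign, ok, eval, Nat.zero_le, true_and]
  have hbE : 1 ≤ b ^ (E + 1) := Nat.one_le_pow _ _ (by omega)
  refine wp_while (fun s' => (s'.v .n = n ∧ s'.v .b = b ∧ s'.v .km = s.v .km ∧ s'.a K = s.a K ∧
    s'.a .CNT = s.a .CNT ∧ s'.v .i ≤ n) ∧ s'.clk ≤ s.clk + 3 * s'.v .i + 1 ∧
    (List.range (s'.v .i)).map (s'.a O) = List.range (s'.v .i)) (fun s' => n - s'.v .i)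
    ⟨by simp [hn, hb], by simp, by simp⟩ ?_
  rintro s1 ⟨⟨e1, e2, e3, e4, e5, e6⟩, e7, e8⟩
  simp only [ok, eval, true_and, e1]
  refine ⟨fun hi => ?_, fun hi => ?_⟩
  · simp only [wp_seq_iff, wp_assign, wp_store, ok, eval, true_and, and_true, St.set_v, St.set_a,
      St.put_v, St.put_a, St.tick_v, St.tick_a, reduceCtorEq, ↓reduceIte, hKO, hO.2.symm]
    repeat refine ⟨by omega, ?_⟩
    refine ⟨⟨⟨e1, e2, e3, e4, e5, by omega⟩, ?_, ?_⟩, by omega⟩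
    · simp only [St.set_clk, St.put_clk, St.tick_clk]; omega
    · rw [map_range_update, e8, List.range_succ]
  have hin : s1.v .i = n := by omega
  rw [hin] at e7 e8
  have h1B : 1 ≤ B := by omega
  simp only [wp_seq_iff, wp_assign, ok, eval, true_and, h1B]
  refine wp_while (fun s' => (s'.v .n = n ∧ s'.v .b = b ∧ s'.v .km = s.v .km ∧ s'.a K = s.a K ∧
    ∀ d, s'.a .CNT d = 0) ∧ ((List.range n).map (s'.a O)).Perm (List.range n) ∧ ∃ t ≤ E,
    s'.v .pw = b ^ t ∧ s'.clk ≤ s.clk + t * (20 * b) + 3 * n + 3 ∧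
    ((List.range n).map (s'.a O)).Pairwise fun i j => s.a K i % b ^ t ≤ s.a K j % b ^ t)
    (fun s' => s.v .km - s'.v .pw) ⟨by simp [e1, e2, e3, e4, e5, hC], by simp [e8], 0, by omega,
      by simp, by simp; omega, by
        simp only [pow_zero, Nat.mod_one]; exact List.pairwise_of_forall fun _ _ => le_rfl⟩ ?_
  rintro s2 ⟨⟨f1, f2, f3, f4, f5⟩, f6, t, ht, f7, f8, f9⟩
  simp only [ok, eval, true_and, f3, f7]
  have hmem : ∀ i < n, s2.a O i < n := fun i hi => by
    have := f6.mem_iff (a := s2.a O i)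
    simpa using this.1 (List.mem_map_of_mem (List.mem_range.2 hi))
  refine ⟨fun hlt => ?_, fun hge => ?_⟩
  · have htE : t < E := by
      by_contra h
      have := Nat.pow_le_pow_right (n := b) (by omega) (not_lt.1 h)
      omega
    have hkB : b ^ E ≤ B := (Nat.pow_le_pow_right (by omega) (by omega)).trans hE
    have hpw : b ^ (t + 1) ≤ B := (Nat.pow_le_pow_right (by omega) (by omega)).trans hE
    have hpos : 0 < b ^ t := Nat.pow_pos (by omega)
    refine wp_seq (wp_frame (wp_distribute (n := n) (b := b) (w := b ^ t) hK hO (by simpa using f1)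
      (by simpa using f2) hnb (by simpa using f7) (by simpa using f5) (by simpa using hmem) hB
      (fun i hi => ?_))) ?_
    · have := hK1 i hi
      simp only [St.tick_a, f4]
      omega
    rintro s3 ⟨⟨g1, g2⟩, g3, g4, -⟩
    simp only [St.tick_a, St.tick_clk, f4] at g1 g2
    have gv : ∀ x ∈ [Var.n, .b, .km, .pw], s3.v x = s2.v x := by
      intro x hx
      rw [g3 x]
      · simp
      · simp only [List.mem_cons, List.not_mem_nil, or_false] at hx
        rcases hx with rfl | rfl | rfl | rfl <;> simp [distribute]
    have gK : s3.a K = s.a K := by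
      rw [g4 K (by simp [distribute, hK.1.symm, hK.2.symm]), St.tick_a, f4]
    have hdig : ∀ a, s.a K a / b ^ t % b < b := fun a => Nat.mod_lt _ (by omega)
    have hlen : ∀ d, s3.a .CNT d ≤ n ∧ (b ≤ d → s3.a .CNT d = 0) := by
      intro d
      have h1 := congrArg List.length (g2 d)
      have h2 := List.length_filter_le (fun a => decide (s.a K a / b ^ t % b = d))
        ((List.range n).map (s2.a O))
      rw [bucket, List.length_map, List.length_range] at h1
      rw [List.length_map, List.length_range] at h2
      refine ⟨by omega, fun hd => ?_⟩
      rw [h1, List.length_eq_zero_iff, List.filter_eq_nil_iff]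
      intro a _
      have := hdig a
      simp only [decide_eq_true_eq]
      omega
    refine wp_seq (wp_frame (wp_collect (b := b) hO ((gv .b (by simp)).trans f2)
      (fun d => by have := (hlen d).1; omega) (fun d => (hlen d).2) hB)) ?_
    rintro s4 ⟨⟨i, k1, k2, k3⟩, k4, k5, -⟩
    have e : (List.range i).map (s4.a O) =
        bucketPass b (fun a => s.a K a / b ^ t % b) ((List.range n).map (s2.a O)) := by
      rw [k3, bucketPass]
      exact congrArg (fun f => (List.range b).flatMap f) (funext g2)
    have hnd : ((List.range n).map (s2.a O)).Nodup := f6.nodup_iff.2 List.nodup_range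
    have hperm := bucketPass_perm (g := fun a => s.a K a / b ^ t % b) hnd fun a _ => hdig a
    obtain rfl : i = n := by
      have := hperm.length_eq
      rw [← e] at this
      simpa using this
    have kv : ∀ x ∈ [Var.n, .b, .km, .pw], s4.v x = s2.v x := by
      intro x hx
      rw [k4 x, gv x hx]
      simp only [List.mem_cons, List.not_mem_nil, or_false] at hx
      rcases hx with rfl | rfl | rfl | rfl <;> simp [collect]
    have kK : s4.a K = s.a K := by
      rw [k5 K (by simp [collect, hKO.symm, hK.2.symm]), gK]
    simp only [wp_assign, ok, eval, true_and, St.set_v, St.set_a, reduceCtorEq, ↓reduceIte,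
      St.set_clk]
    rw [kv .pw (by simp), kv .b (by simp), f7, f2, ← pow_succ]
    refine ⟨hpw, ⟨⟨(kv .n (by simp)).trans f1, rfl, (kv .km (by simp)).trans f3, kK, k2⟩,
      ?_, t + 1, htE, rfl, ?_, ?_⟩, ?_⟩
    · rw [e]; exact hperm.trans f6
    · rw [Nat.succ_mul]
      omega
    · rw [e, pow_succ]
      exact bucketPass_sorted hpos f9
    · have : b ^ t < b ^ (t + 1) := Nat.pow_lt_pow_right (by omega) (by omega)
      omega
  · refine ⟨?_, f5, f6, ?_⟩
    · have := Nat.mul_le_mul_right (20 * b) ht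
      rw [Nat.succ_mul]
      simp only [St.tick_clk]
      omega
    -- All keys are now below `b ^ t`, so the comparison modulo `b ^ t` is the full one.
    · refine f9.imp_of_mem fun {i j} hi hj h => ?_
      have h1 := List.mem_range.1 (f6.mem_iff.1 hi)
      have h2 := List.mem_range.1 (f6.mem_iff.1 hj)
      rwa [Nat.mod_eq_of_lt ((hK1 i h1).trans_le (not_lt.1 hge)),
        Nat.mod_eq_of_lt ((hK1 j h2).trans_le (not_lt.1 hge))] at h

end RAM

/-! ### Reading the input and forming the sorting keys -/

namespace RAM

open RAM.Cmd RAM.Expr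

variable {B off : ℕ}

theorem Cmd.Frame.refl (c : Cmd) (s : St) : c.Frame s s :=
  ⟨fun _ _ => rfl, fun _ _ => rfl, fun _ => rfl⟩

/-- The rule for loops, with the knowledge of what the loop does not change. -/
theorem Cmd.wp_while_frame {a b : Expr} {c : Cmd} {Q : St → Prop} {s : St} (I : St → Prop)
    (m : St → ℕ) (h0 : I s) (hI : ∀ s', I s' → c.Frame s s' → a.ok B off s' ∧ b.ok B off s' ∧
      (a.eval s' < b.eval s' → c.wp B off (fun s2 => I s2 ∧ m s2 < m s') s'.tick) ∧
      (¬ a.eval s' < b.eval s' → Q s'.tick)) : (Cmd.loop a b c).wp B off Q s := by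
  refine wp_while (fun s' => I s' ∧ c.Frame s s') m ⟨h0, .refl _ _⟩ ?_
  rintro s1 ⟨h1, f1⟩
  obtain ⟨ha, hb, hc, hd⟩ := hI s1 h1 f1
  refine ⟨ha, hb, fun hl => ?_, hd⟩
  refine wp_mono ?_ (wp_frame (hc hl))
  rintro s2 ⟨⟨h2, h3⟩, g1, g2, g3⟩
  exact ⟨⟨h2, fun x hx => (g1 x hx).trans (f1.1 x hx), fun x hx => (g2 x hx).trans (f1.2.1 x hx),
    fun hx => (g3 hx).trans (f1.2.2 hx)⟩, h3⟩

/-- The largest coordinate. -/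
def readMax : Cmd :=
  assign .w (.lit 0) ;; assign .i (.lit 0) ;; assign .e (.mul (.lit 4) (.var .n)) ;;
  .loop (.var .i) (.var .e)
    (ite (.var .w) (.io (.add (.var .i) (.lit 1))) (assign .w (.io (.add (.var .i) (.lit 1))))
      skip ;; assign .i (.add (.var .i) (.lit 1)))

theorem wp_readMax {n M : ℕ} {s : St} (hn : s.v .n = n) (hoff : off = 4 * n + 8) (hB : off ≤ B)
    (hM : ∀ i < 4 * n, s.io (i + 1) ≤ M) :
    readMax.wp B off (fun s' => s'.clk ≤ s.clk + 16 * n + 4 ∧ s'.v .w ≤ M ∧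
      ∀ i < 4 * n, s.io (i + 1) ≤ s'.v .w) s := by
  simp only [readMax, wp_seq_iff, wp_assign, ok, eval, Nat.zero_le, true_and, St.set_v,
    reduceCtorEq, ↓reduceIte, hn]
  refine ⟨by omega, ?_⟩
  refine wp_while_frame (fun s' => s'.v .i ≤ 4 * n ∧ s'.clk ≤ s.clk + 4 * s'.v .i + 3 ∧
    s'.v .w ≤ M ∧ ∀ i < s'.v .i, s.io (i + 1) ≤ s'.v .w) (fun s' => 4 * n - s'.v .i)
    ⟨by simp, by simp, by simp, by simp⟩ ?_
  rintro s1 ⟨e1, e2, e3, e4⟩ ⟨f1, -, f3⟩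
  have he : s1.v .e = 4 * n := by rw [f1 .e rfl]; simp
  have hio : s1.io = s.io := by rw [f3 rfl]; rfl
  simp only [ok, eval, true_and, he]
  refine ⟨fun hi => ?_, fun hi => ?_⟩
  · have := hM _ hi
    simp only [skip, wp_seq_iff, wp_ite, wp_assign, ok, eval, true_and, and_true, St.set_v,
      St.tick_v, St.tick_io, reduceCtorEq, ↓reduceIte, hio]
    refine ⟨by omega, fun h => ⟨by omega, by omega, ⟨by omega, ?_, by omega, fun i hi' => ?_⟩,
      by omega⟩, fun h => ⟨by omega, ⟨by omega, ?_, by omega, fun i hi' => ?_⟩, by omega⟩⟩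
    · simp only [St.set_clk, St.tick_clk]; omega
    · rcases Nat.lt_succ_iff_lt_or_eq.1 hi' with h1 | rfl
      · have := e4 i h1; omega
      · exact le_rfl
    · simp only [St.set_clk, St.tick_clk]; omega
    · rcases Nat.lt_succ_iff_lt_or_eq.1 hi' with h1 | rfl
      · exact e4 i h1
      · omega
  · obtain hi : s1.v .i = 4 * n := by omega
    rw [hi] at e2 e4
    exact ⟨by simp only [St.tick_clk]; omega, e3, e4⟩

/-- Whether the vertical direction has to be reversed, so that all corners become lower left or
upper right ones. -/
def readFlip : Cmd :=
  ite (.io (.lit 1)) (.io (.lit 3))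
    (ite (.io (.lit 2)) (.io (.lit 4)) (assign .fl (.lit 0)) (assign .fl (.lit 1)))
    (ite (.io (.lit 2)) (.io (.lit 4)) (assign .fl (.lit 1)) (assign .fl (.lit 0)))

theorem wp_readFlip {s : St} (hoff : 8 ≤ off) (hB : off ≤ B) :
    readFlip.wp B off (fun s' => s'.clk ≤ s.clk + 3 ∧
      s'.v .fl = if (s.io 1 < s.io 3 ↔ s.io 2 < s.io 4) then 0 else 1) s := by
  simp only [readFlip, wp_ite, wp_assign, ok, eval, St.tick_io, St.set_v, ↓reduceIte, St.set_clk,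
    St.tick_clk]
  refine ⟨by omega, by omega, fun h1 => ⟨by omega, by omega, fun h2 => ⟨by omega, by omega, ?_⟩,
    fun h2 => ⟨by omega, by omega, ?_⟩⟩, fun h1 => ⟨by omega, by omega,
    fun h2 => ⟨by omega, by omega, ?_⟩, fun h2 => ⟨by omega, by omega, ?_⟩⟩⟩ <;> simp [h1, h2]

/-- The horizontal sorting key of a corner. -/
def keyX (M n x y i : ℕ) : ℕ := (x * (M + 1) + (M - y)) * n + i

/-- The vertical sorting key of a corner. -/
def keyY (M n x y i : ℕ) : ℕ := (y * (M + 1) + (M - x)) * n + (n - (i + 1))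

theorem mul_add_lt_mul {a b n i : ℕ} (ha : a < b) (hi : i < n) : a * n + i < b * n := by
  have := Nat.mul_le_mul_right n (Nat.succ_le_of_lt ha)
  rw [Nat.succ_mul] at this
  omega

/-- The key is a number with the three digits `x`, `M - y` and the index `i`. The second digit is
reversed, and the index is reversed in `keyY`, so that corners tied in a coordinate are ordered
oppositely by the two keys. -/
theorem keyX_lt {M n x y i : ℕ} (hx : x ≤ M) (hi : i < n) :
    keyX M n x y i < (M + 1) * (M + 1) * n :=
  mul_add_lt_mul (mul_add_lt_mul (by omega) (by omega)) hi

theorem keyY_lt {M n x y i : ℕ} (hy : y ≤ M) (hi : i < n) :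
    keyY M n x y i < (M + 1) * (M + 1) * n :=
  mul_add_lt_mul (mul_add_lt_mul (by omega) (by omega)) (by omega)

/-- The sorting keys. -/
def makeKeys : Cmd :=
  assign .km (.mul (.mul (.add (.var .w) (.lit 1)) (.add (.var .w) (.lit 1))) (.var .n)) ;;
  assign .i (.lit 0) ;;
  .loop (.var .i) (.var .n)
    (assign .x (.io (.add (.mul (.lit 4) (.var .i)) (.lit 1))) ;;
      assign .y (.io (.add (.mul (.lit 4) (.var .i)) (.lit 2))) ;;
      ite (.lit 0) (.var .fl) (assign .y (.sub (.var .w) (.var .y))) skip ;;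
      store .KX (.var .i) (.add (.mul (.add (.mul (.var .x) (.add (.var .w) (.lit 1)))
        (.sub (.var .w) (.var .y))) (.var .n)) (.var .i)) ;;
      store .KY (.var .i) (.add (.mul (.add (.mul (.var .y) (.add (.var .w) (.lit 1)))
        (.sub (.var .w) (.var .x))) (.var .n)) (.sub (.var .n) (.add (.var .i) (.lit 1)))) ;;
      assign .i (.add (.var .i) (.lit 1)))

theorem wp_makeKeys {n M fl : ℕ} {s : St} (hn : s.v .n = n) (hM : s.v .w = M) (hfl : s.v .fl = fl)
    (hoff : off = 4 * n + 8) (hio : ∀ i < 4 * n, s.io (i + 1) ≤ M)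
    (hB : off + 16 * (n + 1) ≤ B) (hB' : (M + 1) * (M + 1) * (n + 1) ≤ B) {x y : ℕ → ℕ}
    (hx : ∀ i < n, x i = s.io (4 * i + 1))
    (hy : ∀ i < n, y i = if 0 < fl then M - s.io (4 * i + 2) else s.io (4 * i + 2)) :
    makeKeys.wp B off (fun s' => s'.clk ≤ s.clk + 8 * n + 3 ∧
      s'.v .km = (M + 1) * (M + 1) * n ∧
      ∀ i < n, s'.a .KX i = keyX M n (x i) (y i) i ∧ s'.a .KY i = keyY M n (x i) (y i) i) s := by
  have hMB : (M + 1) * (M + 1) ≤ B := (Nat.le_mul_of_pos_right _ (by omega)).trans hB'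
  have hMB2 : M + 1 ≤ B := (Nat.le_mul_of_pos_right _ (by omega)).trans hMB
  have hMB3 : (M + 1) * (M + 1) * n ≤ B := (Nat.mul_le_mul_left _ (by omega)).trans hB'
  simp only [makeKeys, wp_seq_iff, wp_assign, ok, eval, Nat.zero_le, true_and, St.set_v,
    reduceCtorEq, ↓reduceIte, hn, hM]
  refine ⟨by omega, ?_⟩
  refine wp_while_frame (fun s' => s'.v .i ≤ n ∧ s'.clk ≤ s.clk + 8 * s'.v .i + 2 ∧
    ∀ i < s'.v .i, s'.a .KX i = keyX M n (x i) (y i) i ∧ s'.a .KY i = keyY M n (x i) (y i) i)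
    (fun s' => n - s'.v .i) ⟨by simp, by simp, by simp⟩ ?_
  rintro s1 ⟨e1, e2, e3⟩ ⟨f1, -, f3⟩
  have hn1 : s1.v .n = n := by rw [f1 .n rfl]; simp [hn]
  have hw1 : s1.v .w = M := by rw [f1 .w rfl]; simp [hM]
  have hfl1 : s1.v .fl = fl := by rw [f1 .fl rfl]; simp [hfl]
  have hkm1 : s1.v .km = (M + 1) * (M + 1) * n := by rw [f1 .km rfl]; simp
  have hio1 : s1.io = s.io := by rw [f3 rfl]; rfl
  simp only [ok, eval, true_and, hn1]
  refine ⟨fun hi => ?_, fun hi => ?_⟩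
  · have hx1 : s1.io (4 * s1.v .i + 1) = x (s1.v .i) := by rw [hx _ hi, hio1]
    have hxM : x (s1.v .i) ≤ M := by
      rw [hx _ hi]; exact hio _ (by omega)
    have hyM : s.io (4 * s1.v .i + 2) ≤ M := hio (4 * s1.v .i + 1) (by omega)
    -- The common remainder of the two branches, which differ only in whether `y` has been reversed.
    have step : ∀ s2 : St, s2.v .x = x (s1.v .i) → s2.v .y = y (s1.v .i) → y (s1.v .i) ≤ M →
        s2.v .i = s1.v .i → s2.v .n = n → s2.v .w = M → s2.clk ≤ s1.clk + 5 → s2.a = s1.a →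
        (store .KX (.var .i) (.add (.mul (.add (.mul (.var .x) (.add (.var .w) (.lit 1)))
          (.sub (.var .w) (.var .y))) (.var .n)) (.var .i)) ;;
        store .KY (.var .i) (.add (.mul (.add (.mul (.var .y) (.add (.var .w) (.lit 1)))
          (.sub (.var .w) (.var .x))) (.var .n)) (.sub (.var .n) (.add (.var .i) (.lit 1)))) ;;
        assign .i (.add (.var .i) (.lit 1))).wp B off (fun s2 => (s2.v .i ≤ n ∧
          s2.clk ≤ s.clk + 8 * s2.v .i + 2 ∧ ∀ i < s2.v .i,
          s2.a .KX i = keyX M n (x i) (y i) i ∧ s2.a .KY i = keyY M n (x i) (y i) i) ∧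
          n - s2.v .i < n - s1.v .i) s2 := by
      intro s2 g1 g2 g3 g4 g5 g6 g7 g8
      have k1 := keyX_lt (y := y (s1.v .i)) hxM hi
      have k2 := keyY_lt (x := x (s1.v .i)) g3 hi
      have b1 : x (s1.v .i) * (M + 1) + (M - y (s1.v .i)) < (M + 1) * (M + 1) :=
        mul_add_lt_mul (by omega) (by omega)
      have b2 : y (s1.v .i) * (M + 1) + (M - x (s1.v .i)) < (M + 1) * (M + 1) :=
        mul_add_lt_mul (by omega) (by omega)
      simp only [keyX, keyY] at k1 k2
      simp only [wp_seq_iff, wp_store, wp_assign, ok, eval, true_and, and_true, St.set_v, St.put_v,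
        reduceCtorEq, ↓reduceIte, g1, g2, g4, g5, g6]
      refine ⟨by omega, by omega, by omega, by omega, by omega, ⟨by omega, ?_, fun i hi' => ?_⟩,
        by omega⟩
      · simp only [St.set_clk, St.put_clk]; omega
      · simp only [St.set_a, St.put_a, reduceCtorEq, ↓reduceIte, g8, Function.update_apply]
        split_ifs with h1
        · subst h1
          exact ⟨rfl, rfl⟩
        · exact e3 i (by omega)
    simp only [skip, wp_seq_iff (d := ite _ _ _ _ ;; _), wp_seq_iff (c := ite _ _ _ _),
      wp_seq_iff (d := assign _ _ ;; _), wp_ite, wp_assign, ok, eval, true_and, and_true, St.set_v,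
      St.set_io, St.tick_v, St.tick_io, reduceCtorEq, ↓reduceIte, Nat.zero_le]
    have hyi := hy _ hi
    refine ⟨by omega, by omega, fun h => ?_, fun h => ?_⟩
    · simp only [hfl1] at h
      rw [if_pos h] at hyi
      refine step _ ?_ ?_ (by omega) ?_ ?_ ?_ ?_ ?_
      all_goals simp [hx1, hio1, hyi, hn1, hw1]
    · simp only [hfl1] at h
      rw [if_neg h] at hyi
      refine step _ ?_ ?_ (by omega) ?_ ?_ ?_ ?_ ?_
      all_goals simp [hx1, hio1, hyi, hn1, hw1]
  · obtain hi : s1.v .i = n := by omega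
    rw [hi] at e2 e3
    exact ⟨by simp only [St.tick_clk]; omega, hkm1, e3⟩

end RAM

/-! ### The permutation with sentinels, and its tables -/

/-- The tables of a permutation satisfy their recursions. -/
structure Tables (N : ℕ) (P Q T R S : ℕ → ℕ) : Prop where
  T_zero : T 0 = 0
  R_zero : R 0 = 0
  T_rec : ∀ x, 1 ≤ x → x ≤ N → T x = max (T (x - 1)) (P x)
  R_rec : ∀ x, 1 ≤ x → x ≤ N → R x = max (R (x - 1)) (Q x)
  S_end : S (N + 1) = N + 1
  S_rec : ∀ x, 1 ≤ x → x ≤ N → S x = min (P x) (S (x + 1))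

theorem prefix_max {N : ℕ} {P T : ℕ → ℕ} (h0 : T 0 = 0)
    (hT : ∀ x, 1 ≤ x → x ≤ N → T x = max (T (x - 1)) (P x)) (x : ℕ) (hx : x ≤ N) :
    (∀ v, 1 ≤ v → v ≤ x → P v ≤ T x) ∧ (1 ≤ x → ∃ v, 1 ≤ v ∧ v ≤ x ∧ T x = P v) := by
  induction x with
  | zero => exact ⟨fun v h1 h2 => by omega, fun h => by omega⟩
  | succ x ih =>
    obtain ⟨i1, i2⟩ := ih (by omega)
    have hr := hT (x + 1) (by omega) hx
    rw [Nat.add_sub_cancel] at hr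
    refine ⟨fun v h1 h2 => ?_, fun _ => ?_⟩
    · rcases Nat.eq_or_lt_of_le h2 with rfl | h3
      · omega
      · have := i1 v h1 (by omega)
        omega
    · rcases le_total (T x) (P (x + 1)) with h1 | h1
      · exact ⟨x + 1, by omega, le_rfl, by omega⟩
      · rcases Nat.eq_zero_or_pos x with rfl | h2
        · exact ⟨1, le_rfl, le_rfl, by rw [hr]; exact max_eq_right (by omega)⟩
        · obtain ⟨v, h3, h4, h5⟩ := i2 h2
          exact ⟨v, h3, by omega, by omega⟩

theorem suffix_min {N : ℕ} {P S : ℕ → ℕ} (h0 : S (N + 1) = N + 1)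
    (hP : ∀ x, 1 ≤ x → x ≤ N → P x ≤ N)
    (hS : ∀ x, 1 ≤ x → x ≤ N → S x = min (P x) (S (x + 1))) (x : ℕ) (h1 : 1 ≤ x) (hx : x ≤ N) :
    (∀ v, x ≤ v → v ≤ N → S x ≤ P v) ∧ ∃ v, x ≤ v ∧ v ≤ N ∧ P v = S x := by
  induction hx using Nat.decreasingInduction with
  | self =>
    have hr := hS N h1 le_rfl
    have := hP N h1 le_rfl
    refine ⟨fun v h2 h3 => ?_, N, le_rfl, le_rfl, by omega⟩
    obtain rfl : v = N := by omega
    omega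
  | @of_succ x hx ih =>
    obtain ⟨i1, v, i2, i3, i4⟩ := ih (by omega)
    have hr := hS x h1 hx.le
    refine ⟨fun v h2 h3 => ?_, ?_⟩
    · rcases Nat.eq_or_lt_of_le h2 with rfl | h4
      · omega
      · have := i1 v h4 h3
        omega
    · rcases le_total (P x) (S (x + 1)) with h2 | h2
      · exact ⟨x, le_rfl, hx.le, by omega⟩
      · exact ⟨v, by omega, i3, by omega⟩

theorem Tables.permData {N : ℕ} {P Q T R S : ℕ → ℕ} (t : Tables N P Q T R S) (hN : 2 ≤ N)
    (hP : ∀ v, 1 ≤ v → v ≤ N → 1 ≤ P v ∧ P v ≤ N) (hQ : ∀ v, 1 ≤ v → v ≤ N → 1 ≤ Q v ∧ Q v ≤ N)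
    (PQ : ∀ v, 1 ≤ v → v ≤ N → P (Q v) = v) (QP : ∀ v, 1 ≤ v → v ≤ N → Q (P v) = v)
    (h1 : P 1 = 1) (h2 : P N = N) : PermData N P Q T R S where
  two_le := hN
  P_mem := hP
  Q_mem := hQ
  PQ := PQ
  QP := QP
  P_one := h1
  P_last := h2
  T_ge v x hv hvx hx := (prefix_max t.T_zero t.T_rec x hx).1 v hv hvx
  T_at x hx hxN := by
    obtain ⟨v, g1, g2, g3⟩ := (prefix_max t.T_zero t.T_rec x hxN).2 hx
    rw [g3, QP v g1 (by omega)]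
    have := hP v g1 (by omega)
    omega
  R_ge v y hv hvN hy hle := by
    have := (prefix_max t.R_zero t.R_rec y hy).1 (P v) (hP v hv hvN).1 hle
    rwa [QP v hv hvN] at this
  R_at y hy hyN := by
    obtain ⟨v, g1, g2, g3⟩ := (prefix_max t.R_zero t.R_rec y hyN).2 hy
    rw [g3, PQ v g1 (by omega)]
    have := hQ v g1 (by omega)
    omega
  S_le x v hx hxv hv := (suffix_min t.S_end (fun x h h' => (hP x h h').2) t.S_rec x hx
    (by omega)).1 v hxv hv
  S_at x hx hxN := (suffix_min t.S_end (fun x h h' => (hP x h h').2) t.S_rec x hx hxN).2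
  S_end := t.S_end

namespace RAM

open RAM.Cmd RAM.Expr

variable {B off : ℕ}

/-- The permutation and its inverse, from the two orders. -/
def makePerm : Cmd :=
  assign .i (.lit 0) ;;
  .loop (.var .i) (.var .n)
    (store .RY (.arr .OY (.var .i)) (.add (.var .i) (.lit 2)) ;;
      assign .i (.add (.var .i) (.lit 1))) ;;
  assign .i (.lit 0) ;;
  .loop (.var .i) (.var .n)
    (assign .y (.arr .RY (.arr .OX (.var .i))) ;;
      store .P (.add (.var .i) (.lit 2)) (.var .y) ;;
      store .Q (.var .y) (.add (.var .i) (.lit 2)) ;;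
      assign .i (.add (.var .i) (.lit 1))) ;;
  store .P (.lit 1) (.lit 1) ;; store .Q (.lit 1) (.lit 1) ;;
  store .P (.var .m) (.var .m) ;; store .Q (.var .m) (.var .m)

/-- Position `i` of an order becomes point `i + 2`; points 1 and `n + 2` are fixed sentinels at the
lower left and the upper right. -/
theorem wp_makePerm {n : ℕ} {s : St} (hn : s.v .n = n) (hm : s.v .m = n + 2) {OX OY : ℕ → ℕ}
    (hOX : s.a .OX = OX) (hOY : s.a .OY = OY)
    (hX : ((List.range n).map OX).Perm (List.range n))
    (hY : ((List.range n).map OY).Perm (List.range n))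
    (hB : off + 16 * (n + 5) ≤ B) :
    makePerm.wp B off (fun s' => s'.clk ≤ s.clk + 8 * n + 8 ∧
      (∀ i < n, ∃ j < n, s'.a .P (i + 2) = j + 2 ∧ OX i = OY j) ∧
      (∀ j < n, ∃ i < n, s'.a .Q (j + 2) = i + 2 ∧ s'.a .P (i + 2) = j + 2) ∧
      (∀ i < n, s'.a .Q (s'.a .P (i + 2)) = i + 2) ∧
      s'.a .P 1 = 1 ∧ s'.a .Q 1 = 1 ∧ s'.a .P (n + 2) = n + 2 ∧ s'.a .Q (n + 2) = n + 2) s := by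
  have surj : ∀ O : ℕ → ℕ, ((List.range n).map O).Perm (List.range n) →
      (∀ i < n, O i < n) ∧ (∀ j < n, ∃ i < n, O i = j) ∧
        ∀ i < n, ∀ i' < n, O i = O i' → i = i' := by
    intro O hO
    refine ⟨fun i hi => ?_, fun j hj => ?_, fun i hi i' hi' he => ?_⟩
    · have := (hO.mem_iff (a := O i)).1 (List.mem_map_of_mem (List.mem_range.2 hi))
      simpa using this
    · have := (hO.mem_iff (a := j)).2 (List.mem_range.2 hj)
      simpa using this
    · have := hO.nodup_iff.2 List.nodup_range
      exact List.inj_on_of_nodup_map this (List.mem_range.2 hi) (List.mem_range.2 hi') he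
  obtain ⟨X1, X2, X3⟩ := surj OX hX
  obtain ⟨Y1, Y2, Y3⟩ := surj OY hY
  simp only [makePerm, wp_seq_iff, wp_assign, ok, eval, Nat.zero_le, true_and]
  refine wp_while_frame (fun s' => s'.v .i ≤ n ∧ s'.clk ≤ s.clk + 3 * s'.v .i + 1 ∧
    ∀ j < s'.v .i, s'.a .RY (OY j) = j + 2) (fun s' => n - s'.v .i)
    ⟨by simp, by simp, by simp⟩ ?_
  rintro s1 ⟨e1, e2, e3⟩ ⟨f1, f2, -⟩
  have hn1 : s1.v .n = n := by rw [f1 .n rfl]; simp [hn]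
  have hm1 : s1.v .m = n + 2 := by rw [f1 .m rfl]; simp [hm]
  have hX1 : s1.a .OX = OX := by rw [f2 .OX rfl]; simp [hOX]
  have hY1 : s1.a .OY = OY := by rw [f2 .OY rfl]; simp [hOY]
  simp only [ok, eval, true_and, hn1]
  refine ⟨fun hi => ?_, fun hi => ?_⟩
  · have := Y1 _ hi
    simp only [wp_seq_iff, wp_store, wp_assign, ok, eval, true_and, and_true, St.set_v, St.put_v,
      St.tick_v, St.tick_a, St.put_a, St.set_a, reduceCtorEq, ↓reduceIte, hY1]
    repeat refine ⟨by omega, ?_⟩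
    refine ⟨⟨by omega, ?_, fun j hj => ?_⟩, by omega⟩
    · simp only [St.set_clk, St.put_clk, St.tick_clk]; omega
    · rw [Function.update_apply]
      split_ifs with h
      · rw [Y3 j (by omega) _ hi h]
      · refine e3 j ?_
        rcases Nat.lt_succ_iff_lt_or_eq.1 hj with h1 | rfl
        · exact h1
        · exact absurd rfl h
  have hi' : s1.v .i = n := by omega
  rw [hi'] at e2 e3
  have hRY : ∀ i < n, ∃ j < n, s1.a .RY (OX i) = j + 2 ∧ OX i = OY j := by
    intro i hi
    obtain ⟨j, hj, he⟩ := Y2 _ (X1 i hi)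
    exact ⟨j, hj, by rw [← he]; exact e3 j hj, he.symm⟩
  -- Injectivity ensures that no earlier entry of `Q` is overwritten.
  have hinj : ∀ i < n, ∀ i' < n, s1.a .RY (OX i) = s1.a .RY (OX i') → i = i' := by
    intro i hi i' hi' he
    obtain ⟨j, hj, g1, g2⟩ := hRY i hi
    obtain ⟨j', hj', g3, g4⟩ := hRY i' hi'
    obtain rfl : j = j' := by omega
    exact X3 i hi i' hi' (g2.trans g4.symm)
  simp only [wp_seq_iff, wp_assign, ok, eval, Nat.zero_le, true_and]
  refine wp_while_frame (fun s' => s'.v .i ≤ n ∧ s'.clk ≤ s.clk + 3 * n + 5 * s'.v .i + 3 ∧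
    ∀ i < s'.v .i, s'.a .P (i + 2) = s1.a .RY (OX i) ∧ s'.a .Q (s1.a .RY (OX i)) = i + 2)
    (fun s' => n - s'.v .i) ⟨by simp, by simp; omega, by simp⟩ ?_
  rintro s2 ⟨g1, g2, g3⟩ ⟨h1, h2, -⟩
  have hn2 : s2.v .n = n := by rw [h1 .n rfl]; simp [hn1]
  have hm2 : s2.v .m = n + 2 := by rw [h1 .m rfl]; simp [hm1]
  have hX2 : s2.a .OX = OX := by rw [h2 .OX rfl]; simp [hX1]
  have hR2 : s2.a .RY = s1.a .RY := by rw [h2 .RY rfl]; simp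
  simp only [ok, eval, true_and, hn2]
  refine ⟨fun hi => ?_, fun hi => ?_⟩
  · have := X1 _ hi
    obtain ⟨j, hj, k1, k2⟩ := hRY _ hi
    simp only [wp_seq_iff, wp_store, wp_assign, ok, eval, true_and, and_true, St.set_v, St.put_v,
      St.tick_v, St.tick_a, St.put_a, St.set_a, reduceCtorEq, ↓reduceIte, hX2, hR2]
    repeat refine ⟨by omega, ?_⟩
    refine ⟨⟨by omega, ?_, fun i hi' => ?_⟩, by omega⟩
    · simp only [St.set_clk, St.put_clk, St.tick_clk]; omega
    · rcases Nat.lt_succ_iff_lt_or_eq.1 hi' with h3 | rfl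
      · have h4 := g3 i h3
        rw [Function.update_of_ne (by omega), Function.update_of_ne]
        · exact h4
        · intro he
          have := hinj i (by omega) _ hi he
          omega
      · simp
  · have hi2 : s2.v .i = n := by omega
    rw [hi2] at g2 g3
    simp only [wp_seq_iff, wp_store, wp_assign, ok, eval, true_and, and_true, St.set_v, St.put_v,
      St.tick_v, St.tick_a, St.put_a, St.set_a, reduceCtorEq, ↓reduceIte, hm2, St.put_clk,
      St.tick_clk]
    have hP : ∀ i < n, Function.update (Function.update (s2.a .P) 1 1) (n + 2) (n + 2) (i + 2) =
        s1.a .RY (OX i) := fun i hi => by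
      rw [Function.update_of_ne (by omega), Function.update_of_ne (by omega)]
      exact (g3 i hi).1
    have hQ : ∀ j < n, Function.update (Function.update (s2.a .Q) 1 1) (n + 2) (n + 2) (j + 2) =
        s2.a .Q (j + 2) := fun j hj => by
      rw [Function.update_of_ne (by omega), Function.update_of_ne (by omega)]
    repeat refine ⟨by omega, ?_⟩
    refine ⟨fun i hi => ?_, fun j hj => ?_, fun i hi => ?_, by simp, by simp, by simp, by simp⟩
    · rw [hP i hi]; exact hRY i hi
    · obtain ⟨i, hi, he⟩ := X2 _ (Y1 j hj)
      obtain ⟨j', hj', k1, k2⟩ := hRY i hi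
      obtain rfl : j = j' := Y3 j hj j' hj' (he.symm.trans k2)
      refine ⟨i, hi, ?_, ?_⟩
      · rw [hQ j hj, ← k1]; exact (g3 i hi).2
      · rw [hP i hi, k1]
    · obtain ⟨j', hj', k1, k2⟩ := hRY i hi
      rw [hP i hi, k1, hQ j' hj', ← k1]
      exact (g3 i hi).2

/-- The prefix maxima of `P` and of `Q`, and the suffix minima of `P`. -/
def makeTables : Cmd :=
  assign .x (.lit 1) ;;
  .loop (.var .x) (.add (.var .m) (.lit 1))
    (ite (.arr .T (.sub (.var .x) (.lit 1))) (.arr .P (.var .x))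
        (store .T (.var .x) (.arr .P (.var .x)))
        (store .T (.var .x) (.arr .T (.sub (.var .x) (.lit 1)))) ;;
      ite (.arr .R (.sub (.var .x) (.lit 1))) (.arr .Q (.var .x))
        (store .R (.var .x) (.arr .Q (.var .x)))
        (store .R (.var .x) (.arr .R (.sub (.var .x) (.lit 1)))) ;;
      assign .x (.add (.var .x) (.lit 1))) ;;
  store .S (.add (.var .m) (.lit 1)) (.add (.var .m) (.lit 1)) ;;
  assign .x (.var .m) ;;
  .loop (.lit 0) (.var .x)
    (ite (.arr .P (.var .x)) (.arr .S (.add (.var .x) (.lit 1)))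
        (store .S (.var .x) (.arr .P (.var .x)))
        (store .S (.var .x) (.arr .S (.add (.var .x) (.lit 1)))) ;;
      assign .x (.sub (.var .x) (.lit 1)))

theorem wp_makeTables {N : ℕ} {s : St} (hm : s.v .m = N) (hT : s.a .T 0 = 0) (hR : s.a .R 0 = 0)
    (hB : off + 16 * (N + 5) ≤ B) :
    makeTables.wp B off (fun s' => s'.clk ≤ s.clk + 10 * N + 8 ∧
      Tables N (s.a .P) (s.a .Q) (s'.a .T) (s'.a .R) (s'.a .S)) s := by
  simp only [makeTables, wp_seq_iff, wp_assign, ok, eval, Nat.zero_le, true_and]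
  refine ⟨by omega, ?_⟩
  refine wp_while_frame (fun s' => (1 ≤ s'.v .x ∧ s'.v .x ≤ N + 1) ∧
    s'.clk + 5 ≤ s.clk + 6 * s'.v .x ∧ s'.a .T 0 = 0 ∧ s'.a .R 0 = 0 ∧
    ∀ x, 1 ≤ x → x < s'.v .x → s'.a .T x = max (s'.a .T (x - 1)) (s.a .P x) ∧
      s'.a .R x = max (s'.a .R (x - 1)) (s.a .Q x)) (fun s' => N + 1 - s'.v .x)
    ⟨by simp, by simp, by simp [hT], by simp [hR], fun x h1 h2 => by simp at h2; omega⟩ ?_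
  rintro s1 ⟨⟨e0, e1⟩, e2, e3, e4, e5⟩ ⟨f1, f2, -⟩
  have hm1 : s1.v .m = N := by rw [f1 .m rfl]; simp [hm]
  have hP1 : s1.a .P = s.a .P := by rw [f2 .P rfl]; simp
  have hQ1 : s1.a .Q = s.a .Q := by rw [f2 .Q rfl]; simp
  simp only [ok, eval, true_and, hm1]
  refine ⟨by omega, fun hi => ?_, fun hi => ?_⟩
  · simp only [wp_seq_iff, wp_store, wp_assign, wp_ite, ok, eval, true_and, and_true, St.set_v,
      St.put_v, St.tick_v, St.tick_a, St.put_a, St.set_a, reduceCtorEq, ↓reduceIte, hP1, hQ1]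
    have key : ∀ (U V W : ℕ → ℕ) (a : ℕ), W = Function.update U (s1.v .x) a →
        a = max (U (s1.v .x - 1)) (V (s1.v .x)) → U 0 = 0 →
        (∀ x, 1 ≤ x → x < s1.v .x → U x = max (U (x - 1)) (V x)) →
        W 0 = 0 ∧ ∀ x, 1 ≤ x → x < s1.v .x + 1 → W x = max (W (x - 1)) (V x) := by
      rintro U V W a rfl ha h0 hU
      refine ⟨by rw [Function.update_of_ne (by omega)]; exact h0, fun x h1 h2 => ?_⟩
      rw [Function.update_of_ne (a := x - 1) (by omega)]
      rcases Nat.lt_succ_iff_lt_or_eq.1 h2 with h3 | rfl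
      · rw [Function.update_of_ne (by omega)]; exact hU x h1 h3
      · rw [Function.update_self]; exact ha
    have fin : ∀ a b, a = max (s1.a .T (s1.v .x - 1)) (s.a .P (s1.v .x)) →
        b = max (s1.a .R (s1.v .x - 1)) (s.a .Q (s1.v .x)) →
        Function.update (s1.a .T) (s1.v .x) a 0 = 0 ∧ Function.update (s1.a .R) (s1.v .x) b 0 = 0 ∧
        ∀ x, 1 ≤ x → x < s1.v .x + 1 →
          Function.update (s1.a .T) (s1.v .x) a x =
            max (Function.update (s1.a .T) (s1.v .x) a (x - 1)) (s.a .P x) ∧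
          Function.update (s1.a .R) (s1.v .x) b x =
            max (Function.update (s1.a .R) (s1.v .x) b (x - 1)) (s.a .Q x) := by
      intro a b ha hb
      obtain ⟨a1, a2⟩ := key _ _ _ a rfl ha e3 fun x h1 h2 => (e5 x h1 h2).1
      obtain ⟨b1, b2⟩ := key _ _ _ b rfl hb e4 fun x h1 h2 => (e5 x h1 h2).2
      exact ⟨a1, b1, fun x h1 h2 => ⟨a2 x h1 h2, b2 x h1 h2⟩⟩
    refine ⟨by omega, by omega, fun h1 => ⟨by omega, by omega, by omega, by omega,
      fun h2 => ⟨by omega, by omega, by omega, ⟨by omega, ?_, ?_⟩, by omega⟩,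
      fun h2 => ⟨by omega, by omega, by omega, ⟨by omega, ?_, ?_⟩, by omega⟩⟩,
      fun h1 => ⟨by omega, by omega, by omega, by omega,
      fun h2 => ⟨by omega, by omega, by omega, ⟨by omega, ?_, ?_⟩, by omega⟩,
      fun h2 => ⟨by omega, by omega, by omega, ⟨by omega, ?_, ?_⟩, by omega⟩⟩⟩
    all_goals first
      | (simp only [St.set_clk, St.put_clk, St.tick_clk]; omega)
      | exact fin _ _ (by omega) (by omega)
  have hx1 : s1.v .x = N + 1 := by omega
  rw [hx1] at e5 e2
  simp only [wp_seq_iff, wp_store, wp_assign, ok, eval, true_and, and_true, St.set_v, St.put_v,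
    St.tick_v, St.tick_a, St.put_a, St.set_a, reduceCtorEq, ↓reduceIte, hm1]
  refine ⟨by omega, by omega, by omega, ?_⟩
  refine wp_while_frame (fun s' => s'.v .x ≤ N ∧ s'.clk + 4 * s'.v .x ≤ s.clk + 10 * N + 6 ∧
    s'.a .S (N + 1) = N + 1 ∧
    ∀ x, s'.v .x < x → x ≤ N → s'.a .S x = min (s.a .P x) (s'.a .S (x + 1))) (fun s' => s'.v .x)
    ⟨by simp, by simp; omega, by simp, fun x h1 h2 => by simp at h1; omega⟩ ?_
  rintro s2 ⟨g1, g2, g3, g4⟩ ⟨h1, h2, -⟩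
  have hP2 : s2.a .P = s.a .P := by rw [h2 .P rfl]; simp [hP1]
  have hT2 : s2.a .T = s1.a .T := by rw [h2 .T rfl]; simp
  have hR2 : s2.a .R = s1.a .R := by rw [h2 .R rfl]; simp
  simp only [ok, eval, true_and, Nat.zero_le]
  refine ⟨fun hi => ?_, fun hi => ⟨by simp only [St.tick_clk]; omega, ?_⟩⟩
  · simp only [wp_seq_iff, wp_store, wp_assign, wp_ite, ok, eval, true_and, and_true, St.set_v,
      St.put_v, St.tick_v, St.tick_a, St.put_a, St.set_a, reduceCtorEq, ↓reduceIte, hP2]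
    have key : ∀ a, a = min (s.a .P (s2.v .x)) (s2.a .S (s2.v .x + 1)) →
        Function.update (s2.a .S) (s2.v .x) a (N + 1) = N + 1 ∧ ∀ x, s2.v .x - 1 < x → x ≤ N →
        Function.update (s2.a .S) (s2.v .x) a x =
          min (s.a .P x) (Function.update (s2.a .S) (s2.v .x) a (x + 1)) := by
      intro a ha
      refine ⟨by rw [Function.update_of_ne (by omega)]; exact g3, fun x k1 k2 => ?_⟩
      rw [Function.update_of_ne (a := x + 1) (by omega)]
      rcases Nat.eq_or_lt_of_le (show s2.v .x ≤ x by omega) with rfl | k3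
      · rw [Function.update_self]; exact ha
      · rw [Function.update_of_ne (by omega)]; exact g4 x k3 k2
    refine ⟨by omega, by omega, fun k1 => ⟨by omega, by omega, by omega, ⟨by omega, ?_, ?_⟩,
      by omega⟩, fun k1 => ⟨by omega, by omega, by omega, ⟨by omega, ?_, ?_⟩, by omega⟩⟩
    all_goals first
      | (simp only [St.set_clk, St.put_clk, St.tick_clk]; omega)
      | exact key _ (by omega)
  · refine ⟨?_, ?_, fun x k1 k2 => ?_, fun x k1 k2 => ?_, g3, fun x k1 k2 => g4 x (by omega) k2⟩ <;>
      simp only [St.tick_a, hT2, hR2]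
    · exact e3
    · exact e4
    · exact (e5 x k1 (by omega)).1
    · exact (e5 x k1 (by omega)).2

end RAM

/-! ### From frontiers in the last column to minimum dominating sets -/

/-- `out` lists, without repetitions, a smallest dominating set of the graph with vertices below
`n` and adjacency `adj`. -/
def Solves (n : ℕ) (adj : ℕ → ℕ → Prop) (out : List ℕ) : Prop :=
  out.Nodup ∧ (∀ a ∈ out, a < n) ∧ (∀ i < n, i ∉ out → ∃ j ∈ out, adj i j) ∧
    ∀ E : Finset ℕ, (∀ a ∈ E, a < n) → (∀ i < n, i ∉ E → ∃ j ∈ E, adj i j) → out.length ≤ E.card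

/-- A frontier in the last column leaves nothing undominated. The sentinels form no inversions, so
removing them from the witness list keeps all proper points dominated, and a lower bound on the cost
transfers to dominating sets of the graph. -/
theorem solves_of_sound {n c Y : ℕ} {P Q T R S : ℕ → ℕ} {L : List ℕ} {O : ℕ → ℕ}
    {adj : ℕ → ℕ → Prop} (h : PermData (n + 2) P Q T R S)
    (hO : ((List.range n).map O).Perm (List.range n))
    (hadj : ∀ i j, i < n → j < n → i ≠ j → (Covers P (j + 2) (i + 2) ↔ adj (O i) (O j)))
    (hL : Sound (n + 2) P T R c L (n + 2) Y)
    (hc : ∀ c' < c, ∀ Y, ¬ Reach (n + 2) P T R c' (n + 2) Y) :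
    Solves n adj ((L.filter fun v => 1 < v ∧ v < n + 2).map fun v => O (v - 2)) := by
  obtain ⟨hlen, hgood, -⟩ := hL
  have O1 : ∀ i < n, O i < n := fun i hi => by
    have := (hO.mem_iff (a := O i)).1 (List.mem_map_of_mem (List.mem_range.2 hi))
    simpa using this
  have O2 : ∀ j < n, ∃ i < n, O i = j := fun j hj => by
    have := (hO.mem_iff (a := j)).2 (List.mem_range.2 hj)
    simpa using this
  have O3 : ∀ i < n, ∀ i' < n, O i = O i' → i = i' := fun i hi i' hi' he =>
    List.inj_on_of_nodup_map (hO.nodup_iff.2 List.nodup_range) (List.mem_range.2 hi)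
      (List.mem_range.2 hi') he
  have hone : ∀ v, 1 < v → v ≤ n + 2 → ¬ Covers P 1 v := by
    rintro v h1 h2 (⟨-, h3⟩ | ⟨h3, -⟩)
    · have := h.one_lt_P h1 h2
      rw [h.P_one] at h3
      omega
    · omega
  have hlast : ∀ v, 1 < v → v ≤ n + 2 → (Covers P (n + 2) v ∨ Covers P v (n + 2)) →
      v = n + 2 := by
    intro v h1 h2 h3
    have h4 := h.P_mem v h1.le h2
    have h5 := h.P_last
    refine h.inj h1.le h2 (by omega) le_rfl ?_
    rcases h3 with (⟨h6, h7⟩ | ⟨h6, h7⟩) | (⟨h6, h7⟩ | ⟨h6, h7⟩)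
    · obtain rfl : v = n + 2 := by omega
      rfl
    · omega
    · omega
    · obtain rfl : v = n + 2 := by omega
      rfl
  have hcov : ∀ v, 1 < v → v ≤ n + 2 → ∃ d ∈ L, 1 < d ∧ d ≤ n + 2 ∧ Covers P d v := by
    intro v h1 h2
    obtain ⟨d, hd, h3, h4, h5⟩ := hgood v h1 h2 (by omega)
    refine ⟨d, hd, ?_, h4, h5⟩
    rcases Nat.eq_or_lt_of_le h3 with rfl | h6
    · exact absurd h5 (hone v h1 h2)
    · exact h6
  have hdom : ∀ i < n, i ∉ (L.filter fun v => 1 < v ∧ v < n + 2).map (fun v => O (v - 2)) →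
      ∃ j ∈ (L.filter fun v => 1 < v ∧ v < n + 2).map (fun v => O (v - 2)), adj i j := by
    intro i hi hni
    obtain ⟨i', hi', rfl⟩ := O2 i hi
    obtain ⟨d, hd, h1, h2, h3⟩ := hcov (i' + 2) (by omega) (by omega)
    have h4 : d < n + 2 := by
      refine lt_of_le_of_ne h2 ?_
      rintro rfl
      have := hlast (i' + 2) (by omega) (by omega) (Or.inl h3)
      omega
    have hmem : O (d - 2) ∈ (L.filter fun v => 1 < v ∧ v < n + 2).map (fun v => O (v - 2)) :=
      List.mem_map.2 ⟨d, List.mem_filter.2 ⟨hd, by simp [h1, h4]⟩, rfl⟩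
    obtain ⟨d', rfl⟩ : ∃ d', d = d' + 2 := ⟨d - 2, by omega⟩
    rw [Nat.add_sub_cancel] at hmem
    refine ⟨_, hmem, (hadj i' d' hi' (by omega) ?_).1 h3⟩
    rintro rfl
    exact hni hmem
  have hlt : ∀ a ∈ (L.filter fun v => 1 < v ∧ v < n + 2).map (fun v => O (v - 2)), a < n := by
    intro a ha
    obtain ⟨v, hv, rfl⟩ := List.mem_map.1 ha
    have := (List.mem_filter.1 hv).2
    simp only [decide_eq_true_eq] at this
    exact O1 _ (by omega)
  -- The last sentinel is dominated only by itself, so it occurs in `L` and the filter removes at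
  -- least one entry.
  have hlen' : ((L.filter fun v => 1 < v ∧ v < n + 2).map (fun v => O (v - 2))).length < c := by
    obtain ⟨d, hd, h1, h2, h3⟩ := hcov (n + 2) (by omega) le_rfl
    obtain rfl := hlast d h1 h2 (Or.inr h3)
    rw [List.length_map]
    refine lt_of_lt_of_le ?_ hlen
    refine List.length_filter_lt_length_iff_exists.2 ⟨_, hd, by simp⟩
  have hmin : ∀ E : Finset ℕ, (∀ a ∈ E, a < n) → (∀ i < n, i ∉ E → ∃ j ∈ E, adj i j) →
      ((L.filter fun v => 1 < v ∧ v < n + 2).map (fun v => O (v - 2))).length ≤ E.card := by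
    intro E hE hE'
    let E1 := (Finset.Ioo 1 (n + 2)).filter fun v => O (v - 2) ∈ E
    have c1 : E1.card ≤ E.card := by
      refine Finset.card_le_card_of_injOn (fun v => O (v - 2)) ?_ ?_
      · intro v hv
        exact (Finset.mem_filter.1 hv).2
      · intro v hv w hw he
        have h1 := Finset.mem_Ioo.1 (Finset.mem_filter.1 hv).1
        have h2 := Finset.mem_Ioo.1 (Finset.mem_filter.1 hw).1
        have := O3 _ (by omega) _ (by omega) he
        omega
    have c2 : (insert (n + 2) E1).card ≤ E.card + 1 := (Finset.card_insert_le _ _).trans (by omega)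
    have hD : ∀ d ∈ insert (n + 2) E1, 1 < d ∧ d ≤ n + 2 := by
      intro d hd
      rcases Finset.mem_insert.1 hd with rfl | hd
      · omega
      · have := Finset.mem_Ioo.1 (Finset.mem_filter.1 hd).1
        omega
    have hF : Front P (insert (n + 2) E1) (n + 2) (n + 2) := by
      refine ⟨fun d hd => ?_, Or.inr (by simp), Or.inr ⟨n + 2, by simp, h.P_last⟩⟩
      have := hD d hd
      exact ⟨this.2, (h.P_mem d this.1.le this.2).2⟩
    have hG : Good (n + 2) P {d | d ∈ insert (n + 2) E1} (n + 2) (n + 2) := by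
      intro v h1 h2 _
      rcases Nat.eq_or_lt_of_le h2 with rfl | h3
      · exact ⟨n + 2, by simp, by omega, le_rfl, Or.inl ⟨le_rfl, le_rfl⟩⟩
      · obtain ⟨v', rfl⟩ : ∃ v', v = v' + 2 := ⟨v - 2, by omega⟩
        by_cases hv : O v' ∈ E
        · refine ⟨v' + 2, ?_, by omega, by omega, Or.inl ⟨le_rfl, le_rfl⟩⟩
          exact Finset.mem_insert_of_mem (Finset.mem_filter.2 ⟨Finset.mem_Ioo.2 ⟨h1, h3⟩, hv⟩)
        · obtain ⟨j, hj, h4⟩ := hE' _ (O1 v' (by omega)) hv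
          obtain ⟨j', hj', rfl⟩ := O2 j (hE j hj)
          refine ⟨j' + 2, ?_, by omega, by omega,
            (hadj v' j' (by omega) hj' (by rintro rfl; exact hv hj)).2 h4⟩
          have h5 : 1 < j' + 2 ∧ j' + 2 < n + 2 := by omega
          exact Finset.mem_insert_of_mem (Finset.mem_filter.2 ⟨Finset.mem_Ioo.2 h5, hj⟩)
    -- A competing dominating set together with the last sentinel has front `(n + 2, n + 2)`. This
    -- gives a frontier in the last column of cost at most `E.card + 1`, which `hc` bounds below by
    -- `c`.
    obtain ⟨c', hc', X', Y', hX', hY', hr⟩ := h.exists_reach _ hD hF hG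
    have hi := h.inner_of_reach hr
    obtain rfl : X' = n + 2 := le_antisymm hi.2.1 hX'
    have : ¬ c' < c := fun hlt => hc c' hlt _ hr
    omega
  refine ⟨?_, hlt, hdom, hmin⟩
  -- The set of listed vertices is itself dominating. By minimality the list is no longer than its
  -- deduplication, so it has no repetitions.
  have := hmin (List.toFinset _) (fun a ha => hlt a (List.mem_toFinset.1 ha)) (fun i hi hni => by
    obtain ⟨j, hj, h1⟩ := hdom i hi (by rwa [← List.mem_toFinset])
    exact ⟨j, List.mem_toFinset.2 hj, h1⟩)
  rw [List.card_toFinset] at this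
  exact List.dedup_eq_self.1 ((List.dedup_sublist _).eq_of_length_le this)

/-! ### Sorting keys and inversions -/

namespace RAM

/-- The order of the first sorting keys is inverted by the second ones if and only if the corners
are not strictly comparable. -/
theorem keyY_lt_iff {M n : ℕ} {x y x' y' i j : ℕ} (hx : x ≤ M) (hy : y ≤ M) (hx' : x' ≤ M)
    (hy' : y' ≤ M) (hi : i < n) (hj : j < n) (hk : keyX M n x y i < keyX M n x' y' j) :
    keyY M n x' y' j < keyY M n x y i ↔ ¬ (x < x' ∧ y < y') := by
  have lex : ∀ {a b m i j : ℕ}, a < b → i < m → a * m + i < b * m + j := fun h1 h2 =>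
    (mul_add_lt_mul h1 h2).trans_le (Nat.le_add_right _ _)
  simp only [keyX, keyY] at *
  constructor
  · rintro h1 ⟨h2, h3⟩
    have : (y * (M + 1) + (M - x)) * n + (n - (i + 1)) <
        (y' * (M + 1) + (M - x')) * n + (n - (j + 1)) := lex (lex h3 (by omega)) (by omega)
    omega
  · intro h1
    rcases lt_trichotomy x x' with h2 | rfl | h2
    · rcases lt_trichotomy y y' with h3 | rfl | h3
      · exact absurd ⟨h2, h3⟩ h1
      · exact lex (by omega) (by omega)
      · exact lex (lex h3 (by omega)) (by omega)
    · rcases lt_trichotomy y y' with h3 | rfl | h3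
      · have : (x * (M + 1) + (M - y')) * n + j < (x * (M + 1) + (M - y)) * n + i :=
          lex (by omega) hj
        omega
      · omega
      · exact lex (lex h3 (by omega)) (by omega)
    · have : (x' * (M + 1) + (M - y')) * n + j < (x * (M + 1) + (M - y)) * n + i :=
        lex (lex h2 (by omega)) hj
      omega

/-- The index is the last digit of the key, recovered modulo `n`. -/
theorem keyX_inj {M n : ℕ} {x y x' y' i j : ℕ} (hi : i < n) (hj : j < n)
    (hk : keyX M n x y i = keyX M n x' y' j) : i = j := by
  have := congrArg (· % n) hk
  simpa [keyX, Nat.mul_add_mod', Nat.mod_eq_of_lt hi, Nat.mod_eq_of_lt hj] using this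

theorem keyY_inj {M n : ℕ} {x y x' y' i j : ℕ} (hi : i < n) (hj : j < n)
    (hk : keyY M n x y i = keyY M n x' y' j) : i = j := by
  have := congrArg (· % n) hk
  simp only [keyY, Nat.mul_add_mod', Nat.mod_eq_of_lt (show n - (i + 1) < n by omega),
    Nat.mod_eq_of_lt (show n - (j + 1) < n by omega)] at this
  omega

end RAM

theorem pairwise_map_range {n : ℕ} {O : ℕ → ℕ} {r : ℕ → ℕ → Prop}
    (h : ((List.range n).map O).Pairwise r) {i j : ℕ} (hij : i < j) (hj : j < n) :
    r (O i) (O j) := by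
  have := List.pairwise_iff_getElem.1 h i j (by simp; omega) (by simpa using hj) hij
  simpa using this

/-- Inversions of the permutation that arises from two orders are inversions of the orders. -/
theorem covers_iff_of_sorted {n : ℕ} {OX OY KX KY P : ℕ → ℕ}
    (hX : ((List.range n).map OX).Perm (List.range n))
    (sX : ((List.range n).map OX).Pairwise fun i j => KX i ≤ KX j)
    (sY : ((List.range n).map OY).Pairwise fun i j => KY i ≤ KY j)
    (iX : ∀ i < n, ∀ j < n, KX i = KX j → i = j) (iY : ∀ i < n, ∀ j < n, KY i = KY j → i = j)
    (hP : ∀ i < n, ∃ j < n, P (i + 2) = j + 2 ∧ OX i = OY j) {i j : ℕ} (hi : i < n) (hj : j < n)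
    (hij : i ≠ j) : Covers P (j + 2) (i + 2) ↔
      (KX (OX i) < KX (OX j) ∧ KY (OX j) < KY (OX i) ∨
        KX (OX j) < KX (OX i) ∧ KY (OX i) < KY (OX j)) := by
  have O1 : ∀ i < n, OX i < n := fun i hi => by
    have := (hX.mem_iff (a := OX i)).1 (List.mem_map_of_mem (List.mem_range.2 hi))
    simpa using this
  have O3 : ∀ i < n, ∀ j < n, OX i = OX j → i = j := fun i hi i' hi' he =>
    List.inj_on_of_nodup_map (hX.nodup_iff.2 List.nodup_range) (List.mem_range.2 hi)
      (List.mem_range.2 hi') he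
  have key : ∀ i j, i < j → j < n → (P (j + 2) ≤ P (i + 2) ↔
      (KX (OX i) < KX (OX j) ∧ KY (OX j) < KY (OX i) ∨
        KX (OX j) < KX (OX i) ∧ KY (OX i) < KY (OX j))) := by
    intro i j hij hj
    have hi : i < n := by omega
    have h1 := pairwise_map_range sX hij hj
    have hne : OX i ≠ OX j := fun e => by have := O3 i hi j hj e; omega
    have h2 : KX (OX i) ≠ KX (OX j) := fun e => hne (iX _ (O1 i hi) _ (O1 j hj) e)
    have h3 : KY (OX i) ≠ KY (OX j) := fun e => hne (iY _ (O1 i hi) _ (O1 j hj) e)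
    obtain ⟨i', hi', g1, g2⟩ := hP i hi
    obtain ⟨j', hj', g3, g4⟩ := hP j hj
    rw [g1, g3]
    rw [g2, g4] at h3 hne ⊢
    rcases lt_trichotomy i' j' with h | rfl | h
    · have := pairwise_map_range sY h hj'
      rw [g2, g4] at h1 h2
      omega
    · exact absurd rfl hne
    · have := pairwise_map_range sY h hi'
      rw [g2, g4] at h1 h2
      omega
  rcases lt_or_gt_of_ne hij with h | h
  · rw [← key i j h hj, Covers]
    constructor
    · rintro (h1 | h1)
      · omega
      · exact h1.2
    · exact fun h1 => Or.inr ⟨by omega, h1⟩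
  · rw [or_comm, ← key j i h hi, Covers]
    constructor
    · rintro (h1 | h1)
      · exact h1.2
      · omega
    · exact fun h1 => Or.inl ⟨by omega, h1⟩

/-- Two points are not strictly comparable. -/
def NotComparable (x y : ℕ → ℕ) (i j : ℕ) : Prop :=
  ¬ (x i < x j ∧ y i < y j) ∧ ¬ (x j < x i ∧ y j < y i)

/-! ### Initialization and the whole algorithm -/

namespace RAM

open RAM.Cmd RAM.Expr

variable {B off : ℕ}

theorem notComparable_iff {M n : ℕ} {x y : ℕ → ℕ} (hx : ∀ i < n, x i ≤ M) (hy : ∀ i < n, y i ≤ M)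
    {i j : ℕ} (hi : i < n) (hj : j < n) (hij : i ≠ j) :
    (keyX M n (x i) (y i) i < keyX M n (x j) (y j) j ∧
        keyY M n (x j) (y j) j < keyY M n (x i) (y i) i ∨
      keyX M n (x j) (y j) j < keyX M n (x i) (y i) i ∧
        keyY M n (x i) (y i) i < keyY M n (x j) (y j) j) ↔ NotComparable x y i j := by
  have key : ∀ i j, i < n → j < n → keyX M n (x i) (y i) i < keyX M n (x j) (y j) j →
      x i ≤ x j := by
    intro i j hi hj hk
    by_contra h
    have : keyX M n (x j) (y j) j < keyX M n (x i) (y i) i := by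
      refine (mul_add_lt_mul (mul_add_lt_mul (b := x i) (by omega) (by omega)) hj).trans_le ?_
      exact (Nat.mul_le_mul_right n (Nat.le_add_right _ _)).trans (Nat.le_add_right _ _)
    omega
  rcases lt_trichotomy (keyX M n (x i) (y i) i) (keyX M n (x j) (y j) j) with h | h | h
  · have h1 := key i j hi hj h
    have h2 := keyY_lt_iff (hx i hi) (hy i hi) (hx j hj) (hy j hj) hi hj h
    rw [NotComparable, ← h2]
    constructor
    · rintro (h3 | h3)
      · exact ⟨h3.2, by omega⟩
      · omega
    · exact fun h3 => Or.inl ⟨h, h3.1⟩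
  · exact absurd (keyX_inj hi hj h) hij
  · have h1 := key j i hj hi h
    have h2 := keyY_lt_iff (hx j hj) (hy j hj) (hx i hi) (hy i hi) hj hi h
    rw [NotComparable, ← h2]
    constructor
    · rintro (h3 | h3)
      · omega
      · exact ⟨by omega, h3.2⟩
    · exact fun h3 => Or.inr ⟨h, h3.2⟩

/-- The initial frontier. -/
def initLevels : Cmd :=
  assign .p (.lit 1) ;; assign .q (.lit 1) ;; assign .pp (.lit 1) ;; assign .par (.lit 0) ;;
  assign .qn (.lit 0) ;; assign .cnt (.lit 1) ;; store .Y (.lit 2) (.lit 1)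

theorem wp_initLevels {N : ℕ} {P Q T R S : ℕ → ℕ} (h : PermData N P Q T R S) {s : St}
    (hs : s.a .P = P ∧ s.a .Q = Q ∧ s.a .T = T ∧ s.a .R = R ∧ s.a .S = S) (hm : s.v .m = N)
    (hY : ∀ i, s.a .Y i = 0) (hD : s.a .ND 2 = 0) (hB : off + 16 * 3 ≤ B) :
    initLevels.wp B off (fun s' => s'.clk ≤ s.clk + 7 ∧ LevelStart N P Q T R S 0 1 1 1 0 s') s := by
  have hN := h.two_le
  have hT := h.T_at 1 le_rfl (by omega)
  simp only [initLevels, wp_seq_iff, wp_assign, wp_store, ok, eval, true_and]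
  repeat refine ⟨by omega, ?_⟩
  refine ⟨by simp, ?_⟩
  -- Cell 2 belongs to column 1 and parity 0: the only stored frontier is `(1, 1)`, and its node is
  -- the root 0.
  have hcell : ∀ X, Function.update (s.a .Y) 2 1 (2 * X + 0) = if X = 1 then 1 else 0 := by
    intro X
    rw [Function.update_apply, hY]
    split_ifs <;> first | rfl | omega
  have hcell' : ∀ X, Function.update (s.a .Y) 2 1 (2 * X + (1 - 0)) = 0 := by
    intro X
    rw [Function.update_of_ne (by omega), hY]
  have root : ∀ A B : ℕ → ℕ, Node N P T R A B 1 0 0 1 1 := fun A B =>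
    ⟨by omega, [], .nil, h.sound_root⟩
  constructor <;> try simp only [St.put_v, St.set_v, St.put_a, St.set_a, reduceCtorEq, ↓reduceIte, hcell, hcell']
  · simp [Static, hs, hm]
  · omega
  · omega
  · omega
  · omega
  · omega
  · exact hT.1
  · exact one_ne_zero
  · intro X; split_ifs <;> omega
  · intro X; omega
  · intro X _ hX
    split_ifs at hX ⊢ with h1
    · subst h1
      simpa [hD] using root _ _
    · exact absurd rfl hX
  · intro X _ hX; exact absurd rfl hX
  · exact ⟨1, root _ _⟩
  · omega
  · intro X Y hr
    cases hr
    exact ⟨1, by simp⟩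
  · intro c' X Y l b hc'; simp at hc'
  · intro c' hc'; omega

/-- The whole algorithm. -/
def solve : Cmd :=
  assign .n (.io (.lit 0)) ;; assign .b (.add (.var .n) (.lit 2)) ;;
  assign .m (.add (.var .n) (.lit 2)) ;; readMax ;; readFlip ;; makeKeys ;; radixSort .KX .OX ;;
  radixSort .KY .OY ;; makePerm ;; makeTables ;; initLevels ;; levels ;; output

set_option maxHeartbeats 1000000 in
theorem wp_solve {n M E : ℕ} {s : St} (hn : s.io 0 = n) (ha : ∀ k i, s.a k i = 0)
    (hclk : s.clk = 0) (hoff : off = 4 * n + 8) (hM : ∀ i < 4 * n, s.io (i + 1) ≤ M)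
    (hE : (M + 1) * (M + 1) * (n + 1) ≤ (n + 2) ^ E) (hE2 : 1 ≤ E)
    (hB : 1000 * (n + 2) ^ (E + 1) ≤ B) :
    solve.wp B off (fun s' => s'.clk ≤ (40 * E + 400) * (n + 2) ∧ s'.io 0 + 1 ≤ off ∧
      ∃ w, (∀ i < 4 * n, s.io (i + 1) ≤ w) ∧
      Solves n (NotComparable (fun i => s.io (4 * i + 1)) fun i =>
        if (s.io 1 < s.io 3 ↔ s.io 2 < s.io 4) then s.io (4 * i + 2) else w - s.io (4 * i + 2))
        ((List.range (s'.io 0)).map fun a => s'.io (a + 1))) s := by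
  -- The bucket table has `(n + 2) ^ 2` cells; because `1 ≤ E`, the assumed word size covers their
  -- addresses.
  have hpow : (n + 2) * (n + 2) ≤ (n + 2) ^ (E + 1) := by
    rw [← pow_two]; exact Nat.pow_le_pow_right (by omega) (by omega)
  have hpow' : (n + 2) ^ E ≤ (n + 2) ^ (E + 1) := Nat.pow_le_pow_right (by omega) (by omega)
  have hsq : 2 * (n + 2) ≤ (n + 2) * (n + 2) := Nat.mul_le_mul_right _ (by omega)
  have hB2 : off + 16 * ((n + 2) * (n + 2) + (n + 2) + 1) ≤ B := by omega
  have hB3 : off + 16 * (20 * (n + 2) + 40) ≤ B := by omega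
  simp only [solve, wp_seq_iff (c := assign _ _), wp_assign, ok, eval, true_and, St.set_v,
    reduceCtorEq, ↓reduceIte, hn]
  refine ⟨by omega, by omega, by omega, ?_⟩
  obtain ⟨s0, hs0⟩ : ∃ s0, s0 = ((s.set .n n).set .b (n + 2)).set .m (n + 2) := ⟨_, rfl⟩
  rw [← hs0]
  have v0 : s0.v .n = n ∧ s0.v .b = n + 2 ∧ s0.v .m = n + 2 := by simp [hs0]
  have i0 : s0.io = s.io := by simp [hs0]
  have a0 : s0.a = s.a := by simp [hs0]
  have c0 : s0.clk = 3 := by simp [hs0, hclk]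
  clear hs0
  refine wp_seq (wp_frame (wp_readMax v0.1 hoff (by omega) (by rw [i0]; exact hM))) ?_
  rintro s1 ⟨⟨c1, w1, m1⟩, f1, g1, h1⟩
  replace h1 : s1.io = s.io := (h1 rfl).trans i0
  rw [i0] at m1
  refine wp_seq (wp_frame (wp_readFlip (by omega) (by omega))) ?_
  rintro s2 ⟨⟨c2, fl2⟩, f2, g2, h2⟩
  rw [h1] at fl2
  replace h2 : s2.io = s.io := (h2 rfl).trans h1
  have hw2 : s2.v .w = s1.v .w := f2 .w rfl
  set w := s1.v .w
  -- Keys are formed with the actual maximum `w`; the machine knows neither `M` nor `E`.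
  have hwM : (w + 1) * (w + 1) * (n + 1) ≤ (M + 1) * (M + 1) * (n + 1) := by gcongr
  set x : ℕ → ℕ := fun i => s.io (4 * i + 1)
  set y : ℕ → ℕ := fun i =>
    if (s.io 1 < s.io 3 ↔ s.io 2 < s.io 4) then s.io (4 * i + 2) else w - s.io (4 * i + 2)
  have hx : ∀ i < n, x i ≤ w := fun i hi => m1 _ (by omega)
  have hy : ∀ i < n, y i ≤ w := fun i hi => by
    have := m1 (4 * i + 1) (by omega)
    simp only [y]
    split_ifs
    · exact this
    · omega
  have n2 : s2.v .n = n := (f2 .n rfl).trans ((f1 .n rfl).trans v0.1)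
  refine wp_seq (wp_frame (wp_makeKeys (x := x) (y := y) n2 hw2 rfl hoff (by rw [h2]; exact m1)
    (by omega) (by omega) (fun i _ => by rw [h2]) (fun i _ => ?_))) ?_
  · rw [fl2, h2]
    simp only [y]
    split_ifs <;> first | rfl | omega
  rintro s3 ⟨⟨c3, km3, k3⟩, f3, g3, -⟩
  have z3 : ∀ k, k ≠ .KX → k ≠ .KY → ∀ i, s3.a k i = 0 := by
    intro k e1 e2 i
    rw [g3 k (by simp [makeKeys, skip, e1.symm, e2.symm]), g2 k rfl, g1 k rfl, a0, ha]
  have n3 : s3.v .n = n := (f3 .n rfl).trans n2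
  have b3 : s3.v .b = n + 2 :=
    (f3 .b rfl).trans ((f2 .b rfl).trans ((f1 .b rfl).trans v0.2.1))
  have m3 : s3.v .m = n + 2 :=
    (f3 .m rfl).trans ((f2 .m rfl).trans ((f1 .m rfl).trans v0.2.2))
  have hkm : (w + 1) * (w + 1) * n ≤ (n + 2) ^ E :=
    (Nat.mul_le_mul_left _ (by omega)).trans (hwM.trans hE)
  refine wp_seq (wp_frame (wp_radixSort (E := E) (by decide) (by decide) (by decide) n3 b3 rfl
    (z3 .CNT (by decide) (by decide)) hB2 (fun i hi => ?_) (by rw [km3]; exact hkm) (by omega))) ?_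
  · rw [(k3 i hi).1, km3]; exact keyX_lt (hx i hi) hi
  rintro s4 ⟨⟨c4, z4, p4, q4⟩, f4, g4, -⟩
  refine wp_seq (wp_frame (wp_radixSort (E := E) (by decide) (by decide) (by decide)
    ((f4 .n rfl).trans n3) ((f4 .b rfl).trans b3) rfl z4 hB2 (fun i hi => ?_)
    (by rw [f4 .km rfl, km3]; exact hkm) (by omega))) ?_
  · rw [g4 .KY rfl, (k3 i hi).2, f4 .km rfl, km3]; exact keyY_lt (hy i hi) hi
  rintro s5 ⟨⟨c5, -, p5, q5⟩, f5, g5, -⟩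
  rw [g4 .KY rfl] at q5
  rw [← g5 .OX rfl] at p4 q4
  refine wp_seq (wp_frame (wp_makePerm ((f5 .n rfl).trans ((f4 .n rfl).trans n3))
    ((f5 .m rfl).trans ((f4 .m rfl).trans m3)) rfl rfl p4 p5 (by omega))) ?_
  rintro s6 ⟨⟨c6, r1, r2, r3, r4, r5, r6, r7⟩, f6, g6, -⟩
  have m6 : s6.v .m = n + 2 := (f6 .m rfl).trans ((f5 .m rfl).trans ((f4 .m rfl).trans m3))
  have z6 : ∀ k ∈ [Arr.T, .R, .Y, .ND], ∀ i, s6.a k i = 0 := by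
    intro k hk i
    simp only [List.mem_cons, List.not_mem_nil, or_false] at hk
    rcases hk with rfl | rfl | rfl | rfl <;>
      rw [g6 _ rfl, g5 _ rfl, g4 _ rfl, z3 _ (by decide) (by decide)]
  refine wp_seq (wp_frame (wp_makeTables m6 (z6 .T (by simp) 0) (z6 .R (by simp) 0) (by omega))) ?_
  rintro s7 ⟨⟨c7, t7⟩, f7, g7, -⟩
  have hcase : ∀ v, 1 ≤ v → v ≤ n + 2 → v = 1 ∨ v = n + 2 ∨ ∃ i < n, v = i + 2 := by
    intro v e1 e2
    rcases Nat.eq_or_lt_of_le e1 with e | e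
    · exact Or.inl e.symm
    · rcases Nat.eq_or_lt_of_le e2 with e' | e'
      · exact Or.inr (Or.inl e')
      · exact Or.inr (Or.inr ⟨v - 2, by omega, by omega⟩)
  have perm : PermData (n + 2) (s6.a .P) (s6.a .Q) (s7.a .T) (s7.a .R) (s7.a .S) := by
    refine t7.permData (by omega) ?_ ?_ ?_ ?_ r4 r6
    · intro v e1 e2
      rcases hcase v e1 e2 with rfl | rfl | ⟨i, hi, rfl⟩
      · omega
      · omega
      · obtain ⟨j, hj, e3, -⟩ := r1 i hi
        omega
    · intro v e1 e2
      rcases hcase v e1 e2 with rfl | rfl | ⟨i, hi, rfl⟩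
      · omega
      · omega
      · obtain ⟨j, hj, e3, -⟩ := r2 i hi
        omega
    · intro v e1 e2
      rcases hcase v e1 e2 with rfl | rfl | ⟨i, hi, rfl⟩
      · rw [r5, r4]
      · rw [r7, r6]
      · obtain ⟨j, hj, e3, e4⟩ := r2 i hi
        rw [e3, e4]
    · intro v e1 e2
      rcases hcase v e1 e2 with rfl | rfl | ⟨i, hi, rfl⟩
      · rw [r4, r5]
      · rw [r6, r7]
      · exact r3 i hi
  refine wp_seq (wp_frame (wp_initLevels perm ⟨g7 .P rfl, g7 .Q rfl, rfl, rfl, rfl⟩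
    ((f7 .m rfl).trans m6) (fun i => (congrFun (g7 .Y rfl) i).trans (z6 .Y (by simp) i))
    ((congrFun (g7 .ND rfl) 2).trans (z6 .ND (by simp) 2)) (by omega))) ?_
  rintro s8 ⟨⟨c8, L8⟩, f8, g8, -⟩
  refine wp_seq (wp_frame (wp_levels perm hB3 L8)) ?_
  rintro s9 ⟨⟨⟨c, pp, q, par, hc, L9⟩, c9⟩, f9, g9, -⟩
  obtain ⟨d1, Lst, d2, d3⟩ := L9.cur _ L9.pp_le L9.F_p
  have hcnt := L9.cnt_le
  have hlen := d3.1
  refine wp_mono ?_ (wp_output (N := n + 2) (L := Lst) L9.stat.2.1 L9.stat.2.2.2.2.2 L9.par_le d2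
    (by omega) (by omega) hB3)
  rintro s10 ⟨c10, o1, o2⟩
  refine ⟨?_, by omega, w, m1, ?_⟩
  · rw [Nat.add_mul]
    have e1 : (E + 1) * (20 * (n + 2)) = 20 * (E * (n + 2)) + 20 * (n + 2) := by ring
    have e2 : 40 * E * (n + 2) = 40 * (E * (n + 2)) := by ring
    omega
  · rw [o2]
    have hOX : s9.a .OX = s5.a .OX := by
      rw [g9 .OX rfl, g8 .OX rfl, g7 .OX rfl, g6 .OX rfl]
    rw [hOX]
    have O1 : ∀ i < n, s5.a .OX i < n := fun i hi => by
      have := (p4.mem_iff (a := s5.a .OX i)).1 (List.mem_map_of_mem (List.mem_range.2 hi))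
      simpa using this
    have O3 : ∀ i < n, ∀ j < n, s5.a .OX i = s5.a .OX j → i = j := fun i hi i' hi' he =>
      List.inj_on_of_nodup_map (p4.nodup_iff.2 List.nodup_range) (List.mem_range.2 hi)
        (List.mem_range.2 hi') he
    refine solves_of_sound perm p4 (fun i j hi hj hij => ?_) d3 L9.not_last
    rw [covers_iff_of_sorted p4 q4 q5 ?_ ?_ r1 hi hj hij]
    · rw [(k3 _ (O1 i hi)).1, (k3 _ (O1 i hi)).2, (k3 _ (O1 j hj)).1, (k3 _ (O1 j hj)).2]
      exact notComparable_iff hx hy (O1 i hi) (O1 j hj) fun e => hij (O3 i hi j hj e)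
    · intro i hi j hj he
      rw [(k3 i hi).1, (k3 j hj).1] at he
      exact keyX_inj hi hj he
    · intro i hi j hj he
      rw [(k3 i hi).2, (k3 j hj).2] at he
      exact keyY_inj hi hj he

end RAM

/-! ### L-frames through a common vertical and a common horizontal line -/

namespace LFrame

theorem mem_carrier {L : LFrame} {p : ℝ × ℝ} : p ∈ L.carrier ↔
    p.1 ∈ Set.uIcc L.cx L.hx ∧ p.2 = L.cy ∨ p.1 = L.cx ∧ p.2 ∈ Set.uIcc L.cy L.vy := by
  rw [carrier, ← Prod.image_mk_segment_left, ← Prod.image_mk_segment_right, segment_eq_uIcc,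
    segment_eq_uIcc]
  obtain ⟨u, v⟩ := p
  simp only [Set.mem_union, Set.mem_image, Prod.mk.injEq, existsAndEq, true_and, and_true]
  constructor
  · rintro (⟨h1, h2⟩ | ⟨h1, h2⟩)
    · exact Or.inl ⟨h1, h2.symm⟩
    · exact Or.inr ⟨h2.symm, h1⟩
  · rintro (⟨h1, h2⟩ | ⟨h1, h2⟩)
    · exact Or.inl ⟨h1, h2.symm⟩
    · exact Or.inr ⟨h2, h1.symm⟩

/-- Both arms stay within the horizontal extent of the frame, the vertical arm being over the
corner. -/
theorem mem_uIcc_of_meets_vertical {L : LFrame} {a : ℝ}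
    (h : (L.carrier ∩ {p : ℝ × ℝ | p.1 = a}).Nonempty) : a ∈ Set.uIcc L.cx L.hx := by
  obtain ⟨p, h1, rfl⟩ := h
  rcases mem_carrier.1 h1 with h2 | h2
  · exact h2.1
  · rw [h2.1]; exact Set.left_mem_uIcc

theorem mem_uIcc_of_meets_horizontal {L : LFrame} {b : ℝ}
    (h : (L.carrier ∩ {p : ℝ × ℝ | p.2 = b}).Nonempty) : b ∈ Set.uIcc L.cy L.vy := by
  obtain ⟨p, h1, rfl⟩ := h
  rcases mem_carrier.1 h1 with h2 | h2
  · rw [h2.2]; exact Set.left_mem_uIcc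
  · exact h2.2

/-- The corner of `A` is strictly below that of `B` in the product order that belongs to the type
of `A`. -/
def Below (A B : LFrame) : Prop :=
  A.cx < B.cx ∧ if (A.cx < A.hx ↔ A.cy < A.vy) then A.cy < B.cy else B.cy < A.cy

/-- L-frames of the same type that meet common vertical and horizontal lines intersect if and only
if their corners are not strictly comparable. -/
theorem inter_nonempty_iff {A B : LFrame} (hAB : A.SameType B) {a b : ℝ}
    (ha : a ∈ Set.uIcc A.cx A.hx) (ha' : a ∈ Set.uIcc B.cx B.hx) (hb : b ∈ Set.uIcc A.cy A.vy)
    (hb' : b ∈ Set.uIcc B.cy B.vy) :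
    (A.carrier ∩ B.carrier).Nonempty ↔ ¬ A.Below B ∧ ¬ B.Below A := by
  have hcross : ∀ {A B : LFrame}, B.cx ∈ Set.uIcc A.cx A.hx → A.cy ∈ Set.uIcc B.cy B.vy →
      (A.carrier ∩ B.carrier).Nonempty := fun h1 h2 =>
    ⟨(_, _), mem_carrier.2 (Or.inl ⟨h1, rfl⟩), mem_carrier.2 (Or.inr ⟨rfl, h2⟩)⟩
  -- Crossing of the horizontal arm of one frame with the vertical arm of the other.
  have suff : (B.cx ∈ Set.uIcc A.cx A.hx ∧ A.cy ∈ Set.uIcc B.cy B.vy ∨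
      A.cx ∈ Set.uIcc B.cx B.hx ∧ B.cy ∈ Set.uIcc A.cy A.vy) →
      (A.carrier ∩ B.carrier).Nonempty := by
    rintro (h | h)
    · exact hcross h.1 h.2
    · rw [Set.inter_comm]; exact hcross h.1 h.2
  -- Parallel arms can meet only if they lie on the same line; perpendicular ones meet only in a
  -- crossing.
  have nec : (A.carrier ∩ B.carrier).Nonempty → A.cy = B.cy ∨ A.cx = B.cx ∨
      (B.cx ∈ Set.uIcc A.cx A.hx ∧ A.cy ∈ Set.uIcc B.cy B.vy) ∨
      (A.cx ∈ Set.uIcc B.cx B.hx ∧ B.cy ∈ Set.uIcc A.cy A.vy) := by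
    rintro ⟨p, h1, h2⟩
    rcases mem_carrier.1 h1 with ⟨g1, g2⟩ | ⟨g1, g2⟩ <;>
      rcases mem_carrier.1 h2 with ⟨k1, k2⟩ | ⟨k1, k2⟩
    · exact Or.inl (g2.symm.trans k2)
    · exact Or.inr (Or.inr (Or.inl ⟨k1 ▸ g1, g2 ▸ k2⟩))
    · exact Or.inr (Or.inr (Or.inr ⟨g1 ▸ k1, k2 ▸ g2⟩))
    · exact Or.inr (Or.inl (g1.symm.trans k1))
  obtain ⟨t1, t2⟩ := hAB
  have hne1 := A.hx_ne
  have hne2 := A.vy_ne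
  unfold Below
  by_cases hr : A.cx < A.hx <;> by_cases hu : A.cy < A.vy
  all_goals
    have hr' := hr
    have hu' := hu
    rw [t1] at hr'
    rw [t2] at hu'
    simp only [hr, hu, hr', hu', ↓reduceIte, iff_true, iff_self, iff_false, not_true_eq_false]
    try rw [not_lt] at hr hr'
    try rw [not_lt] at hu hu'
    clear t1 t2 hcross
    first | rw [Set.uIcc_of_le hr.le] at * | rw [Set.uIcc_of_ge hr] at *
    first | rw [Set.uIcc_of_le hr'.le] at * | rw [Set.uIcc_of_ge hr'] at *
    first | rw [Set.uIcc_of_le hu.le] at * | rw [Set.uIcc_of_ge hu] at *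
    first | rw [Set.uIcc_of_le hu'.le] at * | rw [Set.uIcc_of_ge hu'] at *
    simp only [Set.mem_Icc] at ha ha' hb hb' suff nec
    constructor
    · intro hne
      rcases nec hne with h | h | h | h <;> constructor <;> rintro ⟨g1, g2⟩ <;> linarith
    · rintro ⟨n1, n2⟩
      -- The values `a` and `b` lie in the extents of both frames, so the arms of incomparable
      -- corners are long enough to cross.
      apply suff
      rcases lt_trichotomy A.cx B.cx with hx | hx | hx <;>
        rcases lt_trichotomy A.cy B.cy with hy | hy | hy <;>
        first
          | (exfalso; apply n1; constructor <;> assumption)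
          | (exfalso; apply n2; constructor <;> assumption)
          | (left; refine ⟨⟨?_, ?_⟩, ?_, ?_⟩ <;> linarith)
          | (right; refine ⟨⟨?_, ?_⟩, ?_, ?_⟩ <;> linarith)

end LFrame

/-! ### The intersection graph in terms of the input words -/

namespace List

theorem getD_flatten_of_length_eq {m : ℕ} {l : List (List ℕ)} (h : ∀ w ∈ l, w.length = m) {i r : ℕ}
    (hr : r < m) : l.flatten.getD (m * i + r) 0 = (l.getD i []).getD r 0 := by
  induction l generalizing i with
  | nil => simp
  | cons w l ih =>
    have hw : w.length = m := h w mem_cons_self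
    rw [flatten_cons]
    cases i with
    | zero => rw [Nat.mul_zero, Nat.zero_add, getD_append _ _ _ _ (by omega), getD_cons_zero]
    | succ i =>
      have e : m * (i + 1) + r - w.length = m * i + r := by rw [hw, Nat.mul_succ]; omega
      rw [getD_append_right _ _ _ _ (by rw [hw, Nat.mul_succ]; omega), e, getD_cons_succ]
      exact ih fun u hu => h u (mem_cons_of_mem _ hu)

end List

namespace LFrame

variable {n : ℕ} {F : Fin n → LFrame} {f g : ℝ → ℕ}

theorem inputWords_getD_zero : (inputWords F f g).getD 0 0 = n := rfl

theorem inputWords_length : (inputWords F f g).length = 4 * n + 1 := by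
  rw [inputWords, List.length_cons, List.length_flatten]
  simp [List.map_ofFn, Function.comp_def, Nat.mul_comm]

theorem inputWords_getD (i : Fin n) {r : ℕ} (hr : r < 4) : (inputWords F f g).getD (4 * i + r + 1) 0 =
    [f (F i).cx, g (F i).cy, f (F i).hx, g (F i).vy].getD r 0 := by
  rw [inputWords, List.getD_cons_succ, List.getD_flatten_of_length_eq (m := 4) _ hr]
  · congr 1
    rw [List.getD_eq_getElem _ _ (by simp), List.getElem_ofFn]
  · simp [List.mem_ofFn]

theorem cx_mem (i : Fin n) : (F i).cx ∈ xCoords F := Or.inl ⟨i, rfl⟩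
theorem hx_mem (i : Fin n) : (F i).hx ∈ xCoords F := Or.inr ⟨i, rfl⟩
theorem cy_mem (i : Fin n) : (F i).cy ∈ yCoords F := Or.inl ⟨i, rfl⟩
theorem vy_mem (i : Fin n) : (F i).vy ∈ yCoords F := Or.inr ⟨i, rfl⟩

theorem le_of_mem_inputWords {M : ℕ} (hf : ∀ x ∈ xCoords F, f x ≤ M)
    (hg : ∀ y ∈ yCoords F, g y ≤ M) {w : ℕ} (hw : w ∈ inputWords F f g) : w = n ∨ w ≤ M := by
  simp only [inputWords, List.mem_cons, List.mem_flatten, List.mem_ofFn] at hw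
  rcases hw with hw | ⟨_, ⟨i, rfl⟩, hw⟩
  · exact Or.inl hw
  · right
    simp only [List.mem_cons, List.not_mem_nil, or_false] at hw
    rcases hw with rfl | rfl | rfl | rfl
    exacts [hf _ (cx_mem i), hg _ (cy_mem i), hf _ (hx_mem i), hg _ (vy_mem i)]

theorem inputWords_getD_succ_le {M : ℕ} (hf : ∀ x ∈ xCoords F, f x ≤ M)
    (hg : ∀ y ∈ yCoords F, g y ≤ M) {i : ℕ} (hi : i < 4 * n) :
    (inputWords F f g).getD (i + 1) 0 ≤ M := by
  have h := inputWords_getD (F := F) (f := f) (g := g) ⟨i / 4, by omega⟩ (Nat.mod_lt i four_pos)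
  rw [Nat.div_add_mod] at h
  rw [h]
  have hr := Nat.mod_lt i four_pos
  interval_cases i % 4
  exacts [hf _ (cx_mem _), hg _ (cy_mem _), hf _ (hx_mem _), hg _ (vy_mem _)]

/-- The words that stand for the corners of the L-frames, with the second coordinates reversed in
two of the four types, determine the intersection graph. -/
theorem interGraph_adj_iff (hF : ∀ i j, (F i).SameType (F j)) {a b : ℝ}
    (ha : ∀ i, a ∈ Set.uIcc (F i).cx (F i).hx) (hb : ∀ i, b ∈ Set.uIcc (F i).cy (F i).vy)
    (hf : StrictMonoOn f (xCoords F)) (hg : StrictMonoOn g (yCoords F)) {w : ℕ} {e : Prop}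
    [Decidable e] (hw : ∀ i, g (F i).cy ≤ w)
    (he : ∀ i, e ↔ ((F i).cx < (F i).hx ↔ (F i).cy < (F i).vy)) {x y : ℕ → ℕ}
    (hx : ∀ i : Fin n, x i = f (F i).cx)
    (hy : ∀ i : Fin n, y i = if e then g (F i).cy else w - g (F i).cy) {i j : Fin n} :
    (interGraph F).Adj i j ↔ i ≠ j ∧ NotComparable x y i j := by
  have below : ∀ i j : Fin n, (F i).Below (F j) ↔ x i < x j ∧ y i < y j := by
    intro i j
    have hwi := hw i
    have hwj := hw j
    rw [Below, hx, hx, hy, hy, hf.lt_iff_lt (cx_mem i) (cx_mem j)]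
    refine and_congr_right fun _ => ?_
    -- The reversal `y ↦ w - y` strictly inverts the order because all values are at most `w`;
    -- otherwise truncation would create ties.
    by_cases h : e
    · rw [if_pos ((he i).1 h), if_pos h, if_pos h, hg.lt_iff_lt (cy_mem i) (cy_mem j)]
    · rw [if_neg fun h' => h ((he i).2 h'), if_neg h, if_neg h,
        ← hg.lt_iff_lt (cy_mem j) (cy_mem i)]
      omega
  refine and_congr_right fun _ => ?_
  rw [inter_nonempty_iff (hF i j) (ha i) (ha j) (hb i) (hb j), below, below]
  rfl

end LFrame

/-! ### Assembly of the main theorem -/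

theorem Solves.exists_isMinDominatingSet {n : ℕ} {G : SimpleGraph (Fin n)} {adj : ℕ → ℕ → Prop}
    {out : List ℕ} (h : Solves n adj out) (hG : ∀ {i j : Fin n}, G.Adj i j ↔ i ≠ j ∧ adj i j) :
    ∃ D : Finset (Fin n), IsMinDominatingSet G D ∧
      ∃ l : List (Fin n), l.Nodup ∧ l.toFinset = D ∧ out = l.map Fin.val := by
  obtain ⟨h1, h2, h3, h4⟩ := h
  obtain ⟨l, rfl⟩ : ∃ l : List (Fin n), out = l.map Fin.val :=
    ⟨out.pmap Fin.mk h2, by simp [List.map_pmap]⟩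
  have hl : l.Nodup := List.Nodup.of_map _ h1
  have hmem : ∀ i : Fin n, (i : ℕ) ∈ l.map Fin.val ↔ i ∈ l := fun i => by
    simp [Fin.val_inj]
  refine ⟨l.toFinset, ⟨fun v hv => ?_, fun E hE => ?_⟩, l, hl, rfl, rfl⟩
  · rw [List.mem_toFinset] at hv
    obtain ⟨j, hj, hvj⟩ := h3 v v.2 (by rwa [hmem])
    obtain ⟨u, hu, rfl⟩ := List.mem_map.1 hj
    refine ⟨u, List.mem_toFinset.2 hu, hG.2 ⟨?_, hvj⟩⟩
    rintro rfl
    exact hv hu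
  · rw [List.toFinset_card_of_nodup hl]
    have := h4 (E.map Fin.valEmbedding) (fun a ha => ?_) fun i hi hiE => ?_
    · simpa using this
    · obtain ⟨u, -, rfl⟩ := Finset.mem_map.1 ha
      exact u.2
    · obtain ⟨u, hu, huv⟩ := hE ⟨i, hi⟩ fun h => hiE (Finset.mem_map.2 ⟨_, h, rfl⟩)
      exact ⟨u, Finset.mem_map.2 ⟨u, hu, rfl⟩, (hG.1 huv).2⟩

theorem RAM.Computes.mono {P : RAM.Program} {input : List ℕ} {T T' B : ℕ} {Q Q' : List ℕ → Prop}
    (h : RAM.Computes P input T B Q) (hT : T ≤ T') (hQ : ∀ out, Q out → Q' out) :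
    RAM.Computes P input T' B Q' := by
  obtain ⟨t, ht, h1, h2, h3⟩ := h
  exact ⟨t, ht.trans hT, h1, h2, hQ _ h3⟩

theorem theorem4 :
    ∃ P : RAM.Program, ∀ k : ℕ, ∃ C : ℕ,
      ∀ (n : ℕ) (F : Fin n → LFrame) (f g : ℝ → ℕ),
        (∀ i j, (F i).SameType (F j)) →
        (∃ a : ℝ, ∀ i, ((F i).carrier ∩ {p : ℝ × ℝ | p.1 = a}).Nonempty) →
        (∃ b : ℝ, ∀ i, ((F i).carrier ∩ {p : ℝ × ℝ | p.2 = b}).Nonempty) →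
        StrictMonoOn f (LFrame.xCoords F) → (∀ x ∈ LFrame.xCoords F, f x ≤ (n + 1) ^ k) →
        StrictMonoOn g (LFrame.yCoords F) → (∀ y ∈ LFrame.yCoords F, g y ≤ (n + 1) ^ k) →
        RAM.Computes P (LFrame.inputWords F f g) (C * (n + 1)) (C * (n + 1) ^ C)
          (fun out => ∃ D : Finset (Fin n), IsMinDominatingSet (LFrame.interGraph F) D ∧
            ∃ l : List (Fin n), l.Nodup ∧ l.toFinset = D ∧ out = l.map Fin.val) := by
  refine ⟨RAM.solve.program, fun k => ?_⟩
  -- The program does not depend on `k`; only the bounds do. Keys are below `((n + 1) ^ k + 1) ^ 2 *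
  -- (n + 1)`, and each of the first two factors is at most `(n + 2) ^ (k + 1)`, so `2 * k + 3`
  -- digits in base `n + 2` suffice.
  obtain ⟨E, hE⟩ : ∃ E, E = 2 * k + 3 := ⟨_, rfl⟩
  -- The first summands bound the time, with a factor 2 from `n + 2 ≤ 2 * (n + 1)`. The last bounds
  -- the word size and also makes `C` at least `E + 1`, the exponent needed.
  obtain ⟨C, hC⟩ : ∃ C, C = 6 + RAM.solve.weight * ((40 * E + 400) * 2) + 1000 * 2 ^ (E + 1) :=
    ⟨_, rfl⟩
  refine ⟨C, fun n F f g hF hva hhb hf hfM hg hgM => ?_⟩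
  obtain ⟨a, hva⟩ := hva
  obtain ⟨b, hhb⟩ := hhb
  have hMpow : (n + 1) ^ k + 1 ≤ (n + 2) ^ (k + 1) := by
    have h1 : (n + 1) ^ k ≤ (n + 2) ^ k := Nat.pow_le_pow_left (by omega) k
    have h2 : 1 ≤ (n + 2) ^ k := Nat.one_le_pow _ _ (by omega)
    rw [pow_succ]
    nlinarith
  have hEM : ((n + 1) ^ k + 1) * ((n + 1) ^ k + 1) * (n + 1) ≤ (n + 2) ^ E := by
    have e : (n + 2) ^ E = (n + 2) ^ (k + 1) * (n + 2) ^ (k + 1) * (n + 2) := by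
      rw [hE, ← pow_add, ← pow_succ]; congr 1; ring
    rw [e]
    exact Nat.mul_le_mul (Nat.mul_le_mul hMpow hMpow) (by omega)
  have hB : 1000 * (n + 2) ^ (E + 1) ≤ C * (n + 1) ^ C := by
    have hlt : E + 1 < 2 ^ (E + 1) := Nat.lt_two_pow_self
    calc 1000 * (n + 2) ^ (E + 1) ≤ 1000 * (2 * (n + 1)) ^ (E + 1) :=
          Nat.mul_le_mul_left _ (Nat.pow_le_pow_left (by omega) _)
      _ = 1000 * 2 ^ (E + 1) * (n + 1) ^ (E + 1) := by rw [mul_pow, mul_assoc]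
      _ ≤ C * (n + 1) ^ C := Nat.mul_le_mul (by omega) (Nat.pow_le_pow_right (by omega) (by omega))
  have hE1 : n + 2 ≤ (n + 2) ^ (E + 1) := Nat.le_self_pow (by omega) _
  have hM1 : (n + 1) ^ k ≤ (n + 2) ^ (E + 1) := by
    refine le_trans (Nat.le_of_succ_le hMpow) (Nat.pow_le_pow_right (by omega) (by omega))
  have hwords : ∀ w ∈ LFrame.inputWords F f g, w ≤ C * (n + 1) ^ C := fun w hw => by
    rcases LFrame.le_of_mem_inputWords hfM hgM hw with h | h <;> omega
  have hwp := RAM.wp_solve (n := n) (M := (n + 1) ^ k) (E := E) (off := 4 * n + 8)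
    (B := C * (n + 1) ^ C) (s := RAM.St.start (LFrame.inputWords F f g)) rfl (fun _ _ => rfl) rfl rfl
    (fun i hi => ?_) hEM (by omega) hB
  · refine (RAM.Cmd.computes (K := (40 * E + 400) * (n + 2)) hwords ?_ ?_
      (RAM.Cmd.wp_mono ?_ hwp)).mono ?_ fun out h => h
    · rw [LFrame.inputWords_getD_zero]; omega
    · rw [LFrame.inputWords_getD_zero, LFrame.inputWords_length]; omega
    · rintro s ⟨h1, h2, w, h3, h4⟩
      refine ⟨h1, h2, h4.exists_isMinDominatingSet fun {i j} => ?_⟩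
      have word : ∀ (i : Fin n) (r : ℕ), r < 4 →
          (RAM.St.start (LFrame.inputWords F f g)).io (4 * i + r + 1) =
            [f (F i).cx, g (F i).cy, f (F i).hx, g (F i).vy].getD r 0 := fun i r hr =>
        LFrame.inputWords_getD i hr
      refine LFrame.interGraph_adj_iff (w := w) (e :=
          ((RAM.St.start (LFrame.inputWords F f g)).io 1 <
            (RAM.St.start (LFrame.inputWords F f g)).io 3 ↔
          (RAM.St.start (LFrame.inputWords F f g)).io 2 <
            (RAM.St.start (LFrame.inputWords F f g)).io 4)) hF
        (fun i => LFrame.mem_uIcc_of_meets_vertical (hva i))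
        (fun i => LFrame.mem_uIcc_of_meets_horizontal (hhb i)) hf hg (fun i => ?_) (fun i => ?_)
        (fun i => ?_) (fun i => ?_)
      · have := h3 (4 * i + 1) (by omega)
        rwa [word i 1 (by omega)] at this
      -- The type is read off the first frame, which exists as soon as there is any `i`; all frames
      -- share it, and `f` and `g` preserve the comparisons.
      · have hn : 0 < n := i.pos
        have e := word ⟨0, hn⟩
        simp only [Nat.mul_zero, Nat.zero_add] at e
        have e0 := e 0 (by omega)
        have e1 := e 1 (by omega)
        have e2 := e 2 (by omega)
        have e3 := e 3 (by omega)
        simp only [Nat.zero_add, Nat.reduceAdd] at e0 e1 e2 e3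
        rw [e0, e1, e2, e3, (hF i ⟨0, hn⟩).1, (hF i ⟨0, hn⟩).2]
        exact iff_congr (hf.lt_iff_lt (LFrame.cx_mem _) (LFrame.hx_mem _))
          (hg.lt_iff_lt (LFrame.cy_mem _) (LFrame.vy_mem _))
      · exact word i 0 (by omega)
      · have e := word i 1 (by omega)
        simp only [add_assoc, Nat.reduceAdd] at e
        simp only [e]
        rfl
    · calc 6 + RAM.solve.weight * ((40 * E + 400) * (n + 2))
          ≤ 6 + RAM.solve.weight * ((40 * E + 400) * (2 * (n + 1))) := by gcongr; omega
        _ = 6 + RAM.solve.weight * ((40 * E + 400) * 2) * (n + 1) := by ring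
        _ ≤ C * (n + 1) := by
          generalize RAM.solve.weight * ((40 * E + 400) * 2) = W at hC ⊢
          have h1 : 6 + W * (n + 1) ≤ (6 + W) * (n + 1) := by
            rw [Nat.add_mul]; omega
          exact h1.trans (Nat.mul_le_mul_right _ (hC ▸ Nat.le_add_right _ _))
  · exact LFrame.inputWords_getD_succ_le hfM hgM hi
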